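/- **Setting.** Let $G$ be a semisimple Lie group with Lie algebra $\mathfrak g$ and Killing form $B$, and let $P\subset G$ be a parabolic subgroup, i.e. a closed subgroup whose Lie algebra is $\mathfrak p=\mathfrak g_0\oplus\dots\oplus\mathfrak g_k$ for some Lie algebra grading $\mathfrak g=\mathfrak g_{-k}\oplus\dots\oplus\mathfrak g_k$. A parabolic geometry of type $(G,P)$ is a smooth principal $P$-bundle $p:\mathcal G\to M$ over a smooth (Hausdorff, second countable) manifold together with a Cartan connection $\omega\in\Omega^1(\mathcal G,\mathfrak g)$, i.e. $\omega$ is a linear isomorphism on every tangent space of $\mathcal G$, is $P$-equivariant, and reproduces the generators of fundamental vector fields. For a finite-dimensional smooth representation $W$ of $P$ over $\mathbb K\in\{\mathbb R,\mathbb C\}$, let $WM=\mathcal G\times_PW$ and identify $\Gamma(WM)=C^\infty(\mathcal G,W)^P=\{f: f(u\cdot h)=h^{-1}\cdot f(u)\}$. The fundamental derivative $Df:\mathcal G\to\mathfrak g^*\otimes W$ of $f\in\Gamma(WM)$ is $Df(u)(X)=(\omega^{-1}(X)\cdot f)(u)$, and the curved Casimir operator is $\mathcal C=(B\otimes\mathrm{id}_W)\circ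 D^2:\Gamma(WM)\to\Gamma(WM)$, that is, $\mathcal C f=\sum_\ell D^2f(\xi_\ell,\xi^\ell)$ for bases $\{\xi_\ell\}$, $\{\xi^\ell\}$ of $\mathfrak g$ that are dual with respect to $B$. A family of linear operators between sections of bundles $WM$ and $\tilde WM$, one for each parabolic geometry of type $(G,P)$, is called natural if these are differential operators of finite order and commute with pullback along morphisms of parabolic geometries (principal bundle maps compatible with the Cartan connections). **Theorem 3.5.** Let $W$ be a finite-dimensional smooth representation of $P$ over $\mathbb K$ with a $P$-invariant filtration $W=W^0\supset W^1\supset\dots\supset W^N\supset W^{N+1}=\{0\}$ such that each subquotient $W^j/W^{j+1}$ is completely reducible. Fix $i\in\{0,\dots,N\}$ and an irreducible component (irreducible subrepresentation) $W'\subset W^i/W^{i+1}$. If $\mathbb K=\mathbb R$, assume in addition that whenever $V$ is $W'$ or an irreducible component of some $W^j/W^{j+1}$ with $j>i$, and $V$ admits a $P$-invariant complex structure, the curved Casimir operator acts by a real scalar on the sections of the bundle induced by $V$. Then on the bundle induced by $W'$, and on the bundles induced by the irreducible components of $W^j/W^{j+1}$ for $j>i$, the curved Casimir operator acts, on all parabolic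 geometries of type $(G,P)$, by scalars in $\mathbb K$. Let $\mu_0$ be the scalar for $W'$ and, for $j>i$, let $\mu^j_1,\dots,\mu^j_{n_j}$ be the (finitely many) different scalars for the irreducible components of $W^j/W^{j+1}$. Then the following hold. 1. The operators $L:=\prod_{j=i+1}^N\prod_{k=1}^{n_j}(\mathcal C-\mu^j_k)$ on $\Gamma(WM)$ form a natural operator. 2. $L$ descends to a natural operator $\bar L:\Gamma(W'M)\to\Gamma(W^iM)$. That is, denoting by $\pi:\Gamma(W^iM)\to\Gamma(W^iM/W^{i+1}M)$ the tensorial projection, every $\sigma\in\Gamma(W'M)$ is of the form $\pi(\hat\sigma)$ with $\hat\sigma\in\Gamma(W^iM)$, and $\bar L(\sigma)=L(\hat\sigma)\in\Gamma(W^iM)$ for every such $\hat\sigma$. 3. For all $\sigma\in\Gamma(W'M)$ one has $\pi(\bar L(\sigma))=\Big(\prod_{j=i+1}^N\prod_{k=1}^{n_j}(\mu_0-\mu^j_k)\Big)\,\sigma$. 4. If all the $\mu^j_k$ with $j>i$ are different from $\mu_0$, then $\bar L$ is a natural splitting operator: it is natural, it is injective on $\Gamma(W'M)$ for every parabolic geometry,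 and $\pi\circ\bar L$ is a nonzero constant multiple of the inclusion $\Gamma(W'M)\subset\Gamma(W^iM/W^{i+1}M)$. -/

import Mathlib

open scoped Manifold ContDiff

set_option linter.unusedSectionVars false

noncomputable section

namespace CurvedCasimir

section VectorValued

variable {𝕜 : Type*} [RCLike 𝕜]
  {E : Type*} [NormedAddCommGroup E] [NormedSpace ℝ E]
  {N : Type*} [TopologicalSpace N] [ChartedSpace E N]
  {E' : Type*} [NormedAddCommGroup E'] [NormedSpace ℝ E']
  {N' : Type*} [TopologicalSpace N'] [ChartedSpace E' N']
  {V : Type*} [NormedAddCommGroup V] [NormedSpace ℝ V]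
  {V' : Type*} [NormedAddCommGroup V'] [NormedSpace ℝ V']
  {W : Type*} [AddCommGroup W] [Module 𝕜 W] [FiniteDimensional 𝕜 W]
  {W' : Type*} [AddCommGroup W'] [Module 𝕜 W'] [FiniteDimensional 𝕜 W']

/-- The derivative of a function with values in a normed space, as an element of that space. -/
def vecDeriv (F : N → V) (x : N) (v : TangentSpace 𝓘(ℝ, E) x) : V :=
  mfderiv 𝓘(ℝ, E) 𝓘(ℝ, V) F x v

theorem vecDeriv_eq {F : N → V} {x : N} {F' : TangentSpace 𝓘(ℝ, E) x →L[ℝ] V}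
    (h : HasMFDerivAt 𝓘(ℝ, E) 𝓘(ℝ, V) F x F') (v : TangentSpace 𝓘(ℝ, E) x) :
    vecDeriv F x v = F' v := by
  unfold vecDeriv
  rw [h.mfderiv]
  rfl

theorem vecDeriv_add_right (F : N → V) (x : N) (v w : TangentSpace 𝓘(ℝ, E) x) :
    vecDeriv F x (v + w) = vecDeriv F x v + vecDeriv F x w :=
  map_add (mfderiv 𝓘(ℝ, E) 𝓘(ℝ, V) F x) v w

theorem vecDeriv_smul_right (F : N → V) (x : N) (c : ℝ) (v : TangentSpace 𝓘(ℝ, E) x) :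
    vecDeriv F x (c • v) = c • vecDeriv F x v :=
  map_smul (mfderiv 𝓘(ℝ, E) 𝓘(ℝ, V) F x) c v

theorem vecDeriv_add {F H : N → V} {x : N} (hF : MDifferentiableAt 𝓘(ℝ, E) 𝓘(ℝ, V) F x)
    (hH : MDifferentiableAt 𝓘(ℝ, E) 𝓘(ℝ, V) H x) (v : TangentSpace 𝓘(ℝ, E) x) :
    vecDeriv (F + H) x v = vecDeriv F x v + vecDeriv H x v :=
  vecDeriv_eq (hF.hasMFDerivAt.add hH.hasMFDerivAt) v

theorem vecDeriv_clm_comp (L : V →L[ℝ] V') {F : N → V} {x : N}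
    (hF : MDifferentiableAt 𝓘(ℝ, E) 𝓘(ℝ, V) F x) (v : TangentSpace 𝓘(ℝ, E) x) :
    vecDeriv (fun y => L (F y)) x v = L (vecDeriv F x v) :=
  vecDeriv_eq (HasMFDerivAt.comp x (L.hasMFDerivAt (x := F x)) hF.hasMFDerivAt) v

theorem vecDeriv_comp {F : N → V} {g : N' → N} {x : N'}
    (hF : MDifferentiableAt 𝓘(ℝ, E) 𝓘(ℝ, V) F (g x))
    (hg : MDifferentiableAt 𝓘(ℝ, E') 𝓘(ℝ, E) g x) (v : TangentSpace 𝓘(ℝ, E') x) :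
    vecDeriv (fun y => F (g y)) x v = vecDeriv F (g x) (mfderiv 𝓘(ℝ, E') 𝓘(ℝ, E) g x v) :=
  vecDeriv_eq (HasMFDerivAt.comp x hF.hasMFDerivAt hg.hasMFDerivAt) v

theorem contMDiff_vecDeriv [IsManifold 𝓘(ℝ, E) ∞ N] {F : N → V}
    (hF : ContMDiff 𝓘(ℝ, E) 𝓘(ℝ, V) ∞ F) {ξ : ∀ x : N, TangentSpace 𝓘(ℝ, E) x}
    (hξ : ContMDiff 𝓘(ℝ, E) 𝓘(ℝ, E).tangent ∞
      (fun x => (⟨x, ξ x⟩ : TangentBundle 𝓘(ℝ, E) N))) :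
    ContMDiff 𝓘(ℝ, E) 𝓘(ℝ, V) ∞ (fun x => vecDeriv F x (ξ x)) :=
  (contMDiff_snd_tangentBundle_modelSpace (n := ∞) V 𝓘(ℝ, V)).comp
    ((ContMDiff.contMDiff_tangentMap (m := ∞) hF (by simp)).comp hξ)

variable (𝕜 W) in
/-- Linear coordinates on a finite-dimensional vector space. They are used only to say what
smoothness and derivatives of `W`-valued functions are; nothing depends on their choice. -/
def coords : W ≃ₗ[𝕜] (Fin (Module.finrank 𝕜 W) → 𝕜) := (Module.finBasis 𝕜 W).equivFun

variable (𝕜 E) in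
/-- A function from a (real) manifold to the finite-dimensional `𝕜`-vector space `W` is smooth. -/
def SmoothVec (f : N → W) : Prop :=
  ContMDiff 𝓘(ℝ, E) 𝓘(ℝ, Fin (Module.finrank 𝕜 W) → 𝕜) ∞ (fun x => coords 𝕜 W (f x))

variable (𝕜) in
/-- The derivative `v · f ∈ W` of a smooth function `f : N → W` in the direction of the tangent
vector `v` at `x`. -/
def dirDeriv (f : N → W) (x : N) (v : TangentSpace 𝓘(ℝ, E) x) : W :=
  (coords 𝕜 W).symm (vecDeriv (fun y => coords 𝕜 W (f y)) x v)

/-- A `𝕜`-linear map in coordinates. -/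
def coordMap (A : W →ₗ[𝕜] W') :
    (Fin (Module.finrank 𝕜 W) → 𝕜) →L[ℝ] (Fin (Module.finrank 𝕜 W') → 𝕜) :=
  (LinearMap.toContinuousLinearMap
    ((coords 𝕜 W').toLinearMap ∘ₗ A ∘ₗ (coords 𝕜 W).symm.toLinearMap)).restrictScalars ℝ

theorem coordMap_coords (A : W →ₗ[𝕜] W') (w : W) :
    coordMap A (coords 𝕜 W w) = coords 𝕜 W' (A w) := by
  simp [coordMap]

theorem SmoothVec.mdiff {f : N → W} (hf : SmoothVec 𝕜 E f) (x : N) :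
    MDifferentiableAt 𝓘(ℝ, E) 𝓘(ℝ, Fin (Module.finrank 𝕜 W) → 𝕜)
      (fun x => coords 𝕜 W (f x)) x :=
  hf.mdifferentiable (by simp) x

theorem SmoothVec.comp_linear (A : W →ₗ[𝕜] W') {f : N → W} (hf : SmoothVec 𝕜 E f) :
    SmoothVec 𝕜 E (fun x => A (f x)) :=
  ((coordMap A).contMDiff.comp hf).congr fun x => (coordMap_coords A (f x)).symm

theorem SmoothVec.comp {f : N → W} (hf : SmoothVec 𝕜 E f) {g : N' → N}
    (hg : ContMDiff 𝓘(ℝ, E') 𝓘(ℝ, E) ∞ g) : SmoothVec 𝕜 E' (fun x => f (g x)) :=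
  ContMDiff.comp (g := fun x => coords 𝕜 W (f x)) hf hg

theorem dirDeriv_comp_linear (A : W →ₗ[𝕜] W') {f : N → W} (hf : SmoothVec 𝕜 E f)
    (x : N) (v : TangentSpace 𝓘(ℝ, E) x) :
    dirDeriv 𝕜 (fun y => A (f y)) x v = A (dirDeriv 𝕜 f x v) := by
  have h := vecDeriv_clm_comp (coordMap A) (hf.mdiff x) v
  simp only [coordMap_coords] at h
  unfold dirDeriv
  rw [h, LinearEquiv.symm_apply_eq, ← coordMap_coords, LinearEquiv.apply_symm_apply]

theorem SmoothVec.add {f g : N → W} (hf : SmoothVec 𝕜 E f) (hg : SmoothVec 𝕜 E g) :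
    SmoothVec 𝕜 E (f + g) :=
  (ContMDiff.add hf hg).congr fun x => by simp

theorem SmoothVec.zero : SmoothVec 𝕜 E (0 : N → W) :=
  (contMDiff_const (c := (0 : Fin (Module.finrank 𝕜 W) → 𝕜))).congr fun x => by simp

theorem dirDeriv_add {f g : N → W} (hf : SmoothVec 𝕜 E f) (hg : SmoothVec 𝕜 E g)
    (x : N) (v : TangentSpace 𝓘(ℝ, E) x) :
    dirDeriv 𝕜 (f + g) x v = dirDeriv 𝕜 f x v + dirDeriv 𝕜 g x v := by
  have h := vecDeriv_add (hf.mdiff x) (hg.mdiff x) v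
  have h2 : (fun y => coords 𝕜 W ((f + g) y)) =
      (fun y => coords 𝕜 W (f y)) + fun y => coords 𝕜 W (g y) := by
    funext y; simp
  unfold dirDeriv
  rw [h2, h, map_add]

theorem dirDeriv_add_right (f : N → W) (x : N) (v w : TangentSpace 𝓘(ℝ, E) x) :
    dirDeriv 𝕜 f x (v + w) = dirDeriv 𝕜 f x v + dirDeriv 𝕜 f x w := by
  unfold dirDeriv
  rw [vecDeriv_add_right, map_add]

theorem dirDeriv_smul_right (f : N → W) (x : N) (c : ℝ) (v : TangentSpace 𝓘(ℝ, E) x) :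
    dirDeriv 𝕜 f x (c • v) = (c : 𝕜) • dirDeriv 𝕜 f x v := by
  unfold dirDeriv
  rw [vecDeriv_smul_right, ← map_smul]
  congr 1
  exact RCLike.real_smul_eq_coe_smul (K := 𝕜) c _

theorem dirDeriv_comp {f : N → W} (hf : SmoothVec 𝕜 E f) {g : N' → N}
    (hg : ContMDiff 𝓘(ℝ, E') 𝓘(ℝ, E) ∞ g) (x : N') (v : TangentSpace 𝓘(ℝ, E') x) :
    dirDeriv 𝕜 (fun y => f (g y)) x v =
      dirDeriv 𝕜 f (g x) (mfderiv 𝓘(ℝ, E') 𝓘(ℝ, E) g x v) := by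
  unfold dirDeriv
  rw [vecDeriv_comp (F := fun y => coords 𝕜 W (f y)) (hf.mdiff (g x))
    (hg.mdifferentiable (by simp) x)]

theorem SmoothVec.dirDeriv [IsManifold 𝓘(ℝ, E) ∞ N] {f : N → W} (hf : SmoothVec 𝕜 E f)
    {ξ : ∀ x : N, TangentSpace 𝓘(ℝ, E) x}
    (hξ : ContMDiff 𝓘(ℝ, E) 𝓘(ℝ, E).tangent ∞
      (fun x => (⟨x, ξ x⟩ : TangentBundle 𝓘(ℝ, E) N))) :
    SmoothVec 𝕜 E (fun x => dirDeriv 𝕜 f x (ξ x)) :=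
  (contMDiff_vecDeriv hf hξ).congr fun x => by
    unfold CurvedCasimir.dirDeriv
    rw [LinearEquiv.apply_symm_apply]

end VectorValued

section LieGroups

universe u

variable {EG : Type*} [NormedAddCommGroup EG] [NormedSpace ℝ EG]
  {G : Type u} [TopologicalSpace G] [ChartedSpace EG G] [Group G]

instance instLieGroupMinSmoothness [LieGroup 𝓘(ℝ, EG) ∞ G] :
    LieGroup 𝓘(ℝ, EG) (minSmoothness ℝ 3) G := by
  rw [minSmoothness_of_isRCLikeNormedField]
  infer_instance

instance instFiniteDimensionalGroupLieAlgebra [FiniteDimensional ℝ EG] :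
    FiniteDimensional ℝ (GroupLieAlgebra 𝓘(ℝ, EG) G) :=
  inferInstanceAs (FiniteDimensional ℝ EG)

variable (EG) in
/-- The adjoint action `Ad(g) : 𝔤 → 𝔤`, the derivative of the conjugation by `g` at the identity. -/
def groupAd (g : G) : GroupLieAlgebra 𝓘(ℝ, EG) G →ₗ[ℝ] GroupLieAlgebra 𝓘(ℝ, EG) G where
  toFun X := mfderiv 𝓘(ℝ, EG) 𝓘(ℝ, EG) (fun x : G => g * x * g⁻¹) 1 X
  map_add' X Y := map_add (mfderiv 𝓘(ℝ, EG) 𝓘(ℝ, EG) (fun x : G => g * x * g⁻¹) 1) X Y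
  map_smul' c X := map_smul (mfderiv 𝓘(ℝ, EG) 𝓘(ℝ, EG) (fun x : G => g * x * g⁻¹) 1) c X

section Ad

variable [LieGroup 𝓘(ℝ, EG) ∞ G]

theorem contMDiff_conj (g : G) :
    ContMDiff 𝓘(ℝ, EG) 𝓘(ℝ, EG) ∞ (fun x : G => g * x * g⁻¹) :=
  (contMDiff_mul_right (a := g⁻¹)).comp (contMDiff_mul_left (a := g))

theorem mdiff_conj (g x : G) :
    MDifferentiableAt 𝓘(ℝ, EG) 𝓘(ℝ, EG) (fun x : G => g * x * g⁻¹) x :=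
  (contMDiff_conj g).mdifferentiable (by simp) x

/-- The differential of a conjugation, as an endomorphism of the model space. -/
def conjDeriv (g x : G) : EG →L[ℝ] EG :=
  mfderiv 𝓘(ℝ, EG) 𝓘(ℝ, EG) (fun y : G => g * y * g⁻¹) x

variable (EG) in
theorem conjDeriv_comp (g k x : G) (v : EG) :
    conjDeriv (EG := EG) g (k * x * k⁻¹) (conjDeriv k x v) = conjDeriv (g * k) x v := by
  have h := mfderiv_comp (I := 𝓘(ℝ, EG)) (I' := 𝓘(ℝ, EG)) (I'' := 𝓘(ℝ, EG)) x
    (mdiff_conj (EG := EG) g (k * x * k⁻¹)) (mdiff_conj (EG := EG) k x)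
  have h2 : (fun x : G => g * x * g⁻¹) ∘ (fun x : G => k * x * k⁻¹) =
      fun x : G => (g * k) * x * (g * k)⁻¹ := by
    funext y; simp [mul_assoc]
  rw [h2] at h
  unfold conjDeriv
  rw [h]
  rfl

theorem groupAd_apply (g : G) (X : GroupLieAlgebra 𝓘(ℝ, EG) G) :
    groupAd EG g X = conjDeriv (EG := EG) g 1 (show EG from X) := rfl

theorem groupAd_comp (g k : G) (X : GroupLieAlgebra 𝓘(ℝ, EG) G) :
    groupAd EG g (groupAd EG k X) = groupAd EG (g * k) X := by
  have h := conjDeriv_comp EG g k 1 X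
  rw [show k * 1 * k⁻¹ = 1 by simp] at h
  exact h

theorem groupAd_one (X : GroupLieAlgebra 𝓘(ℝ, EG) G) : groupAd EG (1 : G) X = X := by
  have h : (fun x : G => 1 * x * 1⁻¹) = id := by funext x; simp
  rw [groupAd_apply]
  unfold conjDeriv
  rw [h, mfderiv_id]
  rfl

/-- `Ad(g)` as a linear automorphism. -/
def groupAdEquiv (g : G) :
    GroupLieAlgebra 𝓘(ℝ, EG) G ≃ₗ[ℝ] GroupLieAlgebra 𝓘(ℝ, EG) G :=
  LinearEquiv.ofLinearMap (groupAd EG g) (groupAd EG g⁻¹)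
    (by ext X; simp [groupAd_comp, groupAd_one])
    (by ext X; simp [groupAd_comp, groupAd_one])

theorem conjDeriv_one (x : G) (v : EG) : conjDeriv (EG := EG) 1 x v = v := by
  have h : (fun x : G => 1 * x * 1⁻¹) = id := by funext x; simp
  unfold conjDeriv
  rw [h, mfderiv_id]
  rfl

theorem isInvertible_conjDeriv (g x : G) : (conjDeriv (EG := EG) g x).IsInvertible := by
  refine ⟨ContinuousLinearEquiv.equivOfInverse (conjDeriv g x) (conjDeriv g⁻¹ (g * x * g⁻¹))
    (fun v => ?_) (fun v => ?_), rfl⟩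
  · rw [conjDeriv_comp, inv_mul_cancel, conjDeriv_one]
  · have h := conjDeriv_comp EG g g⁻¹ (g * x * g⁻¹) v
    rw [show g⁻¹ * (g * x * g⁻¹) * g⁻¹⁻¹ = x by group] at h
    rw [h, mul_inv_cancel, conjDeriv_one]

theorem conjDeriv_mulInvariant (g x : G) (X : GroupLieAlgebra 𝓘(ℝ, EG) G) :
    conjDeriv (EG := EG) g x (mulInvariantVectorField X x) =
      mulInvariantVectorField (groupAd EG g X) (g * x * g⁻¹) := by
  have hL : ∀ a y : G, MDifferentiableAt 𝓘(ℝ, EG) 𝓘(ℝ, EG) (fun z : G => a * z) y :=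
    fun a y => (contMDiff_mul_left (I := 𝓘(ℝ, EG)) (n := ∞) (a := a)).mdifferentiable (by simp) y
  have h1 := mfderiv_comp_apply (I := 𝓘(ℝ, EG)) (I' := 𝓘(ℝ, EG)) (I'' := 𝓘(ℝ, EG)) (1 : G)
    (mdiff_conj (EG := EG) g (x * 1)) (hL x 1) X
  have h2 := mfderiv_comp_apply (I := 𝓘(ℝ, EG)) (I' := 𝓘(ℝ, EG)) (I'' := 𝓘(ℝ, EG)) (1 : G)
    (hL (g * x * g⁻¹) (g * 1 * g⁻¹)) (mdiff_conj (EG := EG) g 1) X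
  have h3 : (fun y : G => g * y * g⁻¹) ∘ (fun z => x * z) =
      (fun z : G => g * x * g⁻¹ * z) ∘ (fun y : G => g * y * g⁻¹) := by
    funext y; simp [mul_assoc]
  rw [h3, h2] at h1
  rw [show g * 1 * g⁻¹ = (1 : G) by simp, mul_one x] at h1
  exact h1.symm

theorem mpullback_conj (g x : G) (X : GroupLieAlgebra 𝓘(ℝ, EG) G) :
    VectorField.mpullback 𝓘(ℝ, EG) 𝓘(ℝ, EG) (fun y : G => g * y * g⁻¹)
      (mulInvariantVectorField (groupAd EG g X)) x = mulInvariantVectorField X x :=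
  ((isInvertible_conjDeriv (EG := EG) g x).inverse_apply_eq).2
    (conjDeriv_mulInvariant g x X).symm

theorem mulInvariantVectorField_at_one (X : GroupLieAlgebra 𝓘(ℝ, EG) G) :
    mulInvariantVectorField X (1 : G) = X := by
  have h : (fun x : G => 1 * x) = id := by funext x; simp
  unfold mulInvariantVectorField
  rw [h, mfderiv_id]
  rfl

theorem groupAd_lie [FiniteDimensional ℝ EG] (g : G) (X Y : GroupLieAlgebra 𝓘(ℝ, EG) G) :
    groupAd EG g ⁅X, Y⁆ = ⁅groupAd EG g X, groupAd EG g Y⁆ := by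
  have : CompleteSpace EG := FiniteDimensional.complete ℝ EG
  have h := VectorField.mpullback_mlieBracket (I := 𝓘(ℝ, EG)) (I' := 𝓘(ℝ, EG)) (n := ∞)
    (f := fun y : G => g * y * g⁻¹) (x₀ := 1)
    (mdifferentiableAt_mulInvariantVectorField (groupAd EG g X))
    (mdifferentiableAt_mulInvariantVectorField (groupAd EG g Y))
    (contMDiff_conj g).contMDiffAt (by simpa using (ENat.LEInfty.out : (2 : WithTop ℕ∞) ≤ ∞))
  have hX : VectorField.mpullback 𝓘(ℝ, EG) 𝓘(ℝ, EG) (fun y : G => g * y * g⁻¹)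
      (mulInvariantVectorField (groupAd EG g X)) = mulInvariantVectorField X :=
    funext fun x => mpullback_conj g x X
  have hY : VectorField.mpullback 𝓘(ℝ, EG) 𝓘(ℝ, EG) (fun y : G => g * y * g⁻¹)
      (mulInvariantVectorField (groupAd EG g Y)) = mulInvariantVectorField Y :=
    funext fun x => mpullback_conj g x Y
  rw [hX, hY, ← mulInvariantVector_mlieBracket (groupAd EG g X) (groupAd EG g Y)] at h
  have h2 := ((isInvertible_conjDeriv (EG := EG) g 1).inverse_apply_eq).1 h
  beta_reduce at h2
  rw [show g * 1 * g⁻¹ = (1 : G) by simp, mulInvariantVectorField_at_one] at h2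
  exact h2.symm

/-- `Ad(g)` as an automorphism of the Lie algebra. -/
def groupAdLieEquiv [FiniteDimensional ℝ EG] (g : G) :
    GroupLieAlgebra 𝓘(ℝ, EG) G ≃ₗ⁅ℝ⁆ GroupLieAlgebra 𝓘(ℝ, EG) G :=
  { groupAdEquiv g with
    map_lie' := fun {X Y} => groupAd_lie g X Y }

theorem killingForm_groupAd [FiniteDimensional ℝ EG] (g : G)
    (X Y : GroupLieAlgebra 𝓘(ℝ, EG) G) :
    killingForm ℝ (GroupLieAlgebra 𝓘(ℝ, EG) G) (groupAd EG g X) (groupAd EG g Y) =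
      killingForm ℝ (GroupLieAlgebra 𝓘(ℝ, EG) G) X Y :=
  LieAlgebra.killingForm_of_equiv_apply (groupAdLieEquiv g) X Y

end Ad

variable {EP : Type*} [NormedAddCommGroup EP] [NormedSpace ℝ EP]
  (P : Subgroup G) [ChartedSpace EP P]

variable (EG EP) in
/-- The inclusion of Lie algebras `𝔭 → 𝔤`, the derivative of `P ⊆ G` at the identity. -/
def subgroupLieMap : GroupLieAlgebra 𝓘(ℝ, EP) P →ₗ[ℝ] GroupLieAlgebra 𝓘(ℝ, EG) G where
  toFun X := mfderiv 𝓘(ℝ, EP) 𝓘(ℝ, EG) (Subtype.val : P → G) 1 X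
  map_add' X Y := map_add (mfderiv 𝓘(ℝ, EP) 𝓘(ℝ, EG) (Subtype.val : P → G) 1) X Y
  map_smul' c X := map_smul (mfderiv 𝓘(ℝ, EP) 𝓘(ℝ, EG) (Subtype.val : P → G) 1) c X

variable [LieGroup 𝓘(ℝ, EG) ∞ G]

/-- A subspace `𝔭` of the (semisimple) Lie algebra `𝔤` is a parabolic subalgebra: there is a grading
`𝔤 = 𝔤₋ₖ ⊕ … ⊕ 𝔤ₖ` of the Lie algebra such that `𝔭 = 𝔤₀ ⊕ … ⊕ 𝔤ₖ`. (The grading is only required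
to exist, it is not part of the data; it has finitely many nonzero components because `𝔤` has
finite dimension.) -/
def IsParabolicSubalgebra (𝔭 : Submodule ℝ (GroupLieAlgebra 𝓘(ℝ, EG) G)) : Prop :=
  ∃ 𝔤 : ℤ → Submodule ℝ (GroupLieAlgebra 𝓘(ℝ, EG) G),
    DirectSum.IsInternal 𝔤 ∧
    (∀ i j, ∀ X ∈ 𝔤 i, ∀ Y ∈ 𝔤 j, ⁅X, Y⁆ ∈ 𝔤 (i + j)) ∧
    𝔭 = ⨆ i : ℕ, 𝔤 (i : ℤ)

variable (EG EP) in
/-- `P ⊆ G` is a parabolic subgroup: a closed (hence embedded) Lie subgroup whose Lie algebra is a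
parabolic subalgebra of `𝔤`. The topology of `P` is the subspace topology, and its manifold
structure makes the inclusion into `G` a smooth immersion. -/
structure IsParabolicSubgroup : Prop where
  isClosed : IsClosed (P : Set G)
  contMDiff_val : ContMDiff 𝓘(ℝ, EP) 𝓘(ℝ, EG) ∞ (Subtype.val : P → G)
  injective_mfderiv : ∀ h : P,
    Function.Injective (mfderiv 𝓘(ℝ, EP) 𝓘(ℝ, EG) (Subtype.val : P → G) h)
  parabolic : IsParabolicSubalgebra (LinearMap.range (subgroupLieMap EG EP P))

variable (EG EP) in
/-- A parabolic geometry `(p : 𝒢 → M, ω)` of type `(G, P)`: a smooth manifold `M` (Hausdorff,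
`σ`-compact, of dimension `dimM`), a smooth principal `P`-bundle `p : 𝒢 → M` and a Cartan connection
`ω` on `𝒢` with values in `𝔤`. As `ω` identifies every tangent space of `𝒢` with `𝔤`, the manifold
`𝒢` has the dimension of `G`, and it is modelled on the same vector space. It follows that
`dimM = dim G - dim P` unless `M` is empty. -/
structure ParabolicGeometry where
  dimM : ℕ
  M : Type u
  𝒢 : Type u
  [topM : TopologicalSpace M]
  [chartedM : ChartedSpace (EuclideanSpace ℝ (Fin dimM)) M]
  [manifoldM : IsManifold 𝓘(ℝ, EuclideanSpace ℝ (Fin dimM)) ∞ M]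
  [t2M : T2Space M]
  [sigmaM : SigmaCompactSpace M]
  [top𝒢 : TopologicalSpace 𝒢]
  [charted𝒢 : ChartedSpace EG 𝒢]
  [manifold𝒢 : IsManifold 𝓘(ℝ, EG) ∞ 𝒢]
  /-- The bundle projection. -/
  proj : 𝒢 → M
  contMDiff_proj : ContMDiff 𝓘(ℝ, EG) 𝓘(ℝ, EuclideanSpace ℝ (Fin dimM)) ∞ proj
  /-- The principal right action `(u, h) ↦ u · h`. -/
  act : 𝒢 → P → 𝒢
  contMDiff_act : ContMDiff (𝓘(ℝ, EG).prod 𝓘(ℝ, EP)) 𝓘(ℝ, EG) ∞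
    (fun q : 𝒢 × P => act q.1 q.2)
  act_one : ∀ u, act u 1 = u
  act_mul : ∀ u h k, act u (h * k) = act (act u h) k
  proj_act : ∀ u h, proj (act u h) = proj u
  /-- Near every point of `M` there are a smooth local section `s` and a smooth map `τ` such that
  `(y, h) ↦ s(y) · h` and `u ↦ (p(u), τ(u))` are inverse to each other: a local trivialization. -/
  locallyTrivial : ∀ x : M, ∃ (U : Set M) (s : M → 𝒢) (τ : 𝒢 → P), IsOpen U ∧ x ∈ U ∧
    ContMDiffOn 𝓘(ℝ, EuclideanSpace ℝ (Fin dimM)) 𝓘(ℝ, EG) ∞ s U ∧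
    ContMDiffOn 𝓘(ℝ, EG) 𝓘(ℝ, EP) ∞ τ (proj ⁻¹' U) ∧
    (∀ y ∈ U, proj (s y) = y) ∧
    (∀ y ∈ U, ∀ h, τ (act (s y) h) = h) ∧
    (∀ u ∈ proj ⁻¹' U, act (s (proj u)) (τ u) = u)
  /-- The Cartan connection `ω`. It defines a smooth isomorphism `T𝒢 ≅ 𝒢 × 𝔤`, smooth in both
  directions. -/
  conn : ∀ u : 𝒢, TangentSpace 𝓘(ℝ, EG) u ≃ₗ[ℝ] GroupLieAlgebra 𝓘(ℝ, EG) G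
  contMDiff_conn : ContMDiff 𝓘(ℝ, EG).tangent 𝓘(ℝ, EG) ∞
    (fun v : TangentBundle 𝓘(ℝ, EG) 𝒢 => (show EG from conn v.1 v.2))
  contMDiff_conn_symm : ∀ X : GroupLieAlgebra 𝓘(ℝ, EG) G,
    ContMDiff 𝓘(ℝ, EG) 𝓘(ℝ, EG).tangent ∞
      (fun u => (⟨u, (conn u).symm X⟩ : TangentBundle 𝓘(ℝ, EG) 𝒢))
  /-- Equivariance: `(r^h)^* ω = Ad(h⁻¹) ∘ ω` for the principal right translation `r^h`. -/
  conn_act : ∀ (h : P) (u : 𝒢) (v : TangentSpace 𝓘(ℝ, EG) u),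
    conn (act u h) (mfderiv 𝓘(ℝ, EG) 𝓘(ℝ, EG) (fun u' => act u' h) u v) =
      groupAd EG (h : G)⁻¹ (conn u v)
  /-- `ω` reproduces the generators of the fundamental vector fields. -/
  conn_fundamental : ∀ (u : 𝒢) (A : GroupLieAlgebra 𝓘(ℝ, EP) P),
    conn (act u 1) (mfderiv 𝓘(ℝ, EP) 𝓘(ℝ, EG) (fun h : P => act u h) 1 A) =
      subgroupLieMap EG EP P A

attribute [instance] ParabolicGeometry.topM ParabolicGeometry.chartedM
  ParabolicGeometry.manifoldM ParabolicGeometry.t2M ParabolicGeometry.sigmaM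
  ParabolicGeometry.top𝒢 ParabolicGeometry.charted𝒢 ParabolicGeometry.manifold𝒢

end LieGroups

section Casimir

universe u

variable {𝕜 : Type*} [RCLike 𝕜]
  {EG : Type*} [NormedAddCommGroup EG] [NormedSpace ℝ EG] [FiniteDimensional ℝ EG]
  {G : Type u} [TopologicalSpace G] [ChartedSpace EG G] [Group G] [LieGroup 𝓘(ℝ, EG) ∞ G]
  {EP : Type*} [NormedAddCommGroup EP] [NormedSpace ℝ EP]
  {P : Subgroup G} [ChartedSpace EP P]
  {W : Type*} [AddCommGroup W] [Module 𝕜 W] [FiniteDimensional 𝕜 W]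
  {W' : Type*} [AddCommGroup W'] [Module 𝕜 W'] [FiniteDimensional 𝕜 W']

/-- The space `Γ(WM)` of smooth sections of the natural bundle `WM = 𝒢 ×_P W`, in its standard
description as the space `C^∞(𝒢, W)^P` of smooth functions `f : 𝒢 → W` which are `P`-equivariant,
`f(u · h) = h⁻¹ · f(u)`. -/
def Sections (X : ParabolicGeometry EG EP P) (ρ : Representation 𝕜 P W) :
    Submodule 𝕜 (X.𝒢 → W) where
  carrier := {f | SmoothVec 𝕜 EG f ∧ ∀ u h, f (X.act u h) = ρ h⁻¹ (f u)}
  add_mem' := fun hf hg => ⟨hf.1.add hg.1, fun u h => by simp [hf.2, hg.2]⟩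
  zero_mem' := ⟨SmoothVec.zero, fun u h => by simp⟩
  smul_mem' := fun c f hf => ⟨hf.1.comp_linear (c • LinearMap.id), fun u h => by simp [hf.2]⟩

variable (𝕜) in
/-- The fundamental derivative `D f : 𝒢 → 𝔤* ⊗ W`: the derivative of `f` at `u` in the direction of
the tangent vector which corresponds to `A ∈ 𝔤` under the Cartan connection. For a section `s` of
the adjoint tractor bundle, i.e. an equivariant function `s : 𝒢 → 𝔤`, one has
`(D_s f)(u) = fundDeriv f u (s u)`. -/
def fundDeriv (X : ParabolicGeometry EG EP P) (f : X.𝒢 → W)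
    (u : X.𝒢) (A : GroupLieAlgebra 𝓘(ℝ, EG) G) : W :=
  dirDeriv 𝕜 f u ((X.conn u).symm A)

variable (𝕜) in
/-- The iterated fundamental derivative `D² f = D(D f) : 𝒢 → 𝔤* ⊗ 𝔤* ⊗ W`, evaluated on `A` (the
slot of the outer derivative) and `B`. As evaluation at a fixed `B ∈ 𝔤` is linear, the derivative
of the `𝔤* ⊗ W`-valued function `D f`, evaluated at `B`, is the derivative of `u ↦ D f(u)(B)`. -/
def fundDeriv₂ (X : ParabolicGeometry EG EP P) (f : X.𝒢 → W)
    (u : X.𝒢) (A B : GroupLieAlgebra 𝓘(ℝ, EG) G) : W :=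
  fundDeriv 𝕜 X (fun u' => fundDeriv 𝕜 X f u' B) u A

variable (EG G) in
/-- The basis of `𝔤` that is dual, with respect to the Killing form, to the basis
`Module.finBasis` of `𝔤`. -/
def killingDualBasis [LieAlgebra.IsSemisimple ℝ (GroupLieAlgebra 𝓘(ℝ, EG) G)] :
    Module.Basis (Fin (Module.finrank ℝ (GroupLieAlgebra 𝓘(ℝ, EG) G))) ℝ
      (GroupLieAlgebra 𝓘(ℝ, EG) G) :=
  (killingForm ℝ (GroupLieAlgebra 𝓘(ℝ, EG) G)).dualBasis
    (LieAlgebra.IsKilling.killingForm_nondegenerate ℝ (GroupLieAlgebra 𝓘(ℝ, EG) G))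
    (Module.finBasis ℝ (GroupLieAlgebra 𝓘(ℝ, EG) G))

variable (𝕜) in
/-- The function `(B ⊗ id)(D² f) : 𝒢 → W`, where `B` is the Killing form: the contraction of `D² f`
with dual bases of `𝔤`. By `contraction_eq` the choice of the basis does not matter. -/
def casimirFun [LieAlgebra.IsSemisimple ℝ (GroupLieAlgebra 𝓘(ℝ, EG) G)]
    (X : ParabolicGeometry EG EP P) (f : X.𝒢 → W) (u : X.𝒢) : W :=
  ∑ l, fundDeriv₂ 𝕜 X f u (Module.finBasis ℝ (GroupLieAlgebra 𝓘(ℝ, EG) G) l)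
    (killingDualBasis EG G l)

theorem fundDeriv_add_right (X : ParabolicGeometry EG EP P) (f : X.𝒢 → W)
    (u : X.𝒢) (A B : GroupLieAlgebra 𝓘(ℝ, EG) G) :
    fundDeriv 𝕜 X f u (A + B) = fundDeriv 𝕜 X f u A + fundDeriv 𝕜 X f u B := by
  unfold fundDeriv
  rw [map_add, dirDeriv_add_right]

theorem fundDeriv_smul_right (X : ParabolicGeometry EG EP P) (f : X.𝒢 → W)
    (u : X.𝒢) (c : ℝ) (A : GroupLieAlgebra 𝓘(ℝ, EG) G) :
    fundDeriv 𝕜 X f u (c • A) = (c : 𝕜) • fundDeriv 𝕜 X f u A := by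
  unfold fundDeriv
  rw [map_smul, dirDeriv_smul_right]

theorem smooth_fundDeriv (X : ParabolicGeometry EG EP P) {f : X.𝒢 → W} (hf : SmoothVec 𝕜 EG f)
    (A : GroupLieAlgebra 𝓘(ℝ, EG) G) : SmoothVec 𝕜 EG (fun u => fundDeriv 𝕜 X f u A) :=
  hf.dirDeriv (X.contMDiff_conn_symm A)

theorem fundDeriv_add (X : ParabolicGeometry EG EP P) {f g : X.𝒢 → W} (hf : SmoothVec 𝕜 EG f)
    (hg : SmoothVec 𝕜 EG g) (u : X.𝒢) (A : GroupLieAlgebra 𝓘(ℝ, EG) G) :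
    fundDeriv 𝕜 X (f + g) u A = fundDeriv 𝕜 X f u A + fundDeriv 𝕜 X g u A :=
  dirDeriv_add hf hg _ _

theorem fundDeriv_comp_linear (X : ParabolicGeometry EG EP P) (L : W →ₗ[𝕜] W') {f : X.𝒢 → W}
    (hf : SmoothVec 𝕜 EG f) (u : X.𝒢) (A : GroupLieAlgebra 𝓘(ℝ, EG) G) :
    fundDeriv 𝕜 X (fun y => L (f y)) u A = L (fundDeriv 𝕜 X f u A) :=
  dirDeriv_comp_linear L hf _ _

theorem contMDiff_act_right (X : ParabolicGeometry EG EP P) (h : P) :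
    ContMDiff 𝓘(ℝ, EG) 𝓘(ℝ, EG) ∞ (fun u => X.act u h) :=
  X.contMDiff_act.comp (contMDiff_id.prodMk contMDiff_const)

theorem conn_symm_act (X : ParabolicGeometry EG EP P) (h : P) (u : X.𝒢)
    (A : GroupLieAlgebra 𝓘(ℝ, EG) G) :
    (X.conn (X.act u h)).symm A =
      mfderiv 𝓘(ℝ, EG) 𝓘(ℝ, EG) (fun u' => X.act u' h) u
        ((X.conn u).symm (groupAd EG (h : G) A)) := by
  rw [LinearEquiv.symm_apply_eq, X.conn_act, LinearEquiv.apply_symm_apply, groupAd_comp,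
    inv_mul_cancel, groupAd_one]

theorem fundDeriv_act (X : ParabolicGeometry EG EP P) {f g : X.𝒢 → W} (h : P)
    (L : W →ₗ[𝕜] W) (hf : SmoothVec 𝕜 EG f) (hg : SmoothVec 𝕜 EG g)
    (hfg : ∀ u, f (X.act u h) = L (g u)) (u : X.𝒢) (A : GroupLieAlgebra 𝓘(ℝ, EG) G) :
    fundDeriv 𝕜 X f (X.act u h) A = L (fundDeriv 𝕜 X g u (groupAd EG (h : G) A)) := by
  have h1 := dirDeriv_comp hf (contMDiff_act_right X h) u
    ((X.conn u).symm (groupAd EG (h : G) A))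
  rw [← conn_symm_act] at h1
  unfold fundDeriv
  rw [← h1, ← dirDeriv_comp_linear L hg]
  congr 1
  funext y
  exact hfg y

theorem smooth_fundDeriv₂ (X : ParabolicGeometry EG EP P) {f : X.𝒢 → W}
    (hf : SmoothVec 𝕜 EG f) (A B : GroupLieAlgebra 𝓘(ℝ, EG) G) :
    SmoothVec 𝕜 EG (fun u => fundDeriv₂ 𝕜 X f u A B) :=
  smooth_fundDeriv X (smooth_fundDeriv X hf B) A

theorem fundDeriv₂_act (X : ParabolicGeometry EG EP P) (ρ : Representation 𝕜 P W)
    {f : X.𝒢 → W} (hf : f ∈ Sections X ρ) (h : P) (u : X.𝒢)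
    (A B : GroupLieAlgebra 𝓘(ℝ, EG) G) :
    fundDeriv₂ 𝕜 X f (X.act u h) A B =
      ρ h⁻¹ (fundDeriv₂ 𝕜 X f u (groupAd EG (h : G) A) (groupAd EG (h : G) B)) :=
  fundDeriv_act X h (ρ h⁻¹) (smooth_fundDeriv X hf.1 B)
    (smooth_fundDeriv X hf.1 (groupAd EG (h : G) B))
    (fun v => fundDeriv_act X h (ρ h⁻¹) hf.1 hf.1 (fun w => hf.2 w h) v B) u A

theorem fundDeriv₂_add (X : ParabolicGeometry EG EP P) {f g : X.𝒢 → W} (hf : SmoothVec 𝕜 EG f)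
    (hg : SmoothVec 𝕜 EG g) (u : X.𝒢) (A B : GroupLieAlgebra 𝓘(ℝ, EG) G) :
    fundDeriv₂ 𝕜 X (f + g) u A B = fundDeriv₂ 𝕜 X f u A B + fundDeriv₂ 𝕜 X g u A B := by
  unfold fundDeriv₂
  rw [← fundDeriv_add X (smooth_fundDeriv X hf B) (smooth_fundDeriv X hg B)]
  congr 1
  funext v
  exact fundDeriv_add X hf hg v B

theorem fundDeriv₂_comp_linear (X : ParabolicGeometry EG EP P) (L : W →ₗ[𝕜] W') {f : X.𝒢 → W}
    (hf : SmoothVec 𝕜 EG f) (u : X.𝒢) (A B : GroupLieAlgebra 𝓘(ℝ, EG) G) :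
    fundDeriv₂ 𝕜 X (fun y => L (f y)) u A B = L (fundDeriv₂ 𝕜 X f u A B) := by
  unfold fundDeriv₂
  rw [← fundDeriv_comp_linear X L (smooth_fundDeriv X hf B)]
  congr 1
  funext v
  exact fundDeriv_comp_linear X L hf v B

theorem fundDeriv₂_add_left (X : ParabolicGeometry EG EP P) (f : X.𝒢 → W)
    (u : X.𝒢) (A A' B : GroupLieAlgebra 𝓘(ℝ, EG) G) :
    fundDeriv₂ 𝕜 X f u (A + A') B = fundDeriv₂ 𝕜 X f u A B + fundDeriv₂ 𝕜 X f u A' B :=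
  fundDeriv_add_right X _ u A A'

theorem fundDeriv₂_smul_left (X : ParabolicGeometry EG EP P) (f : X.𝒢 → W)
    (u : X.𝒢) (c : ℝ) (A B : GroupLieAlgebra 𝓘(ℝ, EG) G) :
    fundDeriv₂ 𝕜 X f u (c • A) B = (c : 𝕜) • fundDeriv₂ 𝕜 X f u A B :=
  fundDeriv_smul_right X _ u c A

theorem fundDeriv₂_add_right (X : ParabolicGeometry EG EP P) {f : X.𝒢 → W}
    (hf : SmoothVec 𝕜 EG f) (u : X.𝒢) (A B B' : GroupLieAlgebra 𝓘(ℝ, EG) G) :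
    fundDeriv₂ 𝕜 X f u A (B + B') = fundDeriv₂ 𝕜 X f u A B + fundDeriv₂ 𝕜 X f u A B' := by
  unfold fundDeriv₂
  rw [← fundDeriv_add X (smooth_fundDeriv X hf B) (smooth_fundDeriv X hf B')]
  congr 1
  funext v
  exact fundDeriv_add_right X f v B B'

theorem fundDeriv₂_smul_right (X : ParabolicGeometry EG EP P) {f : X.𝒢 → W}
    (hf : SmoothVec 𝕜 EG f) (u : X.𝒢) (c : ℝ) (A B : GroupLieAlgebra 𝓘(ℝ, EG) G) :
    fundDeriv₂ 𝕜 X f u A (c • B) = (c : 𝕜) • fundDeriv₂ 𝕜 X f u A B := by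
  have h := fundDeriv_comp_linear X ((c : 𝕜) • (LinearMap.id : W →ₗ[𝕜] W))
    (smooth_fundDeriv X hf B) u A
  simp only [LinearMap.smul_apply, LinearMap.id_apply] at h
  unfold fundDeriv₂
  rw [← h]
  congr 1
  funext v
  exact fundDeriv_smul_right X f v c B

/-- The contraction of a bilinear map with a pair of dual bases does not depend on the bases. -/
theorem contraction_eq {L : Type*} [AddCommGroup L] [Module ℝ L] {ι : Type*} [Fintype ι]
    [DecidableEq ι] {F : Type*} [AddCommGroup F] [Module ℝ F] {B : LinearMap.BilinForm ℝ L}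
    (hB : B.Nondegenerate) (b b' : Module.Basis ι ℝ L) (T : L →ₗ[ℝ] L →ₗ[ℝ] F) :
    ∑ l, T (b' l) (B.dualBasis hB b' l) = ∑ l, T (b l) (B.dualBasis hB b l) := by
  have h1 : ∀ l, B.dualBasis hB b' l =
      ∑ k, B (B.dualBasis hB b' l) (b k) • B.dualBasis hB b k := fun l => by
    conv_lhs => rw [← (B.dualBasis hB b).sum_repr (B.dualBasis hB b' l)]
    simp only [LinearMap.BilinForm.dualBasis_repr_apply]
  have h2 : ∀ k, b k = ∑ l, B (B.dualBasis hB b' l) (b k) • b' l := fun k => by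
    conv_lhs => rw [← b'.sum_repr (b k)]
    refine Finset.sum_congr rfl fun l _ => ?_
    congr 1
    have h := congrArg (B (B.dualBasis hB b' l)) (b'.sum_repr (b k))
    simp only [map_sum, map_smul, LinearMap.BilinForm.apply_dualBasis_left, smul_eq_mul,
      mul_ite, mul_one, mul_zero, Finset.sum_ite_eq', Finset.mem_univ, if_true] at h
    exact h
  calc ∑ l, T (b' l) (B.dualBasis hB b' l)
      = ∑ l, ∑ k, B (B.dualBasis hB b' l) (b k) • T (b' l) (B.dualBasis hB b k) := by
        refine Finset.sum_congr rfl fun l _ => ?_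
        conv_lhs => rw [h1 l]
        simp
    _ = ∑ k, ∑ l, B (B.dualBasis hB b' l) (b k) • T (b' l) (B.dualBasis hB b k) :=
        Finset.sum_comm
    _ = ∑ k, T (b k) (B.dualBasis hB b k) := by
        refine Finset.sum_congr rfl fun k _ => ?_
        conv_rhs => rw [h2 k]
        simp

theorem casimirFun_act [LieAlgebra.IsSemisimple ℝ (GroupLieAlgebra 𝓘(ℝ, EG) G)]
    (X : ParabolicGeometry EG EP P) (ρ : Representation 𝕜 P W)
    {f : X.𝒢 → W} (hf : f ∈ Sections X ρ) (h : P) (u : X.𝒢) :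
    casimirFun 𝕜 X f (X.act u h) = ρ h⁻¹ (casimirFun 𝕜 X f u) := by
  let _ : Module ℝ W := Module.compHom W (algebraMap ℝ 𝕜)
  let T : GroupLieAlgebra 𝓘(ℝ, EG) G →ₗ[ℝ] GroupLieAlgebra 𝓘(ℝ, EG) G →ₗ[ℝ] W :=
    LinearMap.mk₂ ℝ (fundDeriv₂ 𝕜 X f u) (fundDeriv₂_add_left X f u)
      (fundDeriv₂_smul_left X f u) (fundDeriv₂_add_right X hf.1 u)
      (fun c A B => fundDeriv₂_smul_right X hf.1 u c A B)
  have hnd := LieAlgebra.IsKilling.killingForm_nondegenerate ℝ (GroupLieAlgebra 𝓘(ℝ, EG) G)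
  have h1 := contraction_eq hnd (Module.finBasis ℝ (GroupLieAlgebra 𝓘(ℝ, EG) G))
    ((Module.finBasis ℝ (GroupLieAlgebra 𝓘(ℝ, EG) G)).map (groupAdEquiv (h : G))) T
  have h2 := (LinearMap.BilinForm.dualBasis_eq_iff hnd
    ((Module.finBasis ℝ (GroupLieAlgebra 𝓘(ℝ, EG) G)).map (groupAdEquiv (h : G)))
    (fun l => groupAd EG (h : G) (killingDualBasis EG G l))).2 (fun i j => by
      rw [Module.Basis.map_apply]
      exact (killingForm_groupAd (h : G) _ _).trans
        (LinearMap.BilinForm.apply_dualBasis_left hnd _ i j))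
  rw [h2] at h1
  unfold casimirFun
  rw [map_sum]
  have h3 : ∀ l, fundDeriv₂ 𝕜 X f (X.act u h)
      (Module.finBasis ℝ (GroupLieAlgebra 𝓘(ℝ, EG) G) l) (killingDualBasis EG G l) = _ :=
    fun l => fundDeriv₂_act X ρ hf h u _ _
  simp only [h3]
  rw [← map_sum, ← map_sum]
  exact congrArg (ρ h⁻¹) h1

theorem smooth_casimirFun [LieAlgebra.IsSemisimple ℝ (GroupLieAlgebra 𝓘(ℝ, EG) G)]
    (X : ParabolicGeometry EG EP P) {f : X.𝒢 → W} (hf : SmoothVec 𝕜 EG f) :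
    SmoothVec 𝕜 EG (casimirFun 𝕜 X f) := by
  have h : ∀ s : Finset (Fin (Module.finrank ℝ (GroupLieAlgebra 𝓘(ℝ, EG) G))),
      SmoothVec 𝕜 EG (fun u => ∑ l ∈ s, fundDeriv₂ 𝕜 X f u
        (Module.finBasis ℝ (GroupLieAlgebra 𝓘(ℝ, EG) G) l) (killingDualBasis EG G l)) := by
    classical
    intro s
    induction s using Finset.induction_on with
    | empty =>
      simp only [Finset.sum_empty]
      exact SmoothVec.zero
    | insert a s ha ih =>
      simp only [Finset.sum_insert ha]
      exact (smooth_fundDeriv₂ X hf _ _).add ih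
  exact h Finset.univ

theorem casimirFun_add [LieAlgebra.IsSemisimple ℝ (GroupLieAlgebra 𝓘(ℝ, EG) G)]
    (X : ParabolicGeometry EG EP P) {f g : X.𝒢 → W} (hf : SmoothVec 𝕜 EG f)
    (hg : SmoothVec 𝕜 EG g) : casimirFun 𝕜 X (f + g) = casimirFun 𝕜 X f + casimirFun 𝕜 X g := by
  funext u
  rw [Pi.add_apply]
  unfold casimirFun
  rw [← Finset.sum_add_distrib]
  exact Finset.sum_congr rfl fun l _ => fundDeriv₂_add X hf hg u _ _

theorem casimirFun_comp_linear [LieAlgebra.IsSemisimple ℝ (GroupLieAlgebra 𝓘(ℝ, EG) G)]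
    (X : ParabolicGeometry EG EP P) (L : W →ₗ[𝕜] W') {f : X.𝒢 → W} (hf : SmoothVec 𝕜 EG f) :
    casimirFun 𝕜 X (fun u => L (f u)) = fun u => L (casimirFun 𝕜 X f u) := by
  funext u
  unfold casimirFun
  rw [map_sum]
  exact Finset.sum_congr rfl fun l _ => fundDeriv₂_comp_linear X L hf u _ _

theorem casimirFun_smul [LieAlgebra.IsSemisimple ℝ (GroupLieAlgebra 𝓘(ℝ, EG) G)]
    (X : ParabolicGeometry EG EP P) (c : 𝕜) {f : X.𝒢 → W} (hf : SmoothVec 𝕜 EG f) :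
    casimirFun 𝕜 X (c • f) = c • casimirFun 𝕜 X f := by
  have h : c • f = fun u => (c • (LinearMap.id : W →ₗ[𝕜] W)) (f u) := by
    funext u; simp
  rw [h, casimirFun_comp_linear X _ hf]
  funext u
  simp

/-- The curved Casimir operator `𝒞 = (B ⊗ id) ∘ D²` on the sections of a natural bundle. -/
def curvedCasimir [LieAlgebra.IsSemisimple ℝ (GroupLieAlgebra 𝓘(ℝ, EG) G)]
    (X : ParabolicGeometry EG EP P) (ρ : Representation 𝕜 P W) :
    Module.End 𝕜 (Sections X ρ) where
  toFun σ := ⟨casimirFun 𝕜 X σ, smooth_casimirFun X σ.2.1,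
    fun u h => casimirFun_act X ρ σ.2 h u⟩
  map_add' σ τ := Subtype.ext (casimirFun_add X σ.2.1 τ.2.1)
  map_smul' c σ := Subtype.ext (casimirFun_smul X c σ.2.1)

end Casimir

section Operators

universe u

variable {𝕜 : Type*} [RCLike 𝕜]
  {EG : Type*} [NormedAddCommGroup EG] [NormedSpace ℝ EG]
  {G : Type u} [TopologicalSpace G] [ChartedSpace EG G] [Group G]
  {EP : Type*} [NormedAddCommGroup EP] [NormedSpace ℝ EP]
  {P : Subgroup G} [ChartedSpace EP P]
  {W : Type*} [AddCommGroup W] [Module 𝕜 W] [FiniteDimensional 𝕜 W]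
  {W' : Type*} [AddCommGroup W'] [Module 𝕜 W'] [FiniteDimensional 𝕜 W']

/-- The tensorial operator `Γ(WM) → Γ(W'M)` induced by a `P`-equivariant linear map `W → W'`. -/
def sectionsMap (X : ParabolicGeometry EG EP P) {ρ : Representation 𝕜 P W}
    {ρ' : Representation 𝕜 P W'} (Φ : ρ.IntertwiningMap ρ') :
    Sections X ρ →ₗ[𝕜] Sections X ρ' where
  toFun σ := ⟨fun u => Φ (σ.1 u), σ.2.1.comp_linear Φ.toLinearMap, fun u h => by
    beta_reduce
    rw [σ.2.2, Φ.isIntertwining]⟩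
  map_add' σ τ := by ext u; exact map_add Φ (σ.1 u) (τ.1 u)
  map_smul' c σ := by ext u; exact map_smul Φ c (σ.1 u)

/-- Multiplication of sections by a smooth real-valued function on `M`. -/
def mulFun (X : ParabolicGeometry EG EP P) (ρ : Representation 𝕜 P W)
    (φ : ContMDiffMap 𝓘(ℝ, EuclideanSpace ℝ (Fin X.dimM)) 𝓘(ℝ, ℝ) X.M ℝ ∞) :
    Module.End 𝕜 (Sections X ρ) where
  toFun σ := ⟨fun u => (φ (X.proj u) : 𝕜) • σ.1 u, by
    have h := (φ.contMDiff.comp X.contMDiff_proj).smul σ.2.1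
    refine h.congr fun u => ?_
    rw [map_smul]
    exact (RCLike.real_smul_eq_coe_smul (K := 𝕜) _ _).symm, fun u h => by
    beta_reduce
    rw [X.proj_act, σ.2.2, map_smul]⟩
  map_add' σ τ := by ext u; exact smul_add _ (σ.1 u) (τ.1 u)
  map_smul' c σ := by ext u; exact smul_comm _ c (σ.1 u)

/-- Linear differential operators of order at most `r` between spaces of sections, defined in the
usual algebraic way: an operator has order at most `0` if it is linear over `C^∞(M, ℝ)`, and order
at most `r + 1` if its commutators with all smooth functions have order at most `r`. -/
def IsDiffOp (X : ParabolicGeometry EG EP P) (ρ : Representation 𝕜 P W)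
    (ρ' : Representation 𝕜 P W') : ℕ → (Sections X ρ →ₗ[𝕜] Sections X ρ') → Prop
  | 0, T => ∀ φ, T ∘ₗ mulFun X ρ φ = mulFun X ρ' φ ∘ₗ T
  | r + 1, T => ∀ φ, IsDiffOp X ρ ρ' r (T ∘ₗ mulFun X ρ φ - mulFun X ρ' φ ∘ₗ T)

/-- Morphisms of parabolic geometries of type `(G, P)`: homomorphisms of principal bundles which
are compatible with the Cartan connections. (The induced map of the bases is automatically smooth,
and a local diffeomorphism.) -/
structure IsMorphism (X Y : ParabolicGeometry EG EP P) (Φ : X.𝒢 → Y.𝒢) : Prop where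
  contMDiff : ContMDiff 𝓘(ℝ, EG) 𝓘(ℝ, EG) ∞ Φ
  map_act : ∀ u h, Φ (X.act u h) = Y.act (Φ u) h
  pullback_conn : ∀ (u : X.𝒢) (v : TangentSpace 𝓘(ℝ, EG) u),
    Y.conn (Φ u) (mfderiv 𝓘(ℝ, EG) 𝓘(ℝ, EG) Φ u v) = X.conn u v

/-- A family of linear operators `Γ(WM) → Γ(W'M)`, one for each parabolic geometry of type
`(G, P)`, is a natural (invariant) differential operator: the operators are differential operators
of some finite order, and they commute with the pullback of sections along morphisms. -/
structure IsNaturalOperator {ρ : Representation 𝕜 P W} {ρ' : Representation 𝕜 P W'}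
    (T : ∀ X : ParabolicGeometry EG EP P, Sections X ρ →ₗ[𝕜] Sections X ρ') : Prop where
  isDiffOp : ∃ r : ℕ, ∀ X, IsDiffOp X ρ ρ' r (T X)
  pullback : ∀ (X Y : ParabolicGeometry EG EP P) (Φ : X.𝒢 → Y.𝒢), IsMorphism X Y Φ →
    ∀ (σ : Sections X ρ) (τ : Sections Y ρ), (∀ u, σ.1 u = τ.1 (Φ u)) →
      ∀ u, (T X σ).1 u = (T Y τ).1 (Φ u)

variable (EP) in
/-- The representation `ρ` of the Lie group `P` on `W` is smooth. -/
def IsSmoothRep (ρ : Representation 𝕜 P W) : Prop :=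
  ∀ w, SmoothVec 𝕜 EP (fun h : P => ρ h w)

end Operators

section Filtrations

variable {𝕜 : Type*} [Field 𝕜] {H : Type*} [Group H] {W : Type*} [AddCommGroup W] [Module 𝕜 W]

/-- The inclusion of a subrepresentation. -/
def inclusion {ρ : Representation 𝕜 H W} (V : Subrepresentation ρ) :
    V.toRepresentation.IntertwiningMap ρ where
  toLinearMap := V.toSubmodule.subtype
  isIntertwining' _ := rfl

/-- An invariant filtration `W = W⁰ ⊇ W¹ ⊇ … ⊇ Wᴺ ⊇ Wᴺ⁺¹ = 0`. -/
structure InvariantFiltration (ρ : Representation 𝕜 H W) (N : ℕ) where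
  /-- The subrepresentation `Wʲ`. -/
  step : ℕ → Subrepresentation ρ
  antitone : Antitone step
  step_zero : step 0 = ⊤
  step_last : step (N + 1) = ⊥

namespace InvariantFiltration

variable {ρ : Representation 𝕜 H W} {N : ℕ}

/-- `Wʲ⁺¹` as a subspace of `Wʲ`. -/
def next (F : InvariantFiltration ρ N) (j : ℕ) : Submodule 𝕜 (F.step j).toSubmodule :=
  (F.step (j + 1)).toSubmodule.comap (F.step j).toSubmodule.subtype

/-- The subquotient `Wʲ / Wʲ⁺¹` as a vector space. -/
abbrev Gr (F : InvariantFiltration ρ N) (j : ℕ) := (F.step j).toSubmodule ⧸ F.next j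

/-- The representation on the subquotient `Wʲ / Wʲ⁺¹`. -/
def gr (F : InvariantFiltration ρ N) (j : ℕ) : Representation 𝕜 H (F.Gr j) :=
  (F.step j).toRepresentation.quotient (F.next j)
    (fun g _ hw => (F.step (j + 1)).apply_mem_toSubmodule g hw)

/-- The projection `π : Wʲ → Wʲ / Wʲ⁺¹`. -/
def proj (F : InvariantFiltration ρ N) (j : ℕ) :
    (F.step j).toRepresentation.IntertwiningMap (F.gr j) where
  toLinearMap := (F.next j).mkQ
  isIntertwining' _ := rfl

end InvariantFiltration

end Filtrations

section Eigenvalues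

universe u

variable {𝕜 : Type*} [RCLike 𝕜]
  {EG : Type*} [NormedAddCommGroup EG] [NormedSpace ℝ EG] [FiniteDimensional ℝ EG]
  {G : Type u} [TopologicalSpace G] [ChartedSpace EG G] [Group G] [LieGroup 𝓘(ℝ, EG) ∞ G]
  [LieAlgebra.IsSemisimple ℝ (GroupLieAlgebra 𝓘(ℝ, EG) G)]
  {EP : Type*} [NormedAddCommGroup EP] [NormedSpace ℝ EP]
  {P : Subgroup G} [ChartedSpace EP P]
  {W : Type*} [AddCommGroup W] [Module 𝕜 W] [FiniteDimensional 𝕜 W]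

variable (EG EP) in
/-- `c` is the eigenvalue of the curved Casimir operator on the natural bundle induced by `ρ`: on
every parabolic geometry of type `(G, P)`, the operator acts on the sections of this bundle as
multiplication by `c`. -/
def HasCasimirEigenvalue (ρ : Representation 𝕜 P W) (c : 𝕜) : Prop :=
  ∀ (X : ParabolicGeometry EG EP P) (σ : Sections X ρ), curvedCasimir X ρ σ = c • σ

/-- An invariant complex structure on the representation `ρ`. -/
def HasInvariantComplexStructure (ρ : Representation 𝕜 P W) : Prop :=
  ∃ J : ρ.IntertwiningMap ρ, ∀ w, J (J w) = -w

variable (EG EP) in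
/-- The condition, void for complex scalars, that the eigenvalue of the curved Casimir operator on
the bundle induced by the irreducible representation `ρ` is to be found in the field of scalars: if
the scalars are real and `ρ` has an invariant complex structure (so that the eigenvalue is a priori
a complex number, acting through that structure), then the operator acts by a real scalar. -/
def RealityCondition (ρ : Representation 𝕜 P W) : Prop :=
  (RCLike.I : 𝕜) = 0 → HasInvariantComplexStructure ρ → ∃ c, HasCasimirEigenvalue EG EP ρ c

variable (EG EP) in
/-- The numbers entering the construction of the splitting operator: `μ₀` is the eigenvalue of the
curved Casimir operator on the bundle induced by `W'`, and for `i < j ≤ N` the finite set `S j`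
consists of the different eigenvalues `μʲ₁, …, μʲₙ` of the curved Casimir operators on the bundles
induced by the irreducible components of `Wʲ / Wʲ⁺¹`. -/
structure IsEigenvalueSystem {ρ : Representation 𝕜 P W} {N : ℕ} (F : InvariantFiltration ρ N)
    (i : ℕ) (W' : Subrepresentation (F.gr i)) (μ₀ : 𝕜) (S : ℕ → Finset 𝕜) : Prop where
  eigenvalue : HasCasimirEigenvalue EG EP W'.toRepresentation μ₀
  exists_mem : ∀ j ∈ Finset.Ioc i N, ∀ V : Subrepresentation (F.gr j),
    V.toRepresentation.IsIrreducible → ∃ c ∈ S j, HasCasimirEigenvalue EG EP V.toRepresentation c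
  of_mem : ∀ j ∈ Finset.Ioc i N, ∀ c ∈ S j, ∃ V : Subrepresentation (F.gr j),
    V.toRepresentation.IsIrreducible ∧ HasCasimirEigenvalue EG EP V.toRepresentation c

/-- The operator `L = ∏_{j = i+1}^N ∏_{c ∈ S j} (𝒞 - c)` on `Γ(WM)`. The factors commute, being
polynomials in `𝒞`. -/
def casimirProduct (X : ParabolicGeometry EG EP P) (ρ : Representation 𝕜 P W) (i N : ℕ)
    (S : ℕ → Finset 𝕜) : Module.End 𝕜 (Sections X ρ) :=
  Polynomial.aeval (curvedCasimir X ρ)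
    (∏ j ∈ Finset.Ioc i N, ∏ c ∈ S j, (Polynomial.X - Polynomial.C c))

end Eigenvalues

section Splitting

universe u

variable {𝕜 : Type*} [RCLike 𝕜]
  {EG : Type*} [NormedAddCommGroup EG] [NormedSpace ℝ EG]
  {G : Type u} [TopologicalSpace G] [ChartedSpace EG G] [Group G]
  {EP : Type*} [NormedAddCommGroup EP] [NormedSpace ℝ EP]
  {P : Subgroup G} [ChartedSpace EP P]
  {W : Type*} [AddCommGroup W] [Module 𝕜 W] [FiniteDimensional 𝕜 W]

/-- Natural splitting operators for an irreducible component `W' ⊆ Wⁱ / Wⁱ⁺¹`: natural differential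
operators `T : Γ(W'M) → Γ(WⁱM)` that are injective and split the projection
`π : Γ(WⁱM) → Γ(WⁱM / Wⁱ⁺¹M)` over `Γ(W'M)`, up to a nonzero constant factor. -/
structure IsNaturalSplittingOperator {ρ : Representation 𝕜 P W} {N : ℕ}
    (F : InvariantFiltration ρ N) (i : ℕ) (W' : Subrepresentation (F.gr i))
    (T : ∀ X : ParabolicGeometry EG EP P,
      Sections X W'.toRepresentation →ₗ[𝕜] Sections X (F.step i).toRepresentation) : Prop where
  natural : IsNaturalOperator T
  injective : ∀ X, Function.Injective (T X)
  splits : ∃ c : 𝕜, c ≠ 0 ∧ ∀ X σ,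
    sectionsMap X (F.proj i) (T X σ) = c • sectionsMap X (inclusion W') σ

end Splitting

end CurvedCasimir

end

open CurvedCasimir

/-! The Killing form pairs the grading components `𝔤_k` and `𝔤_{-k}`. In dual bases adapted to the
grading, every summand `D²f(ξ, ξ')` of `𝒞 f` therefore has a slot in `𝔭`. Differentiation along `𝔭`
is algebraic: `ω` reproduces fundamental vector fields and `f` is equivariant, so `Df(u)(A)` is the
infinitesimal action of `A` on `f(u)`. For a second derivative with outer slot `A ∈ 𝔭`, equivariance
of `Df` leaves the action of `A` on `Df(u)(B)` and a term `Df(u)([A, B])`. If `𝔭₊` acts trivially on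
the fibre, every remaining derivative is along `𝔤₀` or vanishes, and `𝒞` is a fixed endomorphism of
the fibre (`exists_casimirFun_eq`).

The nilradical does act trivially on irreducible representations. A grading element makes the
elements of `𝔭₊` raise eigenvalues, so they have a common kernel vector in finite dimension
(`exists_common_kernel`); the common kernel is `P`-invariant because `𝔭₊` is `Ad(P)`-invariant,
hence it is everything. Complete reducibility extends this to the subquotients of the filtration.
Schur's lemma (`exists_scalar_or_complexStructure`) then yields the scalars, except over `ℝ` in the
presence of an invariant complex structure, where the reality assumption takes over.

Since `𝒞` commutes with all bundle maps induced by `P`-homomorphisms, the block `∏_c (𝒞 - c)` over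
the eigenvalues on `Wʲ/Wʲ⁺¹` annihilates sections of that subquotient, so it maps `Γ(WʲM)` into
`Γ(Wʲ⁺¹M)` (`casimirProduct_step`). All blocks with `j > i` together kill `Γ(Wⁱ⁺¹M)`: the value of
`L` on a section of `WⁱM` depends only on its projection, and `π ∘ L` acts on `Γ(W'M)` as the
polynomial evaluated at `μ₀`. Lifts of sections exist by a partition of unity
(`exists_isDiffOp_rightInverse`). They are not natural, but the independence of the lift makes the
descended operator natural: a lift can be pulled back along a morphism. Finite order holds because
iterated commutators of `𝒞` with functions leave a multiplication operator. -/

noncomputable section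

open scoped Topology

namespace CurvedCasimir

/-! ### The derivative of `Ad` is the Lie bracket. -/

section AdDerivative

variable {EG : Type*} [NormedAddCommGroup EG] [NormedSpace ℝ EG]
  {G : Type*} [TopologicalSpace G] [ChartedSpace EG G] [Group G] [LieGroup 𝓘(ℝ, EG) ∞ G]

variable (EG) in
/-- The orbit map `g ↦ Ad(g) B`, with values in the model space. -/
def adOrbit (B : EG) (g : G) : EG := groupAd EG g B

/-- Smooth dependence of a derivative on a parameter is available in tangent coordinates. Here both
base points, `1` and `g * 1 * g⁻¹`, equal the identity for every `g`, so the coordinate changes are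
trivial. -/
theorem adOrbit_eq_coord (g₀ g : G) (B : EG) :
    adOrbit EG B g = inTangentCoordinates 𝓘(ℝ, EG) 𝓘(ℝ, EG) (fun _ : G => (1 : G))
      (fun g => g * 1 * g⁻¹)
      (fun g => mfderiv 𝓘(ℝ, EG) 𝓘(ℝ, EG) (fun x : G => g * x * g⁻¹) 1) g₀ g B := by
  have : IsManifold 𝓘(ℝ, EG) 1 G := IsManifold.of_le (n := ∞) (by simp)
  rw [inTangentCoordinates_eq_mfderiv_comp (by simp) (by simp)]
  have h1 : ∀ y z : G, y = z → ∀ v : EG,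
      (mfderiv 𝓘(ℝ, EG) 𝓘(ℝ, EG) (extChartAt 𝓘(ℝ, EG) y) z v : EG) = v := by
    rintro y _ rfl v
    rw [mfderiv_extChartAt_self]
    rfl
  have h2 : mfderivWithin 𝓘(ℝ, EG) 𝓘(ℝ, EG) (extChartAt 𝓘(ℝ, EG) (1:G)).symm
    (Set.range 𝓘(ℝ, EG)) (extChartAt 𝓘(ℝ, EG) (1:G) 1) = ContinuousLinearMap.id _ _ :=
    mfderivWithin_range_extChartAt_symm
  rw [h2]
  exact (h1 _ _ (by simp) _).symm

theorem contMDiff_adOrbit (B : EG) :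
    ContMDiff 𝓘(ℝ, EG) 𝓘(ℝ, EG) ∞ (adOrbit EG B : G → EG) := by
  intro g₀
  have : IsManifold 𝓘(ℝ, EG) 1 G := IsManifold.of_le (n := ∞) (by simp)
  have h := ContMDiffAt.mfderiv (J := 𝓘(ℝ, EG)) (I := 𝓘(ℝ, EG)) (I' := 𝓘(ℝ, EG)) (m := ∞) (n := ∞)
    (x₀ := g₀) (fun g x : G => g * x * g⁻¹) (fun _ => 1) (by
      have h : ContMDiff (𝓘(ℝ, EG).prod 𝓘(ℝ, EG)) 𝓘(ℝ, EG) ∞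
        (fun q : G × G => q.1 * q.2 * q.1⁻¹) :=
        (contMDiff_fst.mul contMDiff_snd).mul contMDiff_fst.inv
      exact h.contMDiffAt) contMDiffAt_const (by simp)
  have h2 := h.clm_apply (contMDiffAt_const (c := B))
  exact h2.congr_of_eventuallyEq (Filter.Eventually.of_forall fun g => adOrbit_eq_coord g₀ g B)

/-- The multiplication of a Lie group in the preferred chart at the identity. -/
def chartMul (EG : Type*) [NormedAddCommGroup EG] [NormedSpace ℝ EG]
    (G : Type*) [TopologicalSpace G] [ChartedSpace EG G] [Group G] (q : EG × EG) : EG :=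
  extChartAt 𝓘(ℝ, EG) (1 : G)
    ((extChartAt 𝓘(ℝ, EG) (1 : G)).symm q.1 * (extChartAt 𝓘(ℝ, EG) (1 : G)).symm q.2)

local notation "φ" => extChartAt 𝓘(ℝ, EG) (1 : G)
local notation "ψ" => PartialEquiv.symm (extChartAt 𝓘(ℝ, EG) (1 : G))
local notation "e₀" => extChartAt 𝓘(ℝ, EG) (1 : G) (1 : G)

theorem contMDiffAt_chart_symm : ContMDiffAt 𝓘(ℝ, EG) 𝓘(ℝ, EG) ∞ (ψ : EG → G) e₀ := by
  exact (contMDiffOn_extChartAt_symm (n := ∞) (1 : G)).contMDiffAt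
    (extChartAt_target_mem_nhds (1 : G))

theorem contDiffAt_chartMul : ContDiffAt ℝ ∞ (chartMul EG G) (e₀, e₀) := by
  rw [← contMDiffAt_iff_contDiffAt]
  have h1 : ContMDiffAt 𝓘(ℝ, EG × EG) 𝓘(ℝ, EG) ∞ (fun q : EG × EG => (ψ q.1 : G)) (e₀, e₀) :=
    ContMDiffAt.comp (e₀, e₀) (g := (ψ : EG → G)) (f := Prod.fst) contMDiffAt_chart_symm
      contDiffAt_fst.contMDiffAt
  have h2 : ContMDiffAt 𝓘(ℝ, EG × EG) 𝓘(ℝ, EG) ∞ (fun q : EG × EG => (ψ q.2 : G)) (e₀, e₀) :=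
    ContMDiffAt.comp (e₀, e₀) (g := (ψ : EG → G)) (f := Prod.snd) contMDiffAt_chart_symm
      contDiffAt_snd.contMDiffAt
  have h3 := h1.mul h2
  refine ContMDiffAt.comp (e₀, e₀) (g := φ) ?_ h3
  have : (ψ e₀ * ψ e₀ : G) = 1 := by simp
  rw [this]
  exact contMDiffAt_extChartAt

theorem chartMul_base_left : ∀ᶠ x in 𝓝 e₀, chartMul EG G (x, e₀) = x := by
  filter_upwards [extChartAt_target_mem_nhds (I := 𝓘(ℝ, EG)) (1 : G)] with x hx
  rw [chartMul, extChartAt_to_inv, mul_one]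
  exact PartialEquiv.right_inv _ hx

theorem chartMul_base_right : ∀ᶠ x in 𝓝 e₀, chartMul EG G (e₀, x) = x := by
  filter_upwards [extChartAt_target_mem_nhds (I := 𝓘(ℝ, EG)) (1 : G)] with x hx
  rw [chartMul, extChartAt_to_inv, one_mul]
  exact PartialEquiv.right_inv _ hx

/-- The chain rule for the chart, the left translation by `g` and the inverse chart, whose
derivative at the base point is the identity. It links partial derivatives of `chartMul` to
left-invariant fields. -/
theorem hasFDerivAt_chart_mul_left {g : G} (hg : g ∈ (chartAt EG (1 : G)).source) :
    ∃ D : EG →L[ℝ] EG, HasFDerivAt (fun y => φ (g * ψ y)) D e₀ ∧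
      ∀ v : EG, D v = mfderiv 𝓘(ℝ, EG) 𝓘(ℝ, EG) φ g (mulInvariantVectorField v g) := by
  have : IsManifold 𝓘(ℝ, EG) 1 G := IsManifold.of_le (n := ∞) (by simp)
  have h1 : HasMFDerivAt 𝓘(ℝ, EG) 𝓘(ℝ, EG) (ψ : EG → G) e₀ (ContinuousLinearMap.id ℝ EG) := by
    have h := (contMDiffAt_chart_symm (EG := EG) (G := G)).mdifferentiableAt (by simp)
    have h2 := h.hasMFDerivAt
    have h3 := mfderivWithin_range_extChartAt_symm (I := 𝓘(ℝ, EG)) (x := (1 : G))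
    simp only [modelWithCornersSelf_coe, Set.range_id, mfderivWithin_univ] at h3
    rw [h3] at h2
    exact h2
  -- `ψ e₀ = 1` is not definitional, and the tangent spaces depend on the point. Quantifying over
  -- `z` with `z = 1` avoids a transport.
  have h2 : ∀ z : G, z = 1 → HasMFDerivAt 𝓘(ℝ, EG) 𝓘(ℝ, EG) (fun y : G => g * y) z
      (mfderiv 𝓘(ℝ, EG) 𝓘(ℝ, EG) (fun y : G => g * y) 1 : EG →L[ℝ] EG) := by
    rintro z rfl
    exact ((contMDiff_mul_left (I := 𝓘(ℝ, EG)) (n := ∞) (a := g)).mdifferentiable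
      (by simp) 1).hasMFDerivAt
  have h3 : ∀ z : G, z = g → HasMFDerivAt 𝓘(ℝ, EG) 𝓘(ℝ, EG) φ z
      (mfderiv 𝓘(ℝ, EG) 𝓘(ℝ, EG) φ g : EG →L[ℝ] EG) := by
    rintro z rfl
    exact (mdifferentiableAt_extChartAt hg).hasMFDerivAt
  have h4 := (h3 (g * ψ e₀) (by simp)).comp e₀ ((h2 (ψ e₀) (by simp)).comp e₀ h1)
  exact ⟨_, hasMFDerivAt_iff_hasFDerivAt.1 h4, fun v => rfl⟩

theorem hasFDerivAt_chart_conj (g : G) :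
    HasFDerivAt (fun y => φ (g * ψ y * g⁻¹)) (conjDeriv (EG := EG) g 1) e₀ := by
  have : IsManifold 𝓘(ℝ, EG) 1 G := IsManifold.of_le (n := ∞) (by simp)
  have h1 : HasMFDerivAt 𝓘(ℝ, EG) 𝓘(ℝ, EG) (ψ : EG → G) e₀ (ContinuousLinearMap.id ℝ EG) := by
    have h := (contMDiffAt_chart_symm (EG := EG) (G := G)).mdifferentiableAt (by simp)
    have h2 := h.hasMFDerivAt
    have h3 := mfderivWithin_range_extChartAt_symm (I := 𝓘(ℝ, EG)) (x := (1 : G))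
    simp only [modelWithCornersSelf_coe, Set.range_id, mfderivWithin_univ] at h3
    rw [h3] at h2
    exact h2
  have h2 : ∀ z : G, z = 1 → HasMFDerivAt 𝓘(ℝ, EG) 𝓘(ℝ, EG) (fun y : G => g * y * g⁻¹) z
      (conjDeriv g 1 : EG →L[ℝ] EG) := by
    rintro z rfl
    exact (mdiff_conj g 1).hasMFDerivAt
  have h3 : ∀ z : G, z = 1 → HasMFDerivAt 𝓘(ℝ, EG) 𝓘(ℝ, EG) φ z
      (ContinuousLinearMap.id ℝ EG) := by
    rintro z rfl
    have h := (mdifferentiableAt_extChartAt (I := 𝓘(ℝ, EG))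
      (mem_chart_source EG (1 : G))).hasMFDerivAt
    rw [mfderiv_extChartAt_self] at h
    exact h
  have h4 := (h3 (g * ψ e₀ * g⁻¹) (by simp)).comp e₀ ((h2 (ψ e₀) (by simp)).comp e₀ h1)
  exact hasMFDerivAt_iff_hasFDerivAt.1 h4

theorem eventually_differentiable_chartMul :
    ∀ᶠ q in 𝓝 (e₀, e₀), DifferentiableAt ℝ (chartMul EG G) q := by
  have h := (contDiffAt_chartMul (EG := EG) (G := G)).of_le (m := 1) (by simp)
  filter_upwards [h.eventually (by simp)] with q hq
  exact hq.differentiableAt (by simp)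

/-- The invariant vector fields in the chart. -/
theorem mpullback_mulInvariant (B : EG) : ∀ᶠ x in 𝓝 e₀,
    VectorField.mpullbackWithin 𝓘(ℝ, EG) 𝓘(ℝ, EG) (ψ : EG → G)
      (mulInvariantVectorField (I := 𝓘(ℝ, EG)) (G := G) B) (Set.range 𝓘(ℝ, EG)) x =
      fderiv ℝ (chartMul EG G) (x, e₀) (0, B) := by
  have : IsManifold 𝓘(ℝ, EG) 1 G := IsManifold.of_le (n := ∞) (by simp)
  have hc : Filter.Tendsto (fun x : EG => (x, e₀)) (𝓝 e₀) (𝓝 (e₀, e₀)) :=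
    Continuous.tendsto (by fun_prop) _
  filter_upwards [extChartAt_target_mem_nhds (I := 𝓘(ℝ, EG)) (1 : G),
    hc.eventually (eventually_differentiable_chartMul (EG := EG) (G := G))] with x hx hd
  have hs : (ψ x : G) ∈ (chartAt EG (1 : G)).source := by
    simpa using (extChartAt 𝓘(ℝ, EG) (1 : G)).map_target hx
  obtain ⟨D, hD, hDv⟩ := hasFDerivAt_chart_mul_left hs
  -- The function `y ↦ φ(ψ x * ψ y)` is `chartMul` with first argument `x`, so `D` is its partial
  -- derivative in the second slot.
  have h1 := hD.unique (hd.hasFDerivAt.comp e₀ (hasFDerivAt_prodMk_right x e₀))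
  have h2 : D B = fderiv ℝ (chartMul EG G) (x, e₀) (0, B) := by rw [h1]; simp
  rw [← h2, hDv, VectorField.mpullbackWithin_apply]
  refine ((isInvertible_mfderivWithin_extChartAt_symm hx).inverse_apply_eq).2 ?_
  exact (DFunLike.congr_fun (mfderivWithin_extChartAt_symm_comp_mfderiv_extChartAt hx)
    (mulInvariantVectorField (I := 𝓘(ℝ, EG)) (G := G) B (ψ x))).symm

/-- With `g = ψ x`, differentiate `g * y = (g * y * g⁻¹) * g` in `y` at the identity. The left side
varies the second factor, the right side varies the first factor with velocity `Ad(g) B`. -/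
theorem fderiv_chartMul_adOrbit (B : EG) : ∀ᶠ x in 𝓝 e₀,
    fderiv ℝ (chartMul EG G) (x, e₀) (0, B) =
      fderiv ℝ (chartMul EG G) (e₀, x) (adOrbit EG B (ψ x : G), 0) := by
  have hc : Filter.Tendsto (fun x : EG => (x, e₀)) (𝓝 e₀) (𝓝 (e₀, e₀)) :=
    Continuous.tendsto (by fun_prop) _
  have hc' : Filter.Tendsto (fun x : EG => (e₀, x)) (𝓝 e₀) (𝓝 (e₀, e₀)) :=
    Continuous.tendsto (by fun_prop) _
  filter_upwards [hc.eventually (eventually_differentiable_chartMul (EG := EG) (G := G)),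
    hc'.eventually (eventually_differentiable_chartMul (EG := EG) (G := G))] with x hd hd'
  set g : G := ψ x with hg
  have hk := hasFDerivAt_chart_conj (EG := EG) g
  have hke : φ (g * ψ e₀ * g⁻¹) = e₀ := by simp
  have h1 : HasFDerivAt (fun y => chartMul EG G (y, x))
      ((fderiv ℝ (chartMul EG G) (e₀, x)).comp (ContinuousLinearMap.inl ℝ EG EG))
      (φ (g * ψ e₀ * g⁻¹)) := by
    rw [hke]
    exact HasFDerivAt.comp (f := fun y => (y, x)) e₀ hd'.hasFDerivAt
      (hasFDerivAt_prodMk_left e₀ x)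
  have h2 := h1.comp e₀ hk
  have h3 : HasFDerivAt (fun y => chartMul EG G (x, y))
      ((fderiv ℝ (chartMul EG G) (x, e₀)).comp (ContinuousLinearMap.inr ℝ EG EG)) e₀ :=
    hd.hasFDerivAt.comp e₀ (hasFDerivAt_prodMk_right x e₀)
  have hcont : ContinuousAt (fun y : EG => g * ψ y * g⁻¹) e₀ := by
    have h := (contMDiffAt_chart_symm (EG := EG) (G := G)).continuousAt
    have h' := (contMDiff_conj (EG := EG) g).continuous.continuousAt.comp h
    exact h'
  have h4 : (fun y => chartMul EG G (x, y)) =ᶠ[𝓝 e₀]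
      (fun y => chartMul EG G (y, x)) ∘ fun y => φ (g * ψ y * g⁻¹) := by
    have hn : (extChartAt 𝓘(ℝ, EG) (1 : G)).source ∈ 𝓝 (g * ψ e₀ * g⁻¹) := by
      have : g * ψ e₀ * g⁻¹ = (1 : G) := by simp
      rw [this]
      exact extChartAt_source_mem_nhds _
    filter_upwards [hcont hn] with y hy
    have hy' : ψ (φ (g * ψ y * g⁻¹)) = g * ψ y * g⁻¹ := PartialEquiv.left_inv _ hy
    simp only [Function.comp_apply, chartMul]
    rw [hy', ← hg]
    congr 1
    group
  have h5 := h3.unique (h2.congr_of_eventuallyEq h4)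
  have h6 : fderiv ℝ (chartMul EG G) (x, e₀) (0, B) =
      fderiv ℝ (chartMul EG G) (e₀, x) (conjDeriv g 1 B, 0) := by
    simpa using DFunLike.congr_fun h5 B
  exact h6

/-- Differentiating `h` along `A` at `e` gives `D²m((A,0),(0,B)) = D²m((0,A),(B,0)) + O' A`. The
bracket is `D²m((A,0),(0,B)) - D²m((B,0),(0,A))`, and symmetry of the second derivative cancels
everything except `O' A`. -/
theorem lieBracket_of_local_mul {E : Type*} [NormedAddCommGroup E] [NormedSpace ℝ E]
    {m : E × E → E} {e A B : E} {O : E → E} {O' : E →L[ℝ] E}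
    (hm : ContDiffAt ℝ ∞ m (e, e)) (hl : ∀ᶠ x in 𝓝 e, m (x, e) = x)
    (hr : ∀ᶠ x in 𝓝 e, m (e, x) = x) (hO : HasFDerivAt O O' e) (hOe : O e = B)
    (h : ∀ᶠ x in 𝓝 e, fderiv ℝ m (x, e) (0, B) = fderiv ℝ m (e, x) (O x, 0)) :
    VectorField.lieBracket ℝ (fun x => fderiv ℝ m (x, e) (0, A))
      (fun x => fderiv ℝ m (x, e) (0, B)) e = O' A := by
  have hD : DifferentiableAt ℝ (fderiv ℝ m) (e, e) :=
    (hm.fderiv_right (m := 1) (by norm_cast)).differentiableAt one_ne_zero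
  have hsymm : IsSymmSndFDerivAt ℝ m (e, e) := hm.isSymmSndFDerivAt (by
    simpa using (ENat.LEInfty.out : (2 : WithTop ℕ∞) ≤ ∞))
  have hl' : HasFDerivAt (fun x : E => (x, e)) (ContinuousLinearMap.inl ℝ E E) e :=
    hasFDerivAt_prodMk_left e e
  have hr' : HasFDerivAt (fun x : E => (e, x)) (ContinuousLinearMap.inr ℝ E E) e :=
    hasFDerivAt_prodMk_right e e
  have hfield : ∀ B : E, HasFDerivAt (fun x => fderiv ℝ m (x, e) (0, B))
      ((ContinuousLinearMap.apply ℝ E ((0 : E), B)).comp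
        ((fderiv ℝ (fderiv ℝ m) (e, e)).comp (ContinuousLinearMap.inl ℝ E E))) e := fun B =>
    (ContinuousLinearMap.apply ℝ E ((0 : E), B)).hasFDerivAt.comp e
      (HasFDerivAt.comp (f := fun x => (x, e)) e hD.hasFDerivAt hl')
  have h1 : HasFDerivAt (fun x => fderiv ℝ m (e, x)) ((fderiv ℝ (fderiv ℝ m) (e, e)).comp
      (ContinuousLinearMap.inr ℝ E E)) e :=
    HasFDerivAt.comp (f := fun x => (e, x)) e hD.hasFDerivAt hr'
  have h2 := h1.clm_apply (hO.prodMk (hasFDerivAt_const (0 : E) e))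
  have h4 := DFunLike.congr_fun ((hfield B).unique (h2.congr_of_eventuallyEq h)) A
  have hm' : HasFDerivAt m (fderiv ℝ m (e, e)) (e, e) :=
    (hm.differentiableAt (by simp)).hasFDerivAt
  have hidl : ∀ v : E, fderiv ℝ m (e, e) (v, 0) = v := fun v => by
    have h5 : HasFDerivAt (fun x => m (x, e))
        ((fderiv ℝ m (e, e)).comp (ContinuousLinearMap.inl ℝ E E)) e :=
      HasFDerivAt.comp (f := fun x => (x, e)) e hm' hl'
    have h6 := h5.unique ((hasFDerivAt_id e).congr_of_eventuallyEq hl)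
    simpa using DFunLike.congr_fun h6 v
  have hidr : ∀ v : E, fderiv ℝ m (e, e) (0, v) = v := fun v => by
    have h5 : HasFDerivAt (fun x => m (e, x))
        ((fderiv ℝ m (e, e)).comp (ContinuousLinearMap.inr ℝ E E)) e :=
      HasFDerivAt.comp (f := fun x => (e, x)) e hm' hr'
    have h6 := h5.unique ((hasFDerivAt_id e).congr_of_eventuallyEq hr)
    simpa using DFunLike.congr_fun h6 v
  have hs := hsymm.eq (0, A) (B, 0)
  rw [VectorField.lieBracket, (hfield A).fderiv, (hfield B).fderiv, hidr, hidr]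
  simp only [ContinuousLinearMap.comp_apply, ContinuousLinearMap.apply_apply,
    ContinuousLinearMap.inl_apply, add_apply, ContinuousLinearMap.prod_apply,
    ContinuousLinearMap.flip_apply, ContinuousLinearMap.inr_apply, hOe,
    zero_apply, hidl] at h4 ⊢
  rw [h4, hs, add_sub_cancel_right]

/-- The manifold bracket is computed by pulling the fields back to the chart at `1`. There the
invariant fields are partial derivatives of `chartMul`, and the chart has identity derivative at its
centre. -/
theorem vecDeriv_adOrbit_eq_mlieBracket (A B : EG) :
    (vecDeriv (adOrbit EG B : G → EG) 1 A : EG) =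
      VectorField.mlieBracket 𝓘(ℝ, EG) (mulInvariantVectorField (I := 𝓘(ℝ, EG)) A)
        (mulInvariantVectorField (I := 𝓘(ℝ, EG)) B) (1 : G) := by
  have : IsManifold 𝓘(ℝ, EG) 1 G := IsManifold.of_le (n := ∞) (by simp)
  obtain ⟨O', hO⟩ : ∃ O' : EG →L[ℝ] EG,
      HasMFDerivAt 𝓘(ℝ, EG) 𝓘(ℝ, EG) (adOrbit EG B : G → EG) 1 O' :=
    ⟨_, ((contMDiff_adOrbit B 1).mdifferentiableAt (by simp)).hasMFDerivAt⟩
  have hO2 : HasFDerivAt (fun x => adOrbit EG B (ψ x : G)) O' e₀ := by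
    have h := hO.2
    rw [show Set.range 𝓘(ℝ, EG) = Set.univ by simp] at h
    exact hasFDerivWithinAt_univ.1 h
  refine (vecDeriv_eq hO A).trans ?_
  have hO1 : adOrbit EG B (ψ e₀ : G) = B := by
    rw [extChartAt_to_inv]; exact groupAd_one B
  have h := lieBracket_of_local_mul (A := A) (contDiffAt_chartMul (EG := EG) (G := G))
    chartMul_base_left chartMul_base_right hO2 hO1 (fderiv_chartMul_adOrbit B)
  refine h.symm.trans ?_
  rw [← VectorField.mlieBracketWithin_univ,
    VectorField.mlieBracketWithin_apply]
  have h1 : (mfderiv 𝓘(ℝ, EG) 𝓘(ℝ, EG) φ (1 : G) : EG →L[ℝ] EG).inverse =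
      ContinuousLinearMap.id ℝ EG := by
    rw [mfderiv_extChartAt_self]
    exact ContinuousLinearMap.inverse_id
  refine Eq.trans ?_ (DFunLike.congr_fun h1 _).symm
  have h2 : ∀ (V V' U U' : EG → EG) (s : Set EG), s = Set.univ → V =ᶠ[𝓝 e₀] V' →
      U =ᶠ[𝓝 e₀] U' →
      VectorField.lieBracket ℝ V' U' e₀ = VectorField.lieBracketWithin ℝ V U s e₀ := by
    rintro V V' U U' s rfl hV hU
    rw [VectorField.lieBracketWithin_univ]
    exact (Filter.EventuallyEq.lieBracket_vectorField_eq hV hU).symm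
  exact h2 _ _ _ _ _ (by simp) (mpullback_mulInvariant A) (mpullback_mulInvariant B)

/-- The derivative of the adjoint representation of a Lie group is the adjoint representation of
its Lie algebra. -/
theorem vecDeriv_adOrbit (A B : GroupLieAlgebra 𝓘(ℝ, EG) G) :
    (vecDeriv (V := EG) (adOrbit EG B) (1 : G) A : GroupLieAlgebra 𝓘(ℝ, EG) G) = ⁅A, B⁆ :=
  vecDeriv_adOrbit_eq_mlieBracket (EG := EG) A B

end AdDerivative

/-! ### Product rules for vector-valued functions. -/

section ProductRule

variable {𝕜 : Type*} [RCLike 𝕜]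
  {E : Type*} [NormedAddCommGroup E] [NormedSpace ℝ E]
  {N : Type*} [TopologicalSpace N] [ChartedSpace E N]
  {V : Type*} [NormedAddCommGroup V] [NormedSpace ℝ V]
  {W : Type*} [AddCommGroup W] [Module 𝕜 W] [FiniteDimensional 𝕜 W]
  {W' : Type*} [AddCommGroup W'] [Module 𝕜 W'] [FiniteDimensional 𝕜 W']

theorem vecDeriv_const (c : V) (x : N) (v : TangentSpace 𝓘(ℝ, E) x) :
    vecDeriv (fun _ : N => c) x v = 0 :=
  vecDeriv_eq (hasMFDerivAt_const _ _) v

theorem SmoothVec.smul {c : N → 𝕜} (hc : ContMDiff 𝓘(ℝ, E) 𝓘(ℝ, 𝕜) ∞ c) {f : N → W}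
    (hf : SmoothVec 𝕜 E f) : SmoothVec 𝕜 E (fun x => c x • f x) := by
  have h : ContMDiff 𝓘(ℝ, E) 𝓘(ℝ, Fin (Module.finrank 𝕜 W) → 𝕜) ∞
      (fun x => ContinuousLinearMap.lsmul ℝ 𝕜 (c x) (coords 𝕜 W (f x))) :=
    ((ContinuousLinearMap.lsmul ℝ 𝕜).contMDiff.comp hc).clm_apply hf
  exact h.congr fun x => by simp

theorem dirDeriv_smul {c : N → 𝕜} (hc : ContMDiff 𝓘(ℝ, E) 𝓘(ℝ, 𝕜) ∞ c) {f : N → W}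
    (hf : SmoothVec 𝕜 E f) (x : N) (v : TangentSpace 𝓘(ℝ, E) x) :
    dirDeriv 𝕜 (fun x => c x • f x) x v = c x • dirDeriv 𝕜 f x v + vecDeriv c x v • f x := by
  obtain ⟨c', hc'⟩ : ∃ c' : E →L[ℝ] 𝕜, HasMFDerivAt 𝓘(ℝ, E) 𝓘(ℝ, 𝕜) c x c' :=
    ⟨_, (hc.mdifferentiable (by simp) x).hasMFDerivAt⟩
  obtain ⟨f', hf'⟩ : ∃ f' : E →L[ℝ] (Fin (Module.finrank 𝕜 W) → 𝕜),
      HasMFDerivAt 𝓘(ℝ, E) 𝓘(ℝ, Fin (Module.finrank 𝕜 W) → 𝕜) (fun x => coords 𝕜 W (f x)) x f' :=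
    ⟨_, (hf.mdiff x).hasMFDerivAt⟩
  have h : HasMFDerivAt 𝓘(ℝ, E) 𝓘(ℝ, Fin (Module.finrank 𝕜 W) → 𝕜)
      (fun x => c x • coords 𝕜 W (f x)) x (c x • f' + c'.smulRight (coords 𝕜 W (f x)) :
        E →L[ℝ] (Fin (Module.finrank 𝕜 W) → 𝕜)) := by
    constructor
    · exact hc'.1.smul hf'.1
    · have h1 := hc'.2.smul hf'.2
      -- The product rule in the chart produces the values of the chart representatives; these are
      -- the values of the functions at `x`.
      have e : ∀ (V : Type _) [NormedAddCommGroup V] [NormedSpace ℝ V] (F : N → V),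
          writtenInExtChartAt 𝓘(ℝ, E) 𝓘(ℝ, V) x F (extChartAt 𝓘(ℝ, E) x x) = F x := by
        intro V _ _ F
        exact congrArg F (extChartAt_to_inv x)
      rw [e 𝕜 c, e _ (fun x => coords 𝕜 W (f x))] at h1
      exact h1
  unfold dirDeriv
  simp only [map_smul]
  rw [vecDeriv_eq h, vecDeriv_eq hc', vecDeriv_eq hf', LinearEquiv.symm_apply_eq]
  simp only [map_add, map_smul, LinearEquiv.apply_symm_apply]
  rfl

theorem SmoothVec.sum {ι : Type*} (s : Finset ι) {f : ι → N → W}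
    (hf : ∀ i ∈ s, SmoothVec 𝕜 E (f i)) : SmoothVec 𝕜 E (fun x => ∑ i ∈ s, f i x) := by
  classical
  induction s using Finset.induction_on with
  | empty => exact SmoothVec.zero
  | insert a s ha ih =>
    simp only [Finset.sum_insert ha]
    exact (hf a (by simp)).add (ih fun i hi => hf i (by simp [hi]))

theorem dirDeriv_sum {ι : Type*} (s : Finset ι) {f : ι → N → W}
    (hf : ∀ i ∈ s, SmoothVec 𝕜 E (f i)) (x : N) (v : TangentSpace 𝓘(ℝ, E) x) :
    dirDeriv 𝕜 (fun x => ∑ i ∈ s, f i x) x v = ∑ i ∈ s, dirDeriv 𝕜 (f i) x v := by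
  classical
  induction s using Finset.induction_on with
  | empty =>
    have h := dirDeriv_comp_linear (0 : W →ₗ[𝕜] W) (SmoothVec.zero (𝕜 := 𝕜) (E := E) (N := N)) x v
    simpa using h
  | insert a s ha ih =>
    simp only [Finset.sum_insert ha]
    rw [← ih fun i hi => hf i (by simp [hi])]
    exact dirDeriv_add (hf a (by simp)) (SmoothVec.sum s fun i hi => hf i (by simp [hi])) x v

theorem smooth_coord {f : N → W} (hf : SmoothVec 𝕜 E f) (k : Fin (Module.finrank 𝕜 W)) :
    ContMDiff 𝓘(ℝ, E) 𝓘(ℝ, 𝕜) ∞ (fun x => coords 𝕜 W (f x) k) :=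
  (ContinuousLinearMap.proj (R := ℝ) (φ := fun _ : Fin (Module.finrank 𝕜 W) => 𝕜) k).contMDiff.comp
    hf

theorem sum_coords (w : W) : ∑ k, coords 𝕜 W w k • Module.finBasis 𝕜 W k = w :=
  (Module.finBasis 𝕜 W).sum_equivFun w

/-- Expansion in a basis reduces families of linear maps to finite sums of scalar functions times
vector functions. -/
theorem family_apply_eq (R : N → W →ₗ[𝕜] W') (f : N → W) :
    (fun x => R x (f x)) = fun x => ∑ k, coords 𝕜 W (f x) k • R x (Module.finBasis 𝕜 W k) := by
  funext x
  conv_lhs => rw [← sum_coords (𝕜 := 𝕜) (f x)]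
  simp

theorem SmoothVec.family_apply {R : N → W →ₗ[𝕜] W'} (hR : ∀ w, SmoothVec 𝕜 E (fun x => R x w))
    {f : N → W} (hf : SmoothVec 𝕜 E f) : SmoothVec 𝕜 E (fun x => R x (f x)) := by
  rw [family_apply_eq]
  exact SmoothVec.sum _ fun k _ => SmoothVec.smul (smooth_coord hf k) (hR _)

theorem SmoothVec.const (w : W) : SmoothVec 𝕜 E (fun _ : N => w) :=
  contMDiff_const

theorem dirDeriv_const (w : W) (x : N) (v : TangentSpace 𝓘(ℝ, E) x) :
    dirDeriv 𝕜 (fun _ : N => w) x v = 0 := by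
  unfold dirDeriv
  rw [vecDeriv_const, map_zero]

/-- The product rule for the evaluation of a smooth family of linear maps. -/
theorem dirDeriv_family_apply {R : N → W →ₗ[𝕜] W'} (hR : ∀ w, SmoothVec 𝕜 E (fun x => R x w))
    {f : N → W} (hf : SmoothVec 𝕜 E f) (x : N) (v : TangentSpace 𝓘(ℝ, E) x) :
    dirDeriv 𝕜 (fun y => R y (f y)) x v =
      dirDeriv 𝕜 (fun y => R y (f x)) x v + R x (dirDeriv 𝕜 f x v) := by
  rw [family_apply_eq R f, family_apply_eq R (fun _ => f x), dirDeriv_sum _ fun k _ =>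
    SmoothVec.smul (smooth_coord hf k) (hR _), dirDeriv_sum _ fun k _ =>
    SmoothVec.smul contMDiff_const (hR _)]
  rw [← dirDeriv_comp_linear (R x) hf, family_apply_eq (fun _ => R x) f, dirDeriv_sum _ fun k _ =>
    SmoothVec.smul (smooth_coord hf k) (SmoothVec.const _), ← Finset.sum_add_distrib]
  refine Finset.sum_congr rfl fun k _ => ?_
  rw [dirDeriv_smul (smooth_coord hf k) (hR _), dirDeriv_smul contMDiff_const (hR _),
    dirDeriv_smul (smooth_coord hf k) (SmoothVec.const _), dirDeriv_const,
    vecDeriv_const, smul_zero, zero_add, zero_smul, add_zero]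

/-- A real-linear map with values in a vector space over `𝕜`, in coordinates. -/
theorem exists_real_coord [FiniteDimensional ℝ V] (l : V → W) (hadd : ∀ v w, l (v + w) = l v + l w)
    (hsmul : ∀ (c : ℝ) v, l (c • v) = (c : 𝕜) • l v) :
    ∃ L : V →L[ℝ] (Fin (Module.finrank 𝕜 W) → 𝕜), ∀ v, L v = coords 𝕜 W (l v) := by
  let L : V →ₗ[ℝ] (Fin (Module.finrank 𝕜 W) → 𝕜) :=
    { toFun := fun v => coords 𝕜 W (l v)
      map_add' := fun v w => by rw [hadd, map_add]
      map_smul' := fun c v => by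
        rw [hsmul, map_smul]
        exact (RCLike.real_smul_eq_coe_smul (K := 𝕜) _ _).symm }
  exact ⟨L.toContinuousLinearMap, fun v => rfl⟩

theorem SmoothVec.real_linear_comp [FiniteDimensional ℝ V] {l : V → W}
    (hadd : ∀ v w, l (v + w) = l v + l w)
    (hsmul : ∀ (c : ℝ) v, l (c • v) = (c : 𝕜) • l v) {H : N → V}
    (hH : ContMDiff 𝓘(ℝ, E) 𝓘(ℝ, V) ∞ H) : SmoothVec 𝕜 E (fun x => l (H x)) := by
  obtain ⟨L, hL⟩ := exists_real_coord l hadd hsmul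
  exact (L.contMDiff.comp hH).congr fun x => (hL _).symm

theorem dirDeriv_real_linear_comp [FiniteDimensional ℝ V] {l : V → W}
    (hadd : ∀ v w, l (v + w) = l v + l w)
    (hsmul : ∀ (c : ℝ) v, l (c • v) = (c : 𝕜) • l v) {H : N → V}
    (hH : ContMDiff 𝓘(ℝ, E) 𝓘(ℝ, V) ∞ H) (x : N) (v : TangentSpace 𝓘(ℝ, E) x) :
    dirDeriv 𝕜 (fun x => l (H x)) x v = l (vecDeriv H x v) := by
  obtain ⟨L, hL⟩ := exists_real_coord l hadd hsmul
  have h := vecDeriv_clm_comp L (hH.mdifferentiable (by simp) x) v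
  unfold dirDeriv
  simp only [← hL]
  rw [h, hL, LinearEquiv.symm_apply_apply]

end ProductRule

/-! ### The infinitesimal action of the Lie algebra of `P`. -/

section InfinitesimalAction

variable {𝕜 : Type*} [RCLike 𝕜]
  {G : Type*} [TopologicalSpace G] [Group G]
  {EP : Type*} [NormedAddCommGroup EP] [NormedSpace ℝ EP]
  {P : Subgroup G} [ChartedSpace EP P]
  {W : Type*} [AddCommGroup W] [Module 𝕜 W] [FiniteDimensional 𝕜 W]

/-- The derivative at the identity of `h ↦ ρ(h) w`. -/
def infRep {ρ : Representation 𝕜 P W} (hρ : IsSmoothRep EP ρ) (A : GroupLieAlgebra 𝓘(ℝ, EP) P) :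
    W →ₗ[𝕜] W where
  toFun w := dirDeriv 𝕜 (fun h : P => ρ h w) 1 A
  map_add' v w := by
    rw [← dirDeriv_add (hρ v) (hρ w)]
    congr 1
    funext h
    simp
  map_smul' c w := by
    have h := dirDeriv_comp_linear (c • (LinearMap.id : W →ₗ[𝕜] W)) (hρ w) 1 A
    simp only [LinearMap.smul_apply, LinearMap.id_apply] at h
    simp only [map_smul]
    exact h

variable [LieGroup 𝓘(ℝ, EP) ∞ P]

theorem IsSmoothRep.inv {ρ : Representation 𝕜 P W} (hρ : IsSmoothRep EP ρ) (w : W) :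
    SmoothVec 𝕜 EP (fun h : P => ρ h⁻¹ w) :=
  (hρ w).comp (contMDiff_inv 𝓘(ℝ, EP) ∞)

/-- The derivative at the identity of `h ↦ ρ(h⁻¹) w`. -/
def infAct {ρ : Representation 𝕜 P W} (hρ : IsSmoothRep EP ρ) (A : GroupLieAlgebra 𝓘(ℝ, EP) P) :
    W →ₗ[𝕜] W where
  toFun w := dirDeriv 𝕜 (fun h : P => ρ h⁻¹ w) 1 A
  map_add' v w := by
    rw [← dirDeriv_add (hρ.inv v) (hρ.inv w)]
    congr 1
    funext h
    simp
  map_smul' c w := by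
    have h := dirDeriv_comp_linear (c • (LinearMap.id : W →ₗ[𝕜] W)) (hρ.inv w) 1 A
    simp only [LinearMap.smul_apply, LinearMap.id_apply] at h
    simp only [map_smul]
    exact h

variable {ρ : Representation 𝕜 P W} (hρ : IsSmoothRep EP ρ)

theorem infAct_apply (A : GroupLieAlgebra 𝓘(ℝ, EP) P) (w : W) :
    infAct hρ A w = dirDeriv 𝕜 (fun h : P => ρ h⁻¹ w) 1 A := rfl

theorem infAct_add (A B : GroupLieAlgebra 𝓘(ℝ, EP) P) (w : W) :
    infAct hρ (A + B) w = infAct hρ A w + infAct hρ B w :=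
  dirDeriv_add_right _ _ _ _

theorem infAct_smul (c : ℝ) (A : GroupLieAlgebra 𝓘(ℝ, EP) P) (w : W) :
    infAct hρ (c • A) w = (c : 𝕜) • infAct hρ A w :=
  dirDeriv_smul_right _ _ _ _

theorem infAct_intertwining {W' : Type*} [AddCommGroup W'] [Module 𝕜 W'] [FiniteDimensional 𝕜 W']
    {ρ' : Representation 𝕜 P W'} (hρ' : IsSmoothRep EP ρ') (Φ : ρ.IntertwiningMap ρ')
    (A : GroupLieAlgebra 𝓘(ℝ, EP) P) (w : W) : Φ (infAct hρ A w) = infAct hρ' A (Φ w) := by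
  have h := dirDeriv_comp_linear Φ.toLinearMap (hρ.inv w) 1 A
  refine h.symm.trans ?_
  rw [infAct_apply]
  congr 1
  funext k
  exact Φ.isIntertwining ρ ρ' k⁻¹ w

/-- Differentiate `ρ(h) ρ(k⁻¹) w = ρ((h k h⁻¹)⁻¹) ρ(h) w` in `k` at the identity. -/
theorem infAct_conj (h : P) (A : GroupLieAlgebra 𝓘(ℝ, EP) P) (w : W) :
    ρ h (infAct hρ A w) = infAct hρ (groupAd EP h A) (ρ h w) := by
  have h1 := dirDeriv_comp_linear (ρ h) (hρ.inv w) 1 A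
  have h2 := dirDeriv_comp (hρ.inv (ρ h w)) (contMDiff_conj (EG := EP) h) 1 A
  have h3 : ∀ (x : P) (v : EP), x = 1 →
      dirDeriv 𝕜 (fun k : P => ρ k⁻¹ (ρ h w)) x v = dirDeriv 𝕜 (fun k : P => ρ k⁻¹ (ρ h w)) 1 v := by
    rintro x v rfl
    rfl
  rw [infAct_apply, ← h1, infAct_apply]
  refine Eq.trans ?_ (h2.trans (h3 _ _ (by simp)))
  congr 1
  funext k
  rw [← Module.End.mul_apply, ← map_mul, ← Module.End.mul_apply, ← map_mul]
  congr 2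
  group

/-- The derivative of `infAct_conj` in `h` at the identity, along `A`: the bracket comes from
differentiating `Ad(h) B`. Using both `infRep` and `infAct` makes the sign relation between them
unnecessary. -/
theorem infRep_infAct [FiniteDimensional ℝ EP] (A B : GroupLieAlgebra 𝓘(ℝ, EP) P) (w : W) :
    infRep hρ A (infAct hρ B w) = infAct hρ ⁅A, B⁆ w + infAct hρ B (infRep hρ A w) := by
  have hs : ∀ w, SmoothVec 𝕜 EP (fun h : P => infAct hρ (adOrbit EP B h) w) := fun w =>
    SmoothVec.real_linear_comp (V := EP) (l := fun A => infAct hρ A w)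
      (fun A B => infAct_add hρ A B w) (fun c A => infAct_smul hρ c A w) (contMDiff_adOrbit (EG := EP) B)
  have h1 := dirDeriv_family_apply (R := fun h : P => infAct hρ (adOrbit EP B h)) hs (hρ w) 1 A
  have h2 := dirDeriv_real_linear_comp (V := EP) (l := fun A => infAct hρ A w)
      (fun A B => infAct_add hρ A B w) (fun c A => infAct_smul hρ c A w)
      (contMDiff_adOrbit (EG := EP) (G := P) B) 1 A
  simp only [map_one, Module.End.one_apply] at h1
  rw [h2] at h1
  have h3 : (fun h : P => infAct hρ (adOrbit EP B h) (ρ h w)) = fun h => ρ h (infAct hρ B w) :=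
    funext fun h => (infAct_conj hρ h B w).symm
  rw [h3] at h1
  refine h1.trans ?_
  have h4 : adOrbit EP B (1 : P) = B := groupAd_one B
  rw [h4]
  congr 1
  exact congrArg (fun Z => infAct hρ Z w) (vecDeriv_adOrbit A B)

end InfinitesimalAction

/-! ### Fundamental derivatives in directions of `𝔭`. -/

section InfinitesimalGeometry

universe u

variable {𝕜 : Type*} [RCLike 𝕜]
  {EG : Type*} [NormedAddCommGroup EG] [NormedSpace ℝ EG] [FiniteDimensional ℝ EG]
  {G : Type u} [TopologicalSpace G] [ChartedSpace EG G] [Group G] [LieGroup 𝓘(ℝ, EG) ∞ G]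
  {EP : Type*} [NormedAddCommGroup EP] [NormedSpace ℝ EP] [FiniteDimensional ℝ EP]
  {P : Subgroup G} [ChartedSpace EP P] [LieGroup 𝓘(ℝ, EP) ∞ P]
  {W : Type*} [AddCommGroup W] [Module 𝕜 W] [FiniteDimensional 𝕜 W]

theorem subgroupLieMap_groupAd (hP : IsParabolicSubgroup EG EP P) (h : P)
    (A : GroupLieAlgebra 𝓘(ℝ, EP) P) :
    subgroupLieMap EG EP P (groupAd EP h A) = groupAd EG (h : G) (subgroupLieMap EG EP P A) := by
  have hv : ∀ x : P, MDifferentiableAt 𝓘(ℝ, EP) 𝓘(ℝ, EG) (Subtype.val : P → G) x :=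
    hP.contMDiff_val.mdifferentiable (by simp)
  have h1 := mfderiv_comp_apply (I := 𝓘(ℝ, EP)) (I' := 𝓘(ℝ, EP)) (I'' := 𝓘(ℝ, EG)) (1 : P)
    (hv (h * 1 * h⁻¹)) (mdiff_conj (EG := EP) h 1) A
  have h2 := mfderiv_comp_apply (I := 𝓘(ℝ, EP)) (I' := 𝓘(ℝ, EG)) (I'' := 𝓘(ℝ, EG)) (1 : P)
    (mdiff_conj (EG := EG) (h : G) ((1 : P) : G)) (hv 1) A
  have h3 : (Subtype.val : P → G) ∘ (fun y : P => h * y * h⁻¹) =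
      (fun y : G => h * y * (h : G)⁻¹) ∘ Subtype.val := by
    funext y; simp
  have h4 : ∀ (x : P) (v : EP), x = 1 →
      (mfderiv 𝓘(ℝ, EP) 𝓘(ℝ, EG) (Subtype.val : P → G) x v : EG) =
        mfderiv 𝓘(ℝ, EP) 𝓘(ℝ, EG) (Subtype.val : P → G) 1 v := by
    rintro x v rfl
    rfl
  rw [h3] at h1
  exact (h4 (h * 1 * h⁻¹) _ (by simp)).symm.trans (h1.symm.trans h2)

/-- The inclusion intertwines the adjoint actions, and differentiating `Ad` gives the bracket in
either group. -/
theorem subgroupLieMap_lie (hP : IsParabolicSubgroup EG EP P) (A B : GroupLieAlgebra 𝓘(ℝ, EP) P) :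
    subgroupLieMap EG EP P ⁅A, B⁆ = ⁅subgroupLieMap EG EP P A, subgroupLieMap EG EP P B⁆ := by
  have h1 := vecDeriv_comp (F := adOrbit EG (subgroupLieMap EG EP P B))
    (g := (Subtype.val : P → G)) (x := 1)
    ((contMDiff_adOrbit (EG := EG) (G := G) (subgroupLieMap EG EP P B)).mdifferentiable
      (by simp) _) (hP.contMDiff_val.mdifferentiable (by simp) _) A
  let L : EP →L[ℝ] EG := LinearMap.toContinuousLinearMap (subgroupLieMap EG EP P : EP →ₗ[ℝ] EG)
  have h2 := vecDeriv_clm_comp L (F := adOrbit EP B) (x := (1 : P))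
    ((contMDiff_adOrbit (EG := EP) (G := P) B).mdifferentiable (by simp) _) A
  have h3 : (fun h : P => L (adOrbit EP B h)) =
      fun h : P => adOrbit EG (subgroupLieMap EG EP P B) (h : G) :=
    funext fun h => subgroupLieMap_groupAd hP h B
  rw [h3] at h2
  have h4 : L (vecDeriv (V := EP) (adOrbit EP B) (1 : P) A) = subgroupLieMap EG EP P ⁅A, B⁆ :=
    congrArg (subgroupLieMap EG EP P) (vecDeriv_adOrbit A B)
  rw [← h4, ← h2, h1]
  exact vecDeriv_adOrbit (EG := EG) _ _

/-- As `ω` reproduces the generators of fundamental fields, the tangent vector corresponding to `A`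
is the velocity of the orbit map `h ↦ u · h`. -/
theorem fundDeriv_subgroupLieMap (X : ParabolicGeometry EG EP P) {F : X.𝒢 → W}
    (hF : SmoothVec 𝕜 EG F) (u : X.𝒢) (A : GroupLieAlgebra 𝓘(ℝ, EP) P) :
    fundDeriv 𝕜 X F u (subgroupLieMap EG EP P A) =
      dirDeriv 𝕜 (fun h : P => F (X.act u h)) 1 A := by
  have hg : ContMDiff 𝓘(ℝ, EP) 𝓘(ℝ, EG) ∞ (fun h : P => X.act u h) :=
    X.contMDiff_act.comp (contMDiff_const.prodMk contMDiff_id)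
  rw [dirDeriv_comp hF hg]
  have h1 : fundDeriv 𝕜 X F (X.act u 1) (subgroupLieMap EG EP P A) =
      dirDeriv 𝕜 F (X.act u 1) (mfderiv 𝓘(ℝ, EP) 𝓘(ℝ, EG) (fun h : P => X.act u h) 1 A) := by
    unfold fundDeriv
    rw [← X.conn_fundamental, LinearEquiv.symm_apply_apply]
  rw [← h1, X.act_one]

variable {ρ : Representation 𝕜 P W} (hρ : IsSmoothRep EP ρ)

theorem fundDeriv_eq_infAct (X : ParabolicGeometry EG EP P) {f : X.𝒢 → W} (hf : f ∈ Sections X ρ)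
    (u : X.𝒢) (A : GroupLieAlgebra 𝓘(ℝ, EP) P) :
    fundDeriv 𝕜 X f u (subgroupLieMap EG EP P A) = infAct hρ A (f u) := by
  rw [fundDeriv_subgroupLieMap X hf.1, infAct_apply]
  congr 1
  funext h
  exact hf.2 u h

/-- `Df` is itself equivariant: `Df(u · h)(B) = ρ(h⁻¹) Df(u)(Ad(h) B)`. The product rule at `h = 1`
gives one term from `ρ(h⁻¹)` and one from `Ad(h) B`. -/
theorem fundDeriv₂_subgroupLieMap (hP : IsParabolicSubgroup EG EP P) (X : ParabolicGeometry EG EP P)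
    {f : X.𝒢 → W} (hf : f ∈ Sections X ρ) (u : X.𝒢) (A : GroupLieAlgebra 𝓘(ℝ, EP) P)
    (B : GroupLieAlgebra 𝓘(ℝ, EG) G) :
    fundDeriv₂ 𝕜 X f u (subgroupLieMap EG EP P A) B =
      infAct hρ A (fundDeriv 𝕜 X f u B) +
        fundDeriv 𝕜 X f u ⁅subgroupLieMap EG EP P A, B⁆ := by
  unfold fundDeriv₂
  rw [fundDeriv_subgroupLieMap X (smooth_fundDeriv X hf.1 B)]
  have h1 : (fun h : P => fundDeriv 𝕜 X f (X.act u h) B) =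
      fun h : P => ρ h⁻¹ (fundDeriv 𝕜 X f u (adOrbit EG B (h : G))) := by
    funext h
    exact fundDeriv_act X h (ρ h⁻¹) hf.1 hf.1 (fun w => hf.2 w h) u B
  have hO : ContMDiff 𝓘(ℝ, EP) 𝓘(ℝ, EG) ∞ (fun h : P => adOrbit EG B (h : G)) :=
    (contMDiff_adOrbit (EG := EG) B).comp hP.contMDiff_val
  have hs := SmoothVec.real_linear_comp (V := EG) (l := fun A => fundDeriv 𝕜 X f u A)
    (fun A B => fundDeriv_add_right X f u A B) (fun c A => fundDeriv_smul_right X f u c A) hO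
  have hd := dirDeriv_real_linear_comp (V := EG) (l := fun A => fundDeriv 𝕜 X f u A)
    (fun A B => fundDeriv_add_right X f u A B) (fun c A => fundDeriv_smul_right X f u c A) hO 1 A
  rw [h1, dirDeriv_family_apply (fun w => hρ.inv w) hs, hd]
  have h2 : adOrbit EG B ((1 : P) : G) = B := groupAd_one B
  have h3 := vecDeriv_comp (F := adOrbit EG B) (g := (Subtype.val : P → G)) (x := 1)
    ((contMDiff_adOrbit (EG := EG) (G := G) B).mdifferentiable
      (by simp) _) (hP.contMDiff_val.mdifferentiable (by simp) _) A
  have h4 : vecDeriv (fun h : P => adOrbit EG B (h : G)) 1 A = ⁅subgroupLieMap EG EP P A, B⁆ :=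
    h3.trans (vecDeriv_adOrbit (EG := EG) _ _)
  rw [h2, h4, infAct_apply]
  simp

end InfinitesimalGeometry

/-! ### Grading elements and the Killing form. -/

section GradingElement

variable {L : Type*} [LieRing L] [LieAlgebra ℝ L] [FiniteDimensional ℝ L] [LieAlgebra.IsKilling ℝ L]

/-- The eigenspace of `ad E` for the integer `k`. -/
def adEigenspace (E : L) (k : ℤ) : Submodule ℝ L :=
  (LieAlgebra.ad ℝ L E).eigenspace (k : ℝ)

theorem mem_adEigenspace {E X : L} {k : ℤ} : X ∈ adEigenspace E k ↔ ⁅E, X⁆ = (k : ℝ) • X :=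
  Module.End.mem_eigenspace_iff

theorem lie_mem_adEigenspace {E X Y : L} {j k : ℤ} (hX : X ∈ adEigenspace E j)
    (hY : Y ∈ adEigenspace E k) : ⁅X, Y⁆ ∈ adEigenspace E (j + k) := by
  rw [mem_adEigenspace] at *
  rw [leibniz_lie, hX, hY, smul_lie, lie_smul, ← add_smul]
  push_cast
  rfl

/-- The derivation defining a grading of a Lie algebra. -/
theorem exists_grading_derivation {𝔤 : ℤ → Submodule ℝ L} (h𝔤 : DirectSum.IsInternal 𝔤)
    (hlie : ∀ i j, ∀ X ∈ 𝔤 i, ∀ Y ∈ 𝔤 j, ⁅X, Y⁆ ∈ 𝔤 (i + j)) :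
    ∃ D : LieDerivation ℝ L L, ∀ (k : ℤ), ∀ X ∈ 𝔤 k, D X = (k : ℝ) • X := by
  let e := LinearEquiv.ofBijective (DirectSum.coeLinearMap 𝔤) h𝔤
  let D : L →ₗ[ℝ] L :=
    DirectSum.toModule ℝ ℤ L (fun k => (k : ℝ) • (𝔤 k).subtype) ∘ₗ e.symm.toLinearMap
  have hD : ∀ (k : ℤ), ∀ X ∈ 𝔤 k, D X = (k : ℝ) • X := by
    intro k X hX
    have he : e.symm X = DirectSum.lof ℝ ℤ (fun k => 𝔤 k) k ⟨X, hX⟩ := by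
      rw [LinearEquiv.symm_apply_eq]
      exact (DirectSum.coeLinearMap_lof 𝔤 k ⟨X, hX⟩).symm
    simp only [D, LinearMap.comp_apply, LinearEquiv.coe_coe, he, DirectSum.toModule_lof]
    rfl
  have htop : ∀ X : L, X ∈ ⨆ k, 𝔤 k := fun X => by
    rw [h𝔤.submodule_iSup_eq_top]; trivial
  refine ⟨⟨D, fun a b => ?_⟩, hD⟩
  induction htop a using Submodule.iSup_induction' with
  | zero => simp
  | add x y _ _ hx hy => simp only [add_lie, map_add, lie_add, hx, hy]; abel
  | mem j x hx =>
    induction htop b using Submodule.iSup_induction' with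
    | zero => simp
    | add x y _ _ hx hy => simp only [add_lie, map_add, lie_add, hx, hy]; abel
    | mem k y hy =>
      rw [hD _ _ (hlie j k x hx y hy), hD _ _ hx, hD _ _ hy, lie_smul, lie_smul, ← lie_skew x y]
      push_cast
      module

/-- The derivation that multiplies `𝔤 k` by `k` is inner, since the Killing form is nondegenerate.
This puts each component into an eigenspace; equality follows because the components span and
eigenspaces are independent. -/
theorem exists_gradingElement {𝔤 : ℤ → Submodule ℝ L} (h𝔤 : DirectSum.IsInternal 𝔤)
    (hlie : ∀ i j, ∀ X ∈ 𝔤 i, ∀ Y ∈ 𝔤 j, ⁅X, Y⁆ ∈ 𝔤 (i + j)) :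
    ∃ E : L, ∀ k, 𝔤 k = adEigenspace E k := by
  obtain ⟨D, hD⟩ := exists_grading_derivation h𝔤 hlie
  obtain ⟨E, hE⟩ := LieDerivation.IsKilling.exists_eq_ad D
  have hle : ∀ k, 𝔤 k ≤ adEigenspace E k := fun k X hX => by
    rw [mem_adEigenspace, ← hD k X hX, ← hE, ← LieAlgebra.ad_apply (R := ℝ),
      ← LieDerivation.coe_ad_apply_eq_ad_apply]
    rfl
  refine ⟨E, fun k => le_antisymm (hle k) fun X hX => ?_⟩
  have h1 : X ∈ 𝔤 k ⊔ ⨆ j, ⨆ (_ : j ≠ k), 𝔤 j := by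
    have h2 : (⊤ : Submodule ℝ L) ≤ 𝔤 k ⊔ ⨆ j, ⨆ (_ : j ≠ k), 𝔤 j := by
      rw [← h𝔤.submodule_iSup_eq_top]
      refine iSup_le fun j => ?_
      by_cases hj : j = k
      · subst hj; exact le_sup_left
      · exact le_sup_of_le_right (le_iSup₂_of_le j hj le_rfl)
    exact h2 trivial
  obtain ⟨x, hx, y, hy, rfl⟩ := Submodule.mem_sup.1 h1
  -- The part `y` of `X` outside `𝔤 k` lies in the `k`-eigenspace and in the sum of the other
  -- eigenspaces, hence vanishes.
  have h3 : y ∈ (LieAlgebra.ad ℝ L E).eigenspace (k : ℝ) := by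
    have := Submodule.sub_mem _ hX (hle k hx)
    rwa [add_sub_cancel_left] at this
  have h4 : y ∈ ⨆ μ, ⨆ (_ : μ ≠ (k : ℝ)), (LieAlgebra.ad ℝ L E).eigenspace μ := by
    refine (iSup₂_le fun j hj => ?_ : (⨆ j, ⨆ (_ : j ≠ k), 𝔤 j) ≤ _) hy
    exact le_iSup₂_of_le (j : ℝ) (by exact_mod_cast hj) (hle j)
  have h5 := Submodule.disjoint_def.1
    (Module.End.eigenspaces_iSupIndep (LieAlgebra.ad ℝ L E) (k : ℝ)) y h3 h4
  rw [h5, add_zero]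
  exact hx

/-- Invariance of the Killing form under `ad E` gives `(j + k) B(X, Y) = 0`. -/
theorem killingForm_adEigenspace {E X Y : L} {j k : ℤ} (hX : X ∈ adEigenspace E j)
    (hY : Y ∈ adEigenspace E k) (hjk : j + k ≠ 0) : killingForm ℝ L X Y = 0 := by
  rw [mem_adEigenspace] at hX hY
  have h := LieModule.traceForm_apply_lie_apply ℝ L L X E Y
  rw [← lie_skew, hX, hY] at h
  simp only [map_neg, map_smul, LinearMap.neg_apply, LinearMap.smul_apply, smul_eq_mul] at h
  have h2 : ((j + k : ℤ) : ℝ) * LieModule.traceForm ℝ L L X Y = 0 := by push_cast; linarith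
  exact (mul_eq_zero.1 h2).resolve_left (by exact_mod_cast hjk)

theorem eq_zero_of_killingForm {X : L} (h : ∀ Y, killingForm ℝ L X Y = 0) : X = 0 :=
  (LieAlgebra.IsKilling.killingForm_nondegenerate ℝ L).1 X h

/-- A basis of eigenvectors of `ad E`, and the eigenvalues of the dual basis. -/
theorem exists_adEigenbasis {E : L} (hE : ⨆ k, adEigenspace E k = ⊤) :
    ∃ (b : Module.Basis (Fin (Module.finrank ℝ L)) ℝ L) (d : Fin (Module.finrank ℝ L) → ℤ),
      ∀ l, b l ∈ adEigenspace E (d l) ∧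
        (killingForm ℝ L).dualBasis (LieAlgebra.IsKilling.killingForm_nondegenerate ℝ L) b l ∈
          adEigenspace E (-d l) := by
  have hs : (⊤ : Submodule ℝ L) ≤ Submodule.span ℝ {X | ∃ k : ℤ, X ∈ adEigenspace E k} := by
    rw [← hE]
    exact iSup_le fun k X hX => Submodule.subset_span ⟨k, hX⟩
  let b₀ := Module.Basis.ofSpan hs
  have hfin := Module.Finite.finite_basis b₀
  let _ := @Fintype.ofFinite _ hfin
  let b := b₀.reindex (Fintype.equivFinOfCardEq (Module.finrank_eq_card_basis b₀).symm)
  have hb : ∀ l, ∃ k : ℤ, b l ∈ adEigenspace E k := fun l => by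
    simp only [b, Module.Basis.reindex_apply]
    exact Module.Basis.ofSpan_subset hs ⟨_, rfl⟩
  choose d hd using hb
  refine ⟨b, d, fun l => ⟨hd l, ?_⟩⟩
  set B := killingForm ℝ L with hB
  have hnd : B.Nondegenerate := LieAlgebra.IsKilling.killingForm_nondegenerate ℝ L
  -- By nondegeneracy it suffices to pair with the basis vectors `b m`. Invariance moves `ad E` onto
  -- `b m` with a sign, and only `m = l` contributes.
  have h0 : ⁅E, B.dualBasis hnd b l⁆ - ((-d l : ℤ) : ℝ) • B.dualBasis hnd b l = 0 := by
    refine eq_zero_of_killingForm fun Y => ?_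
    rw [← hB]
    suffices h : B (⁅E, B.dualBasis hnd b l⁆ - ((-d l : ℤ) : ℝ) • B.dualBasis hnd b l) = 0 by
      rw [h]; rfl
    refine b.ext fun m => ?_
    have h1 := LieModule.traceForm_apply_lie_apply ℝ L L (B.dualBasis hnd b l) E (b m)
    rw [← lie_skew, (mem_adEigenspace).1 (hd m)] at h1
    have h2 : B ⁅E, B.dualBasis hnd b l⁆ (b m) = -((d m : ℝ) * B (B.dualBasis hnd b l) (b m)) := by
      simp only [map_neg, map_smul, LinearMap.neg_apply, smul_eq_mul] at h1
      linarith
    rw [map_sub, LinearMap.sub_apply, h2, map_smul, LinearMap.smul_apply,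
      LinearMap.BilinForm.apply_dualBasis_left, LinearMap.zero_apply]
    by_cases hml : m = l
    · subst hml; simp
    · simp [hml]
  rw [mem_adEigenspace]
  exact sub_eq_zero.1 h0

end GradingElement

/-! ### A common kernel for eigenvalue-raising endomorphisms. -/

section Nilpotent

variable {K : Type*} [Field K] [CharZero K] {V : Type*} [AddCommGroup V] [Module K V]
  [FiniteDimensional K V]

/-- Endomorphisms raising the eigenvalues of `T` by positive integers have a common kernel. -/
theorem exists_common_kernel [Nontrivial V] (T : Module.End K V) (S : Set (Module.End K V))
    (hS : ∀ D ∈ S, ∃ k : ℕ, 1 ≤ k ∧ T * D - D * T = (k : K) • D) :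
    ∃ v : V, v ≠ 0 ∧ ∀ D ∈ S, D v = 0 := by
  by_contra! hcon
  -- Without a common kernel vector, a nonzero product `M` of elements of `S` can always be extended
  -- on the left to a nonzero one. These products are eigenvectors of `[T, ·]` with unbounded
  -- eigenvalues, which is impossible on the finite-dimensional space of endomorphisms.
  have h : ∀ n : ℕ, ∃ k : ℕ, n ≤ k ∧ ∃ M : Module.End K V, M ≠ 0 ∧ T * M - M * T = (k : K) • M := by
    intro n
    induction n with
    | zero => exact ⟨0, le_rfl, 1, one_ne_zero, by simp⟩
    | succ n ih =>
      obtain ⟨k, hk, M, hM, hT⟩ := ih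
      obtain ⟨v, hv⟩ : ∃ v, M v ≠ 0 := by
        by_contra! h0
        exact hM (LinearMap.ext h0)
      obtain ⟨D, hD, hDv⟩ := hcon (M v) hv
      obtain ⟨j, hj, hTD⟩ := hS D hD
      refine ⟨j + k, by omega, D * M, fun h0 => hDv ?_, ?_⟩
      · exact DFunLike.congr_fun h0 v
      · have : T * (D * M) - D * M * T = (T * D - D * T) * M + D * (T * M - M * T) := by
          noncomm_ring
        rw [this, hTD, hT]
        simp only [smul_mul_assoc, mul_smul_comm, Nat.cast_add, add_smul]
  let A : Module.End K (Module.End K V) := LinearMap.mulLeft K T - LinearMap.mulRight K T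
  have hA : {k : ℕ | A.HasEigenvalue (k : K)}.Finite :=
    (Module.End.finite_hasEigenvalue A).preimage (Nat.cast_injective.injOn)
  obtain ⟨m, hm⟩ := hA.bddAbove
  obtain ⟨k, hk, M, hM, hT⟩ := h (m + 1)
  have h2 : k ≤ m := hm (Module.End.hasEigenvalue_of_hasEigenvector (x := M)
    ⟨Module.End.mem_eigenspace_iff.2 (by simpa [A] using hT), hM⟩)
  omega

end Nilpotent

/-! ### Irreducible quotients of semisimple representations. -/

section Semisimple

variable {K : Type*} [Field K] {H : Type*} [Group H] {V : Type*} [AddCommGroup V] [Module K V]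
  {ρ : Representation K H V}

/-- A minimal nonzero subrepresentation is irreducible. -/
theorem isIrreducible_of_isAtom {S : Subrepresentation ρ} (hS : IsAtom S) :
    S.toRepresentation.IsIrreducible := by
  have hne : S.toSubmodule ≠ ⊥ := fun h => hS.1 (Subrepresentation.toSubmodule_injective h)
  have hnt : Nontrivial S.toSubmodule := Submodule.nontrivial_iff_ne_bot.2 hne
  refine { exists_pair_ne := ⟨⊥, ⊤, fun h => ?_⟩, eq_bot_or_eq_top := fun U => ?_ }
  · have h1 : (⊥ : Submodule K S.toSubmodule) = ⊤ := congrArg Subrepresentation.toSubmodule h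
    exact bot_ne_top h1
  · let U' : Subrepresentation ρ := ⟨U.toSubmodule.map S.toSubmodule.subtype, by
      rintro g _ ⟨v, hv, rfl⟩
      exact ⟨_, U.apply_mem_toSubmodule g hv, rfl⟩⟩
    have hle : U' ≤ S := by
      rintro _ ⟨v, hv, rfl⟩
      exact v.2
    rcases hS.le_iff.1 hle with h | h
    · left
      refine Subrepresentation.toSubmodule_injective ?_
      have h1 : U.toSubmodule.map S.toSubmodule.subtype = ⊥ :=
        congrArg Subrepresentation.toSubmodule h
      refine Submodule.map_injective_of_injective S.toSubmodule.injective_subtype ?_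
      rw [h1]
      exact (Submodule.map_bot _).symm
    · right
      refine Subrepresentation.toSubmodule_injective ?_
      have h1 : U.toSubmodule.map S.toSubmodule.subtype = S.toSubmodule :=
        congrArg Subrepresentation.toSubmodule h
      refine Submodule.map_injective_of_injective S.toSubmodule.injective_subtype ?_
      rw [h1]
      exact (Submodule.map_subtype_top _).symm

theorem isAtomic_subrepresentation [FiniteDimensional K V] : IsAtomic (Subrepresentation ρ) := by
  refine isAtomic_of_orderBot_wellFounded_lt ?_
  have h : StrictMono (Subrepresentation.toSubmodule : Subrepresentation ρ → Submodule K V) :=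
    fun a b hab => hab
  exact (h.wellFoundedLT).wf

/-- In a semisimple representation, every nonzero vector has a nonzero image under an equivariant
projection to an irreducible subrepresentation. -/
theorem exists_intertwining_irreducible [FiniteDimensional K V]
    (hρ : ρ.IsSemisimpleRepresentation) {x : V} (hx : x ≠ 0) :
    ∃ (S : Subrepresentation ρ) (Φ : ρ.IntertwiningMap S.toRepresentation),
      S.toRepresentation.IsIrreducible ∧ Φ x ≠ 0 := by
  by_contra! hcon
  -- `Q` is the intersection of the kernels of all equivariant maps to irreducible
  -- subrepresentations. If it were nonzero it would contain a minimal subrepresentation `S`, but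
  -- the projection to `S` along an invariant complement does not vanish on `S`.
  let Q : Subrepresentation ρ :=
    { toSubmodule :=
        { carrier := {x | ∀ (S : Subrepresentation ρ) (Φ : ρ.IntertwiningMap S.toRepresentation),
            S.toRepresentation.IsIrreducible → Φ x = 0}
          add_mem' := fun ha hb S Φ hS => by rw [map_add, ha S Φ hS, hb S Φ hS, add_zero]
          zero_mem' := fun S Φ hS => map_zero Φ
          smul_mem' := fun c a ha S Φ hS => by rw [map_smul, ha S Φ hS, smul_zero] }
      apply_mem_toSubmodule := fun g v hv S Φ hS => by
        rw [Φ.isIntertwining, hv S Φ hS, map_zero] }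
  have hxQ : x ∈ Q.toSubmodule := fun S Φ hS => hcon S Φ hS
  have hat := isAtomic_subrepresentation (ρ := ρ)
  rcases eq_bot_or_exists_atom_le Q with h | ⟨S, hS, hSQ⟩
  · rw [h] at hxQ
    exact hx ((Submodule.mem_bot K).1 hxQ)
  · obtain ⟨S', hSS'⟩ := hρ.exists_isCompl S
    have hc : IsCompl S.toSubmodule S'.toSubmodule := by
      constructor
      · rw [disjoint_iff]
        exact congrArg Subrepresentation.toSubmodule hSS'.inf_eq_bot
      · rw [codisjoint_iff]
        exact congrArg Subrepresentation.toSubmodule hSS'.sup_eq_top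
    let p := Submodule.projectionOnto _ _ hc
    let Φ : ρ.IntertwiningMap S.toRepresentation := ⟨p, fun g => by
      ext v
      obtain ⟨a, ha, b, hb, rfl⟩ : ∃ a ∈ S.toSubmodule, ∃ b ∈ S'.toSubmodule, a + b = v :=
        Submodule.mem_sup.1 (hc.sup_eq_top ▸ trivial)
      have h1 : ∀ a ∈ S.toSubmodule, (p a : V) = a := fun a ha => by
        have := Submodule.projectionOnto_apply_left hc ⟨a, ha⟩
        exact congrArg Subtype.val this
      have h2 : ∀ b ∈ S'.toSubmodule, p b = 0 := fun b hb =>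
        Submodule.projectionOnto_apply_right hc ⟨b, hb⟩
      simp only [LinearMap.comp_apply, map_add, h2 b hb, h2 _ (S'.apply_mem_toSubmodule g hb),
        add_zero, map_zero]
      rw [h1 _ (S.apply_mem_toSubmodule g ha)]
      change _ = ρ g (p a : V)
      rw [h1 a ha]⟩
    have hirr := isIrreducible_of_isAtom hS
    obtain ⟨v, hv, hv0⟩ := Submodule.exists_mem_ne_zero_of_ne_bot
      (fun h => hS.1 (Subrepresentation.toSubmodule_injective h) : S.toSubmodule ≠ ⊥)
    have h1 : p v = 0 := hSQ hv S Φ hirr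
    have h2 := Submodule.projectionOnto_apply_left hc ⟨v, hv⟩
    exact hv0 (congrArg Subtype.val (h2.symm.trans h1))

end Semisimple

/-! ### The nilradical `𝔭₊` and its trivial action. -/

section PositivePart

universe u

variable {𝕜 : Type*} [RCLike 𝕜]
  {EG : Type*} [NormedAddCommGroup EG] [NormedSpace ℝ EG] [FiniteDimensional ℝ EG]
  {G : Type u} [TopologicalSpace G] [ChartedSpace EG G] [Group G] [LieGroup 𝓘(ℝ, EG) ∞ G]
  [LieAlgebra.IsSemisimple ℝ (GroupLieAlgebra 𝓘(ℝ, EG) G)]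
  {EP : Type*} [NormedAddCommGroup EP] [NormedSpace ℝ EP] [FiniteDimensional ℝ EP]
  {P : Subgroup G} [ChartedSpace EP P] [LieGroup 𝓘(ℝ, EP) ∞ P]
  {W : Type*} [AddCommGroup W] [Module 𝕜 W] [FiniteDimensional 𝕜 W]

variable (EG) in
/-- The elements of `𝔭` that are orthogonal to `𝔭` with respect to the Killing form of `𝔤`, i.e. the
elements of `𝔭₊`. -/
def IsPositive (Z : GroupLieAlgebra 𝓘(ℝ, EP) P) : Prop :=
  ∀ A : GroupLieAlgebra 𝓘(ℝ, EP) P,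
    killingForm ℝ (GroupLieAlgebra 𝓘(ℝ, EG) G) (subgroupLieMap EG EP P Z)
      (subgroupLieMap EG EP P A) = 0

/-- Both `𝔭` and the Killing form are preserved by `Ad(h)`. This is the advantage of describing `𝔭₊`
by orthogonality: `P` need not preserve the grading. -/
theorem IsPositive.groupAd (hP : IsParabolicSubgroup EG EP P) (h : P)
    {Z : GroupLieAlgebra 𝓘(ℝ, EP) P} (hZ : IsPositive EG Z) :
    IsPositive EG (groupAd EP h Z) := by
  intro A
  have h1 : A = CurvedCasimir.groupAd EP h (CurvedCasimir.groupAd EP h⁻¹ A) := by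
    rw [groupAd_comp, mul_inv_cancel, groupAd_one]
  rw [h1, subgroupLieMap_groupAd hP h Z, subgroupLieMap_groupAd hP h, killingForm_groupAd]
  exact hZ _

theorem subgroupLieMap_injective (hP : IsParabolicSubgroup EG EP P) :
    Function.Injective (subgroupLieMap EG EP P) :=
  hP.injective_mfderiv 1

variable (EG) in
/-- `E ∈ 𝔭` is a grading element for the parabolic subalgebra `𝔭`. -/
structure IsGradingElement (E : GroupLieAlgebra 𝓘(ℝ, EP) P) : Prop where
  iSup_eq_top : ⨆ k, adEigenspace (subgroupLieMap EG EP P E) k = ⊤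
  range_eq : LinearMap.range (subgroupLieMap EG EP P) =
    ⨆ k : ℕ, adEigenspace (subgroupLieMap EG EP P E) (k : ℤ)

/-- The element `E` commutes with itself, so it has degree zero and lies in `𝔤₀ ⊆ 𝔭`. -/
theorem exists_isGradingElement (hP : IsParabolicSubgroup EG EP P) :
    ∃ E : GroupLieAlgebra 𝓘(ℝ, EP) P, IsGradingElement EG E := by
  obtain ⟨𝔤, h𝔤, hlie, hp⟩ := hP.parabolic
  obtain ⟨E, hE⟩ := exists_gradingElement h𝔤 hlie
  have h0 : E ∈ LinearMap.range (subgroupLieMap EG EP P) := by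
    rw [hp]
    refine Submodule.mem_iSup_of_mem 0 ?_
    rw [hE, mem_adEigenspace]
    simp
  obtain ⟨E', rfl⟩ := h0
  refine ⟨E', ?_, ?_⟩
  · simp only [← hE]
    exact h𝔤.submodule_iSup_eq_top
  · simp only [← hE]
    exact hp

namespace IsGradingElement

variable {E : GroupLieAlgebra 𝓘(ℝ, EP) P}

theorem exists_eq (hE : IsGradingElement EG E) {k : ℤ} (hk : 0 ≤ k) {X : GroupLieAlgebra 𝓘(ℝ, EG) G}
    (hX : X ∈ adEigenspace (subgroupLieMap EG EP P E) k) :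
    ∃ A, subgroupLieMap EG EP P A = X := by
  rw [← LinearMap.mem_range, hE.range_eq]
  obtain ⟨n, rfl⟩ := Int.eq_ofNat_of_zero_le hk
  exact Submodule.mem_iSup_of_mem n hX

theorem isPositive (hE : IsGradingElement EG E) {k : ℤ} (hk : 0 < k) {Z : GroupLieAlgebra 𝓘(ℝ, EP) P}
    (hZ : subgroupLieMap EG EP P Z ∈ adEigenspace (subgroupLieMap EG EP P E) k) :
    IsPositive EG Z := by
  intro A
  have hA : subgroupLieMap EG EP P A ∈ ⨆ k : ℕ, adEigenspace (subgroupLieMap EG EP P E) (k : ℤ) := by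
    rw [← hE.range_eq]
    exact LinearMap.mem_range_self _ _
  generalize subgroupLieMap EG EP P A = x at hA
  induction hA using Submodule.iSup_induction' with
  | zero => exact map_zero _
  | add x y _ _ hx hy => rw [map_add, hx, hy, add_zero]
  | mem j x hx => exact killingForm_adEigenspace hZ hx (by omega)

/-- Let `x` be the degree-zero component of `Z`. It is orthogonal to nonzero degrees for degree
reasons, and to `𝔤₀ ⊆ 𝔭` because `Z` and the remaining component `y` are. Nondegeneracy forces `x =
0`. -/
theorem mem_iSup_of_isPositive (hE : IsGradingElement EG E) {Z : GroupLieAlgebra 𝓘(ℝ, EP) P} (hZ : IsPositive EG Z) :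
    subgroupLieMap EG EP P Z ∈
      ⨆ k : ℕ, adEigenspace (subgroupLieMap EG EP P E) ((k + 1 : ℕ) : ℤ) := by
  set B := killingForm ℝ (GroupLieAlgebra 𝓘(ℝ, EG) G) with hB
  have h1 : subgroupLieMap EG EP P Z ∈ adEigenspace (subgroupLieMap EG EP P E) ((0 : ℕ) : ℤ) ⊔
      ⨆ k : ℕ, adEigenspace (subgroupLieMap EG EP P E) ((k + 1 : ℕ) : ℤ) := by
    rw [sup_iSup_nat_succ (fun k : ℕ => adEigenspace (subgroupLieMap EG EP P E) (k : ℤ)),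
      ← hE.range_eq]
    exact LinearMap.mem_range_self _ _
  obtain ⟨x, hx, y, hy, hxy⟩ := Submodule.mem_sup.1 h1
  have hy0 : ∀ w ∈ adEigenspace (subgroupLieMap EG EP P E) 0, B y w = 0 := by
    intro w hw
    clear hxy h1
    induction hy using Submodule.iSup_induction' with
    | zero => rw [map_zero]; rfl
    | add a b _ _ ha hb =>
      rw [map_add, LinearMap.add_apply, ha, hb, add_zero]
    | mem j a ha => exact killingForm_adEigenspace ha hw (by omega)
  have hx0 : x = 0 := by
    refine eq_zero_of_killingForm fun w => ?_
    have hw : w ∈ ⨆ k, adEigenspace (subgroupLieMap EG EP P E) k := by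
      rw [hE.iSup_eq_top]; trivial
    induction hw using Submodule.iSup_induction' with
    | zero => exact map_zero _
    | add a b _ _ ha hb => rw [map_add, ha, hb, add_zero]
    | mem j w hw =>
      by_cases hj : j = 0
      · subst hj
        obtain ⟨A, rfl⟩ := hE.exists_eq le_rfl hw
        have h2 := hZ A
        rw [← hxy, map_add, LinearMap.add_apply, hy0 _ hw, add_zero] at h2
        exact h2
      · exact killingForm_adEigenspace hx hw (by push_cast; omega)
  rw [hx0, zero_add] at hxy
  rw [← hxy]
  exact hy

end IsGradingElement

variable {ρ : Representation 𝕜 P W} (hρ : IsSmoothRep EP ρ)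

theorem infRep_mul_infAct_sub (A B : GroupLieAlgebra 𝓘(ℝ, EP) P) :
    infRep hρ A * infAct hρ B - infAct hρ B * infRep hρ A = infAct hρ ⁅A, B⁆ := by
  ext w
  simp only [LinearMap.sub_apply, Module.End.mul_apply, infRep_infAct, add_sub_cancel_right]

/-- The nilradical of `𝔭` acts trivially on irreducible representations of `P`. -/
theorem infAct_eq_zero_of_irreducible (hP : IsParabolicSubgroup EG EP P) (hirr : ρ.IsIrreducible)
    {Z : GroupLieAlgebra 𝓘(ℝ, EP) P} (hZ : IsPositive EG Z) : infAct hρ Z = 0 := by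
  -- The common kernel of `𝔭₊`, invariant because `Ad(g)` permutes `𝔭₊`. By irreducibility it only
  -- has to be shown nonzero.
  let K : Subrepresentation ρ :=
    { toSubmodule :=
        { carrier := {v | ∀ Z : GroupLieAlgebra 𝓘(ℝ, EP) P, IsPositive EG Z → infAct hρ Z v = 0}
          add_mem' := fun ha hb Z hZ => by rw [map_add, ha Z hZ, hb Z hZ, add_zero]
          zero_mem' := fun Z _ => map_zero _
          smul_mem' := fun c a ha Z hZ => by rw [map_smul, ha Z hZ, smul_zero] }
      apply_mem_toSubmodule := fun g v hv Z hZ => by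
        have h1 := infAct_conj hρ g (groupAd EP g⁻¹ Z) v
        rw [groupAd_comp, mul_inv_cancel, groupAd_one, hv _ (hZ.groupAd hP g⁻¹), map_zero] at h1
        exact h1.symm }
  obtain ⟨E, hE⟩ := exists_isGradingElement hP
  have hnt : Nontrivial W := by
    by_contra hW
    rw [not_nontrivial_iff_subsingleton] at hW
    obtain ⟨a, b, hab⟩ := hirr.exists_pair_ne
    exact hab (Subrepresentation.toSubmodule_injective (Subsingleton.elim _ _))
  -- For homogeneous `Z` of degree `k ≥ 1`, `[E, Z] = k Z` shows that the action of `Z` raises the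
  -- eigenvalues of `infRep hρ E` by `k`.
  obtain ⟨v, hv, hvS⟩ := exists_common_kernel (infRep hρ E)
    {D | ∃ (Z : GroupLieAlgebra 𝓘(ℝ, EP) P) (k : ℕ), 1 ≤ k ∧
      subgroupLieMap EG EP P Z ∈ adEigenspace (subgroupLieMap EG EP P E) (k : ℤ) ∧
      D = infAct hρ Z} (by
    rintro _ ⟨Z, k, hk, hZ, rfl⟩
    refine ⟨k, hk, ?_⟩
    rw [infRep_mul_infAct_sub]
    have h1 : ⁅E, Z⁆ = (k : ℝ) • Z := by
      apply subgroupLieMap_injective hP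
      rw [subgroupLieMap_lie hP, mem_adEigenspace.1 hZ, map_smul]
      simp
    ext w
    rw [h1, infAct_smul]
    simp)
  have hvK : v ∈ K.toSubmodule := by
    intro Z hZ
    let Q : Submodule ℝ (GroupLieAlgebra 𝓘(ℝ, EP) P) :=
      { carrier := {Z | infAct hρ Z v = 0}
        add_mem' := fun {a b} ha hb => by
          rw [Set.mem_ofPred_eq] at *
          rw [infAct_add, ha, hb, add_zero]
        zero_mem' := by
          have := infAct_smul hρ 0 0 v
          simpa using this
        smul_mem' := fun c a ha => by
          rw [Set.mem_ofPred_eq] at *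
          rw [infAct_smul, ha, smul_zero] }
    -- The homogeneous elements of positive degree span `𝔭₊`, so a vector killed by all of them lies
    -- in `K`.
    have hle : ⨆ k : ℕ, adEigenspace (subgroupLieMap EG EP P E) ((k + 1 : ℕ) : ℤ) ≤
        Q.map (subgroupLieMap EG EP P) := by
      refine iSup_le fun k X hX => ?_
      obtain ⟨A, rfl⟩ := hE.exists_eq (by positivity) hX
      exact ⟨A, hvS _ ⟨A, k + 1, by omega, hX, rfl⟩, rfl⟩
    obtain ⟨Z', hZ', h⟩ := hle (hE.mem_iSup_of_isPositive hZ)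
    rw [← subgroupLieMap_injective hP h]
    exact hZ'
  rcases hirr.eq_bot_or_eq_top K with h | h
  · rw [h] at hvK
    exact absurd ((Submodule.mem_bot 𝕜).1 hvK) hv
  · ext w
    have : w ∈ K.toSubmodule := by rw [h]; trivial
    exact this Z hZ

theorem IsSmoothRep.toRepresentation (hρ : IsSmoothRep EP ρ) (S : Subrepresentation ρ) :
    IsSmoothRep EP S.toRepresentation := by
  intro w
  obtain ⟨p, hp⟩ := LinearMap.exists_leftInverse_of_injective S.toSubmodule.subtype
    (LinearMap.ker_eq_bot.2 S.toSubmodule.injective_subtype)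
  have h := (hρ w).comp_linear p
  refine cast ?_ h
  congr 1
  funext g
  exact DFunLike.congr_fun hp (S.toRepresentation g w)

theorem IsSmoothRep.gr (hρ : IsSmoothRep EP ρ) {N : ℕ} (F : InvariantFiltration ρ N) (j : ℕ) :
    IsSmoothRep EP (F.gr j) := by
  intro w
  obtain ⟨w, rfl⟩ := Submodule.mkQ_surjective _ w
  exact (hρ.toRepresentation (F.step j) w).comp_linear (F.next j).mkQ

theorem infAct_eq_zero_of_semisimple (hP : IsParabolicSubgroup EG EP P)
    (hss : ρ.IsSemisimpleRepresentation)
    {Z : GroupLieAlgebra 𝓘(ℝ, EP) P} (hZ : IsPositive EG Z) : infAct hρ Z = 0 := by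
  ext w
  by_contra hw
  obtain ⟨S, Φ, hS, hΦ⟩ := exists_intertwining_irreducible hss hw
  rw [infAct_intertwining hρ (hρ.toRepresentation S), infAct_eq_zero_of_irreducible _ hP hS hZ] at hΦ
  exact hΦ rfl

end PositivePart

/-! ### Schur's lemma over the real or complex numbers. -/

section SchurLemma

variable {𝕜 : Type*} [RCLike 𝕜] {G : Type*} [Group G] {H : Subgroup G}
  {V : Type*} [AddCommGroup V] [Module 𝕜 V]
  {ρ : Representation 𝕜 H V}

theorem nontrivial_of_irreducible (hirr : ρ.IsIrreducible) : Nontrivial V := by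
  by_contra hW
  rw [not_nontrivial_iff_subsingleton] at hW
  obtain ⟨a, b, hab⟩ := hirr.exists_pair_ne
  exact hab (Subrepresentation.toSubmodule_injective (Subsingleton.elim _ _))

theorem apply_eq_zero_of_irreducible (hirr : ρ.IsIrreducible) {D : Module.End 𝕜 V}
    (hD : ∀ g v, D (ρ g v) = ρ g (D v)) (hinj : ¬ Function.Injective D) (v : V) : D v = 0 := by
  have h := hirr.eq_bot_or_eq_top
    { toSubmodule := LinearMap.ker D
      apply_mem_toSubmodule := fun g v hv => by
        rw [LinearMap.mem_ker] at *
        rw [hD, hv, map_zero] }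
  rcases h with h | h
  · exact absurd (LinearMap.ker_eq_bot.1 (congrArg Subrepresentation.toSubmodule h)) hinj
  · have h2 : v ∈ LinearMap.ker D := by
      rw [show LinearMap.ker D = ⊤ from congrArg Subrepresentation.toSubmodule h]
      trivial
    exact h2

/-- Otherwise every nonzero polynomial in `C`, being a product of irreducible ones, would be
injective; but the minimal polynomial gives the zero map. -/
theorem exists_irreducible_aeval_not_injective [FiniteDimensional 𝕜 V] [Nontrivial V]
    (C : Module.End 𝕜 V) :
    ∃ p : Polynomial 𝕜, Irreducible p ∧ ¬ Function.Injective (Polynomial.aeval C p) := by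
  by_contra! hcon
  have h : ∀ m : Polynomial 𝕜, m ≠ 0 → Function.Injective (Polynomial.aeval C m) := by
    intro m
    induction m using WfDvdMonoid.induction_on_irreducible with
    | zero => exact fun h => absurd rfl h
    | unit u hu =>
      intro _
      have h1 : IsUnit (Polynomial.aeval C u) := hu.map _
      exact ((Module.End.isUnit_iff _).1 h1).1
    | mul a p ha hp ih =>
      intro _
      rw [map_mul]
      exact (hcon p hp).comp (ih ha)
  have h1 := h (minpoly 𝕜 C) (minpoly.ne_zero (Algebra.IsIntegral.isIntegral C))
  rw [minpoly.aeval] at h1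
  obtain ⟨v, hv⟩ := exists_ne (0 : V)
  exact hv (h1 rfl)

theorem degree_eq_one_or_two {p : Polynomial 𝕜} (hp : Irreducible p) :
    p.degree = 1 ∨ ((RCLike.I : 𝕜) = 0 ∧ p.degree ≤ 2) := by
  rcases RCLike.I_eq_zero_or_im_I_eq_one (K := 𝕜) with h | h
  · right
    refine ⟨h, ?_⟩
    have h1 : Irreducible (p.map (RCLike.realRingEquiv h : 𝕜 →+* ℝ)) :=
      (MulEquiv.irreducible_iff (Polynomial.mapEquiv (RCLike.realRingEquiv h))).2 hp
    have h2 := h1.degree_le_two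
    rwa [Polynomial.degree_map] at h2
  · left
    have h1 : Irreducible (p.map (RCLike.complexRingEquiv h : 𝕜 →+* ℂ)) :=
      (MulEquiv.irreducible_iff (Polynomial.mapEquiv (RCLike.complexRingEquiv h))).2 hp
    have h2 := IsAlgClosed.degree_eq_one_of_irreducible ℂ h1
    rwa [Polynomial.degree_map] at h2

theorem exists_sq_eq_or_neg (hI : (RCLike.I : 𝕜) = 0) (δ : 𝕜) :
    ∃ s : 𝕜, δ = s * s ∨ δ = -(s * s) := by
  have h1 : δ = (RCLike.re δ : 𝕜) := by
    conv_lhs => rw [← RCLike.re_add_im δ, hI, mul_zero, add_zero]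
  refine ⟨((√|RCLike.re δ| : ℝ) : 𝕜), ?_⟩
  rw [← RCLike.ofReal_mul, Real.mul_self_sqrt (abs_nonneg _), ← RCLike.ofReal_neg]
  rcases abs_choice (RCLike.re δ) with h | h
  · left
    rw [h]
    exact h1
  · right
    rw [h, neg_neg]
    exact h1

/-- Schur's lemma over `ℝ` or `ℂ`. -/
theorem exists_scalar_or_complexStructure [FiniteDimensional 𝕜 V] (hirr : ρ.IsIrreducible)
    {C : Module.End 𝕜 V} (hC : ∀ g v, C (ρ g v) = ρ g (C v)) :
    (∃ c : 𝕜, ∀ v, C v = c • v) ∨ ((RCLike.I : 𝕜) = 0 ∧ HasInvariantComplexStructure ρ) := by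
  have := nontrivial_of_irreducible hirr
  have hlin : ∀ a b : 𝕜, ∀ g v, (a • C + b • 1) (ρ g v) = ρ g ((a • C + b • 1) v) := by
    intro a b g v
    simp [hC]
  have hscal : ∀ a b : 𝕜, a ≠ 0 → ¬ Function.Injective (a • C + b • 1 : Module.End 𝕜 V) →
      ∃ c : 𝕜, ∀ v, C v = c • v := by
    intro a b ha hinj
    refine ⟨-(a⁻¹ * b), fun v => ?_⟩
    have h := apply_eq_zero_of_irreducible hirr (hlin a b) hinj v
    simp only [LinearMap.add_apply, LinearMap.smul_apply, Module.End.one_apply] at h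
    have h2 := congrArg (a⁻¹ • ·) h
    simp only [smul_add, smul_smul, inv_mul_cancel₀ ha, one_smul, smul_zero] at h2
    rw [neg_smul]
    exact eq_neg_of_add_eq_zero_left h2
  obtain ⟨p, hp, hinj⟩ := exists_irreducible_aeval_not_injective C
  have hcomm : ∀ (q : Polynomial 𝕜) g v, Polynomial.aeval C q (ρ g v) =
      ρ g (Polynomial.aeval C q v) := by
    intro q g v
    have h0 : Commute C (ρ g) := LinearMap.ext (hC g)
    have h1 : Commute (Polynomial.aeval C q) (ρ g) := by
      induction q using Polynomial.induction_on' with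
      | add p q hp hq =>
        rw [map_add]
        exact hp.add_left hq
      | monomial n a =>
        rw [Polynomial.aeval_monomial]
        exact (Algebra.commute_algebraMap_left a _).mul_left (h0.pow_left n)
    exact DFunLike.congr_fun h1 v
  have hzero := apply_eq_zero_of_irreducible hirr (hcomm p) hinj
  have hscal1 : p.degree ≤ 1 → ∃ c : 𝕜, ∀ v, C v = c • v := by
    intro hd
    have h1 := Polynomial.eq_X_add_C_of_degree_le_one hd
    by_cases ha : p.coeff 1 = 0
    · rw [ha, Polynomial.C_0, zero_mul, zero_add] at h1
      exfalso
      exact hp.not_isUnit (by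
        rw [h1]
        refine Polynomial.isUnit_C.2 (Ne.isUnit fun h0 => hp.ne_zero ?_)
        rw [h1, h0, Polynomial.C_0])
    · refine hscal _ (p.coeff 0) ha ?_
      rw [h1] at hinj
      simpa [Algebra.smul_def, Module.End.mul_eq_comp] using hinj
  rcases degree_eq_one_or_two hp with hd | ⟨hI, hd⟩
  · exact Or.inl (hscal1 hd.le)
  · by_cases ha : p.coeff 2 = 0
    · left
      refine hscal1 (Polynomial.degree_le_iff_coeff_zero _ _ |>.2 fun m hm => ?_)
      have hm1 : 1 < m := by exact_mod_cast hm
      rcases (show m = 2 ∨ 2 < m by omega) with rfl | hm2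
      · exact ha
      · exact Polynomial.coeff_eq_zero_of_degree_lt (hd.trans_lt (by exact_mod_cast hm2))
    set a := p.coeff 2
    set b := p.coeff 1
    set c := p.coeff 0
    have hq : p = Polynomial.C a * Polynomial.X ^ 2 + Polynomial.C b * Polynomial.X +
      Polynomial.C c := Polynomial.eq_quadratic_of_degree_le_two hd
    have hC2 : ∀ v, a • C (C v) + b • C v + c • v = 0 := by
      intro v
      have := hzero v
      rw [hq] at this
      simpa [pow_two] using this
    -- Completing the square: `D² = b² - 4ac`.
    set D : Module.End 𝕜 V := (2 * a) • C + b • 1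
    have hDD : ∀ v, D (D v) = (b * b - 4 * a * c) • v := by
      intro v
      have h4 := congrArg ((4 * a) • ·) (hC2 v)
      simp only [D, LinearMap.add_apply, LinearMap.smul_apply, Module.End.one_apply, map_add,
        map_smul, smul_add, smul_zero] at h4 ⊢
      rw [← sub_eq_zero, ← h4]
      module
    have ha2 : 2 * a ≠ 0 := mul_ne_zero two_ne_zero ha
    obtain ⟨s, hs⟩ := exists_sq_eq_or_neg hI (b * b - 4 * a * c)
    by_cases hDinj : ¬ Function.Injective D
    · exact Or.inl (hscal _ _ ha2 hDinj)
    rcases hs with hs | hs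
    · left
      -- Here `(D + s)(D - s) = 0`. Either `D + s` kills a nonzero vector in the image of `D - s`,
      -- or `D - s` is zero; in both cases a non-injective equivariant map vanishes and `C` is
      -- scalar.
      by_cases h1 : ∃ v, D v - s • v ≠ 0
      · obtain ⟨v, hv⟩ := h1
        refine hscal (2 * a) (b + s) ha2 fun hin => hv (hin ?_)
        rw [map_zero]
        have : ((2 * a) • C + (b + s) • 1 : Module.End 𝕜 V) = D + s • 1 := by
          simp only [D]; module
        rw [this]
        simp only [LinearMap.add_apply, LinearMap.smul_apply, Module.End.one_apply, map_sub,
          map_smul, hDD, hs]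
        module
      · push Not at h1
        refine hscal (2 * a) (b - s) ha2 fun hin => ?_
        obtain ⟨v, hv⟩ := exists_ne (0 : V)
        refine hv (hin ?_)
        rw [map_zero]
        have : ((2 * a) • C + (b - s) • 1 : Module.End 𝕜 V) = D - s • 1 := by
          simp only [D]; module
        rw [this]
        exact h1 v
    · right
      refine ⟨hI, ?_⟩
      have hs0 : s ≠ 0 := by
        rintro rfl
        obtain ⟨v, hv⟩ := exists_ne (0 : V)
        push Not at hDinj
        have := hDD v
        rw [hs, mul_zero, neg_zero, zero_smul] at this
        exact hv (hDinj (hDinj (by rw [this, map_zero, map_zero])))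
      -- Since `D² = -s²` with `s ≠ 0`, the map `s⁻¹ D` is a complex structure.
      refine ⟨⟨s⁻¹ • D, fun g => ?_⟩, fun v => ?_⟩
      · ext v
        simp only [LinearMap.comp_apply, LinearMap.smul_apply, map_smul]
        rw [hlin]
      · change (s⁻¹ • D) ((s⁻¹ • D) v) = -v
        simp only [LinearMap.smul_apply, map_smul, hDD, hs, smul_smul]
        rw [show s⁻¹ * (s⁻¹ * -(s * s)) = -1 by field_simp, neg_one_smul]

end SchurLemma

/-! ### The curved Casimir operator on completely reducible bundles; existence of eigenvalues. -/

section AlgebraicCasimir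

universe u

variable {𝕜 : Type*} [RCLike 𝕜]
  {EG : Type*} [NormedAddCommGroup EG] [NormedSpace ℝ EG] [FiniteDimensional ℝ EG]
  {G : Type u} [TopologicalSpace G] [ChartedSpace EG G] [Group G] [LieGroup 𝓘(ℝ, EG) ∞ G]
  [LieAlgebra.IsSemisimple ℝ (GroupLieAlgebra 𝓘(ℝ, EG) G)]
  {EP : Type*} [NormedAddCommGroup EP] [NormedSpace ℝ EP] [FiniteDimensional ℝ EP]
  {P : Subgroup G} [ChartedSpace EP P] [LieGroup 𝓘(ℝ, EP) ∞ P]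
  {W : Type*} [AddCommGroup W] [Module 𝕜 W] [FiniteDimensional 𝕜 W]

theorem casimirFun_eq_sum (X : ParabolicGeometry EG EP P) {f : X.𝒢 → W} (hf : SmoothVec 𝕜 EG f)
    (u : X.𝒢) (b : Module.Basis (Fin (Module.finrank ℝ (GroupLieAlgebra 𝓘(ℝ, EG) G))) ℝ
      (GroupLieAlgebra 𝓘(ℝ, EG) G)) :
    casimirFun 𝕜 X f u = ∑ l, fundDeriv₂ 𝕜 X f u (b l)
      ((killingForm ℝ (GroupLieAlgebra 𝓘(ℝ, EG) G)).dualBasis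
        (LieAlgebra.IsKilling.killingForm_nondegenerate ℝ (GroupLieAlgebra 𝓘(ℝ, EG) G)) b l) := by
  -- Restriction of scalars supplies the real structure for which `D²f(u)` is bilinear.
  let _ : Module ℝ W := Module.compHom W (algebraMap ℝ 𝕜)
  let T : GroupLieAlgebra 𝓘(ℝ, EG) G →ₗ[ℝ] GroupLieAlgebra 𝓘(ℝ, EG) G →ₗ[ℝ] W :=
    LinearMap.mk₂ ℝ (fundDeriv₂ 𝕜 X f u) (fundDeriv₂_add_left X f u)
      (fundDeriv₂_smul_left X f u) (fundDeriv₂_add_right X hf u)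
      (fun c A B => fundDeriv₂_smul_right X hf u c A B)
  exact contraction_eq
    (LieAlgebra.IsKilling.killingForm_nondegenerate ℝ (GroupLieAlgebra 𝓘(ℝ, EG) G)) b
    (Module.finBasis ℝ (GroupLieAlgebra 𝓘(ℝ, EG) G)) T

variable {ρ : Representation 𝕜 P W} (hρ : IsSmoothRep EP ρ)

/-- On a bundle induced by a representation on which the nilradical of `𝔭` acts trivially, the
curved Casimir operator is tensorial. -/
theorem exists_casimirFun_eq (hP : IsParabolicSubgroup EG EP P)
    (htriv : ∀ Z : GroupLieAlgebra 𝓘(ℝ, EP) P, IsPositive EG Z → infAct hρ Z = 0) :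
    ∃ C : Module.End 𝕜 W, ∀ (X : ParabolicGeometry EG EP P), ∀ f ∈ Sections X ρ, ∀ u,
      casimirFun 𝕜 X f u = C (f u) := by
  obtain ⟨E, hE⟩ := exists_isGradingElement hP
  obtain ⟨b, d, hb⟩ := exists_adEigenbasis hE.iSup_eq_top
  set b' := (killingForm ℝ (GroupLieAlgebra 𝓘(ℝ, EG) G)).dualBasis
    (LieAlgebra.IsKilling.killingForm_nondegenerate ℝ (GroupLieAlgebra 𝓘(ℝ, EG) G)) b with hb'
  have h : ∀ l, ∃ C : Module.End 𝕜 W, ∀ (X : ParabolicGeometry EG EP P), ∀ f ∈ Sections X ρ,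
      ∀ u, fundDeriv₂ 𝕜 X f u (b l) (b' l) = C (f u) := by
    intro l
    rcases lt_or_ge (d l) 0 with hd | hd
    -- In negative degree the dual vector lies in `𝔭₊`, so the inner derivative vanishes identically
    -- on `𝒢`.
    · obtain ⟨Z, hZ⟩ := hE.exists_eq (k := -d l) (by omega) (hb l).2
      have hpos : IsPositive EG Z := hE.isPositive (k := -d l) (by omega) (hZ ▸ (hb l).2)
      refine ⟨0, fun X f hf u => ?_⟩
      have h0 : (fun u' => fundDeriv 𝕜 X f u' (b' l)) = fun _ => (0 : W) := by
        funext u'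
        rw [hb', ← hZ, fundDeriv_eq_infAct hρ X hf, htriv Z hpos, LinearMap.zero_apply]
      unfold fundDeriv₂
      rw [h0, LinearMap.zero_apply]
      exact dirDeriv_const _ _ _
    · obtain ⟨A, hA⟩ := hE.exists_eq hd (hb l).1
      -- The outer slot now lies in `𝔭`. The bracket of dual basis vectors has degree zero, so the
      -- derivative along it is algebraic.
      have h0 := lie_mem_adEigenspace (hb l).1 (hb l).2
      rw [add_neg_cancel] at h0
      obtain ⟨A', hA'⟩ := hE.exists_eq le_rfl h0
      rcases hd.eq_or_lt with hd0 | hd0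
      -- In degree zero both slots lie in `𝔤₀ ⊆ 𝔭`, which gives a composition of two infinitesimal
      -- actions besides the bracket term.
      · obtain ⟨B, hB⟩ := hE.exists_eq (k := -d l) (by omega) (hb l).2
        refine ⟨infAct hρ A ∘ₗ infAct hρ B + infAct hρ A', fun X f hf u => ?_⟩
        rw [← hA, fundDeriv₂_subgroupLieMap hρ hP X hf, hA, ← hA', hb', ← hB,
          fundDeriv_eq_infAct hρ X hf, fundDeriv_eq_infAct hρ X hf]
        rfl
      -- In positive degree the outer slot acts trivially and only the bracket term survives.
      · have hpos : IsPositive EG A := hE.isPositive hd0 (hA ▸ (hb l).1)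
        refine ⟨infAct hρ A', fun X f hf u => ?_⟩
        rw [← hA, fundDeriv₂_subgroupLieMap hρ hP X hf, hA, ← hA', htriv A hpos,
          fundDeriv_eq_infAct hρ X hf, LinearMap.zero_apply, zero_add]
  choose C hC using h
  refine ⟨∑ l, C l, fun X f hf u => ?_⟩
  rw [casimirFun_eq_sum X hf.1 u b, LinearMap.sum_apply]
  exact Finset.sum_congr rfl fun l _ => hC l X f hf u

theorem curvedCasimir_apply (X : ParabolicGeometry EG EP P) (σ : Sections X ρ) (u : X.𝒢) :
    (curvedCasimir X ρ σ).1 u = casimirFun 𝕜 X σ.1 u := rfl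

theorem exists_hasCasimirEigenvalue (hρ : IsSmoothRep EP ρ) (hP : IsParabolicSubgroup EG EP P) (hirr : ρ.IsIrreducible)
    (hreal : RealityCondition EG EP ρ) : ∃ c, HasCasimirEigenvalue EG EP ρ c := by
  obtain ⟨C, hC⟩ := exists_casimirFun_eq hρ hP
    (fun Z hZ => infAct_eq_zero_of_irreducible hρ hP hirr hZ)
  -- The endomorphism `C` is only determined on values of sections. Their span is invariant, hence
  -- zero or everything: in the first case all sections vanish and any scalar serves; in the second
  -- `C` is equivariant, because `𝒞` preserves equivariance of functions, and Schur's lemma applies.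
  let S : Set W := {w | ∃ (X : ParabolicGeometry EG EP P) (σ : Sections X ρ) (u : X.𝒢), σ.1 u = w}
  have hS : ∀ g, ∀ w ∈ S, ρ g w ∈ S := by
    rintro g _ ⟨X, σ, u, rfl⟩
    refine ⟨X, σ, X.act u g⁻¹, ?_⟩
    rw [σ.2.2, inv_inv]
  let V : Subrepresentation ρ :=
    { toSubmodule := Submodule.span 𝕜 S
      apply_mem_toSubmodule := fun g v hv => by
        have h1 : Submodule.span 𝕜 S ≤ (Submodule.span 𝕜 S).comap (ρ g) :=
          Submodule.span_le.2 fun w hw => Submodule.subset_span (hS g w hw)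
        exact h1 hv }
  rcases hirr.eq_bot_or_eq_top V with h | h
  · refine ⟨0, fun X σ => Subtype.ext (funext fun u => ?_)⟩
    have h1 : ∀ v ∈ Submodule.span 𝕜 S, v = 0 := by
      intro v hv
      have h2 : v ∈ V.toSubmodule := hv
      rw [h] at h2
      exact (Submodule.mem_bot 𝕜).1 h2
    rw [curvedCasimir_apply, hC X _ σ.2, h1 _ (Submodule.subset_span ⟨X, σ, u, rfl⟩), map_zero]
    simp
  · have hcomm : ∀ g v, C (ρ g v) = ρ g (C v) := by
      intro g v
      have hv : v ∈ Submodule.span 𝕜 S := by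
        have h2 : v ∈ V.toSubmodule := by rw [h]; trivial
        exact h2
      have heq : Set.EqOn (C ∘ₗ ρ g) (ρ g ∘ₗ C) S := by
        rintro _ ⟨X, σ, u, rfl⟩
        have h1 := casimirFun_act X ρ σ.2 g⁻¹ u
        rw [hC X _ σ.2, hC X _ σ.2, σ.2.2, inv_inv] at h1
        exact h1
      exact LinearMap.eqOn_span heq hv
    rcases exists_scalar_or_complexStructure hirr hcomm with ⟨c, hc⟩ | ⟨hI, hJ⟩
    · refine ⟨c, fun X σ => Subtype.ext (funext fun u => ?_)⟩
      rw [curvedCasimir_apply, hC X _ σ.2, hc]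
      rfl
    · exact hreal hI hJ

theorem curvedCasimir_sectionsMap {W' : Type*} [AddCommGroup W'] [Module 𝕜 W']
    [FiniteDimensional 𝕜 W'] {ρ' : Representation 𝕜 P W'} (X : ParabolicGeometry EG EP P)
    (Φ : ρ.IntertwiningMap ρ') (σ : Sections X ρ) :
    curvedCasimir X ρ' (sectionsMap X Φ σ) = sectionsMap X Φ (curvedCasimir X ρ σ) :=
  Subtype.ext (casimirFun_comp_linear X Φ.toLinearMap σ.2.1)

theorem sectionsMap_apply {W' : Type*} [AddCommGroup W'] [Module 𝕜 W']
    [FiniteDimensional 𝕜 W'] {ρ' : Representation 𝕜 P W'} (X : ParabolicGeometry EG EP P)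
    (Φ : ρ.IntertwiningMap ρ') (σ : Sections X ρ) (u : X.𝒢) :
    (sectionsMap X Φ σ).1 u = Φ (σ.1 u) := rfl

theorem exists_isEigenvalueSystem (hP : IsParabolicSubgroup EG EP P) (hρ : IsSmoothRep EP ρ)
    {N : ℕ} (F : InvariantFiltration ρ N)
    (hF : ∀ j ≤ N, (F.gr j).IsSemisimpleRepresentation) (i : ℕ) (W' : Subrepresentation (F.gr i))
    (hW' : W'.toRepresentation.IsIrreducible)
    (hreal' : RealityCondition EG EP W'.toRepresentation)
    (hreal : ∀ j ∈ Finset.Ioc i N, ∀ V : Subrepresentation (F.gr j),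
      V.toRepresentation.IsIrreducible → RealityCondition EG EP V.toRepresentation) :
    ∃ (μ₀ : 𝕜) (S : ℕ → Finset 𝕜), IsEigenvalueSystem EG EP F i W' μ₀ S := by
  classical
  have hgr : ∀ j, IsSmoothRep EP (F.gr j) := fun j => hρ.gr F j
  obtain ⟨μ₀, hμ₀⟩ := exists_hasCasimirEigenvalue ((hgr i).toRepresentation W') hP hW' hreal'
  have h : ∀ j, ∃ T : Finset 𝕜, j ∈ Finset.Ioc i N → ∀ V : Subrepresentation (F.gr j),
      V.toRepresentation.IsIrreducible →
        ∃ c ∈ T, HasCasimirEigenvalue EG EP V.toRepresentation c := by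
    intro j
    by_cases hj : j ∈ Finset.Ioc i N
    · obtain ⟨C, hC⟩ := exists_casimirFun_eq (hgr j) hP fun Z hZ =>
        infAct_eq_zero_of_semisimple (hgr j) hP (hF j (Finset.mem_Ioc.1 hj).2) hZ
      have hfin : Set.Finite (Module.End.HasEigenvalue C) := Module.End.finite_hasEigenvalue C
      -- A nonzero section of the bundle of `V` has a nonzero value that is an eigenvector of `C`,
      -- so only finitely many scalars occur. The extra `0` serves components whose bundles have no
      -- nonzero sections, where every scalar is an eigenvalue.
      refine ⟨insert 0 hfin.toFinset, fun _ V hV => ?_⟩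
      obtain ⟨c, hc⟩ := exists_hasCasimirEigenvalue ((hgr j).toRepresentation V) hP hV
        (hreal j hj V hV)
      by_cases hzero : ∀ (X : ParabolicGeometry EG EP P) (σ : Sections X V.toRepresentation), σ = 0
      · refine ⟨0, by simp, fun X σ => ?_⟩
        rw [hzero X σ, map_zero, smul_zero]
      · push Not at hzero
        obtain ⟨X, σ, hσ⟩ := hzero
        have hu : ∃ u, σ.1 u ≠ 0 := by
          by_contra! hcon
          exact hσ (Subtype.ext (funext hcon))
        obtain ⟨u, hu⟩ := hu
        refine ⟨c, Finset.mem_insert_of_mem (hfin.mem_toFinset.2 ?_), hc⟩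
        have h1 := curvedCasimir_sectionsMap X (inclusion V) σ
        rw [hc X σ, map_smul] at h1
        have h2 := congrArg (fun τ => τ.1 u) h1
        have h3 := hC X _ (sectionsMap X (inclusion V) σ).2 u
        refine Module.End.hasEigenvalue_of_hasEigenvector (x := (σ.1 u : F.Gr j))
          ⟨Module.End.mem_eigenspace_iff.2 ?_, ?_⟩
        · exact h3.symm.trans h2
        · exact fun h0 => hu (Subtype.ext h0)
    · exact ⟨∅, fun h => absurd h hj⟩
  choose T hT using h
  -- Filtering discards eigenvalues of `C` that do not come from an irreducible component, as
  -- `of_mem` demands.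
  refine ⟨μ₀, fun j => (T j).filter fun c => ∃ V : Subrepresentation (F.gr j),
    V.toRepresentation.IsIrreducible ∧ HasCasimirEigenvalue EG EP V.toRepresentation c,
    hμ₀, fun j hj V hV => ?_, fun j _ c hc => (Finset.mem_filter.1 hc).2⟩
  obtain ⟨c, hcT, hc⟩ := hT j hj V hV
  exact ⟨c, Finset.mem_filter.2 ⟨hcT, V, hV, hc⟩, hc⟩

end AlgebraicCasimir

/-! ### The calculus of differential and natural operators. -/

section DiffOps

universe u

variable {𝕜 : Type*} [RCLike 𝕜]
  {EG : Type*} [NormedAddCommGroup EG] [NormedSpace ℝ EG]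
  {G : Type u} [TopologicalSpace G] [ChartedSpace EG G] [Group G]
  {EP : Type*} [NormedAddCommGroup EP] [NormedSpace ℝ EP]
  {P : Subgroup G} [ChartedSpace EP P]
  {W : Type*} [AddCommGroup W] [Module 𝕜 W] [FiniteDimensional 𝕜 W]
  {W' : Type*} [AddCommGroup W'] [Module 𝕜 W'] [FiniteDimensional 𝕜 W']
  {W'' : Type*} [AddCommGroup W''] [Module 𝕜 W''] [FiniteDimensional 𝕜 W'']
  {ρ : Representation 𝕜 P W} {ρ' : Representation 𝕜 P W'} {ρ'' : Representation 𝕜 P W''}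
  {X : ParabolicGeometry EG EP P}

/-- The commutator of an operator with the multiplication by a smooth function on `M`. -/
def mulCommutator (φ : ContMDiffMap 𝓘(ℝ, EuclideanSpace ℝ (Fin X.dimM)) 𝓘(ℝ, ℝ) X.M ℝ ∞)
    (T : Sections X ρ →ₗ[𝕜] Sections X ρ') : Sections X ρ →ₗ[𝕜] Sections X ρ' :=
  T ∘ₗ mulFun X ρ φ - mulFun X ρ' φ ∘ₗ T

theorem mulCommutator_apply
    (φ : ContMDiffMap 𝓘(ℝ, EuclideanSpace ℝ (Fin X.dimM)) 𝓘(ℝ, ℝ) X.M ℝ ∞)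
    (T : Sections X ρ →ₗ[𝕜] Sections X ρ') (σ : Sections X ρ) :
    mulCommutator φ T σ = T (mulFun X ρ φ σ) - mulFun X ρ' φ (T σ) := rfl

theorem isDiffOp_zero_iff {T : Sections X ρ →ₗ[𝕜] Sections X ρ'} :
    IsDiffOp X ρ ρ' 0 T ↔ ∀ φ, mulCommutator φ T = 0 :=
  forall_congr' fun _ => ⟨fun h => LinearMap.ext fun σ => sub_eq_zero.2 (LinearMap.congr_fun h σ),
    fun h => LinearMap.ext fun σ => sub_eq_zero.1 (LinearMap.congr_fun h σ)⟩

theorem isDiffOp_succ_iff {r : ℕ} {T : Sections X ρ →ₗ[𝕜] Sections X ρ'} :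
    IsDiffOp X ρ ρ' (r + 1) T ↔ ∀ φ, IsDiffOp X ρ ρ' r (mulCommutator φ T) := Iff.rfl

variable (φ : ContMDiffMap 𝓘(ℝ, EuclideanSpace ℝ (Fin X.dimM)) 𝓘(ℝ, ℝ) X.M ℝ ∞)

theorem mulCommutator_zero : mulCommutator φ (0 : Sections X ρ →ₗ[𝕜] Sections X ρ') = 0 := by
  refine LinearMap.ext fun σ => ?_
  rw [mulCommutator_apply, LinearMap.zero_apply, LinearMap.zero_apply,
    map_zero]
  exact sub_self _

theorem mulCommutator_add (T S : Sections X ρ →ₗ[𝕜] Sections X ρ') :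
    mulCommutator φ (T + S) = mulCommutator φ T + mulCommutator φ S := by
  refine LinearMap.ext fun σ => ?_
  simp only [mulCommutator_apply, LinearMap.add_apply, map_add]
  exact add_sub_add_comm _ _ _ _

theorem mulCommutator_smul (c : 𝕜) (T : Sections X ρ →ₗ[𝕜] Sections X ρ') :
    mulCommutator φ (c • T) = c • mulCommutator φ T := by
  refine LinearMap.ext fun σ => ?_
  simp only [mulCommutator_apply, LinearMap.smul_apply, map_smul]
  exact (smul_sub _ _ _).symm

theorem mulCommutator_comp (T : Sections X ρ' →ₗ[𝕜] Sections X ρ'')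
    (S : Sections X ρ →ₗ[𝕜] Sections X ρ') :
    mulCommutator φ (T ∘ₗ S) = T ∘ₗ mulCommutator φ S + mulCommutator φ T ∘ₗ S := by
  refine LinearMap.ext fun σ => ?_
  rw [LinearMap.add_apply, LinearMap.comp_apply, LinearMap.comp_apply, mulCommutator_apply,
    mulCommutator_apply, mulCommutator_apply, map_sub]
  exact (sub_add_sub_cancel _ _ _).symm

theorem IsDiffOp.zero_map (r : ℕ) : IsDiffOp X ρ ρ' r 0 := by
  induction r with
  | zero => exact isDiffOp_zero_iff.2 mulCommutator_zero
  | succ r ih =>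
    refine isDiffOp_succ_iff.2 fun φ => ?_
    rwa [mulCommutator_zero]

theorem IsDiffOp.add {r : ℕ} {T S : Sections X ρ →ₗ[𝕜] Sections X ρ'}
    (hT : IsDiffOp X ρ ρ' r T) (hS : IsDiffOp X ρ ρ' r S) : IsDiffOp X ρ ρ' r (T + S) := by
  induction r generalizing T S with
  | zero =>
    rw [isDiffOp_zero_iff] at *
    intro φ
    rw [mulCommutator_add, hT φ, hS φ, add_zero]
  | succ r ih =>
    rw [isDiffOp_succ_iff] at *
    intro φ
    rw [mulCommutator_add]
    exact ih (hT φ) (hS φ)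

theorem IsDiffOp.smul {r : ℕ} (c : 𝕜) {T : Sections X ρ →ₗ[𝕜] Sections X ρ'}
    (hT : IsDiffOp X ρ ρ' r T) : IsDiffOp X ρ ρ' r (c • T) := by
  induction r generalizing T with
  | zero =>
    rw [isDiffOp_zero_iff] at *
    intro φ
    rw [mulCommutator_smul, hT φ, smul_zero]
  | succ r ih =>
    rw [isDiffOp_succ_iff] at *
    intro φ
    rw [mulCommutator_smul]
    exact ih (hT φ)

theorem IsDiffOp.succ {r : ℕ} {T : Sections X ρ →ₗ[𝕜] Sections X ρ'}
    (hT : IsDiffOp X ρ ρ' r T) : IsDiffOp X ρ ρ' (r + 1) T := by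
  induction r generalizing T with
  | zero =>
    refine isDiffOp_succ_iff.2 fun φ => ?_
    rw [isDiffOp_zero_iff.1 hT φ]
    exact IsDiffOp.zero_map 0
  | succ r ih => exact fun φ => ih (hT φ)

theorem IsDiffOp.mono {r s : ℕ} (hrs : r ≤ s) {T : Sections X ρ →ₗ[𝕜] Sections X ρ'}
    (hT : IsDiffOp X ρ ρ' r T) : IsDiffOp X ρ ρ' s T := by
  induction hrs with
  | refl => exact hT
  | step _ ih => exact ih.succ

/-- Induction on the total order, using the Leibniz rule `mulCommutator_comp`: each term of the
commutator lowers the order of one factor. -/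
theorem IsDiffOp.comp {r s : ℕ} {T : Sections X ρ' →ₗ[𝕜] Sections X ρ''}
    {S : Sections X ρ →ₗ[𝕜] Sections X ρ'} (hT : IsDiffOp X ρ' ρ'' r T)
    (hS : IsDiffOp X ρ ρ' s S) : IsDiffOp X ρ ρ'' (r + s) (T ∘ₗ S) := by
  obtain ⟨n, hn⟩ : ∃ n, n = r + s := ⟨_, rfl⟩
  induction n generalizing r s T S with
  | zero =>
    obtain rfl : r = 0 := by omega
    obtain rfl : s = 0 := by omega
    refine isDiffOp_zero_iff.2 fun φ => ?_
    rw [mulCommutator_comp, isDiffOp_zero_iff.1 hT, isDiffOp_zero_iff.1 hS, LinearMap.comp_zero,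
      LinearMap.zero_comp, add_zero]
  | succ n ih =>
    rw [← hn]
    refine isDiffOp_succ_iff.2 fun φ => ?_
    rw [mulCommutator_comp]
    refine IsDiffOp.add ?_ ?_
    -- A factor of order zero has vanishing commutator, so its term drops out.
    · cases s with
      | zero =>
        rw [isDiffOp_zero_iff.1 hS, LinearMap.comp_zero]
        exact IsDiffOp.zero_map _
      | succ s =>
        have := ih hT (hS φ) (by omega)
        rwa [show r + s = n by omega] at this
    · cases r with
      | zero =>
        rw [isDiffOp_zero_iff.1 hT, LinearMap.zero_comp]
        exact IsDiffOp.zero_map _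
      | succ r =>
        have := ih (hT φ) hS (by omega)
        rwa [show r + s = n by omega] at this

theorem isDiffOp_sectionsMap (Φ : ρ.IntertwiningMap ρ') :
    IsDiffOp X ρ ρ' 0 (sectionsMap X Φ) := by
  intro φ
  ext σ u
  exact map_smul Φ _ (σ.1 u)

theorem isDiffOp_id : IsDiffOp X ρ ρ 0 LinearMap.id := fun φ => by
  rw [LinearMap.id_comp, LinearMap.comp_id]

namespace IsNaturalOperator

variable {T T' : ∀ X : ParabolicGeometry EG EP P, Sections X ρ →ₗ[𝕜] Sections X ρ'}
  {S : ∀ X : ParabolicGeometry EG EP P, Sections X ρ' →ₗ[𝕜] Sections X ρ''}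

theorem add (hT : IsNaturalOperator T) (hT' : IsNaturalOperator T') :
    IsNaturalOperator (fun X => T X + T' X) where
  isDiffOp := by
    obtain ⟨r, hr⟩ := hT.isDiffOp
    obtain ⟨s, hs⟩ := hT'.isDiffOp
    exact ⟨max r s, fun X => ((hr X).mono (le_max_left r s)).add ((hs X).mono (le_max_right r s))⟩
  pullback X Y Φ hΦ σ τ h u :=
    congrArg₂ (· + ·) (hT.pullback X Y Φ hΦ σ τ h u) (hT'.pullback X Y Φ hΦ σ τ h u)

theorem smul (c : 𝕜) (hT : IsNaturalOperator T) : IsNaturalOperator (fun X => c • T X) where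
  isDiffOp := by
    obtain ⟨r, hr⟩ := hT.isDiffOp
    exact ⟨r, fun X => (hr X).smul c⟩
  pullback X Y Φ hΦ σ τ h u := congrArg (c • ·) (hT.pullback X Y Φ hΦ σ τ h u)

theorem comp (hS : IsNaturalOperator S) (hT : IsNaturalOperator T) :
    IsNaturalOperator (fun X => S X ∘ₗ T X) where
  isDiffOp := by
    obtain ⟨r, hr⟩ := hS.isDiffOp
    obtain ⟨s, hs⟩ := hT.isDiffOp
    exact ⟨r + s, fun X => (hr X).comp (hs X)⟩
  pullback X Y Φ hΦ σ τ h u :=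
    hS.pullback X Y Φ hΦ (T X σ) (T Y τ) (hT.pullback X Y Φ hΦ σ τ h) u

theorem id : IsNaturalOperator
    (fun X : ParabolicGeometry EG EP P => (LinearMap.id : Module.End 𝕜 (Sections X ρ))) where
  isDiffOp := ⟨0, fun _ => isDiffOp_id⟩
  pullback _ _ _ _ _ _ h u := h u

theorem aeval {C : ∀ X : ParabolicGeometry EG EP P, Module.End 𝕜 (Sections X ρ)}
    (hC : IsNaturalOperator C) (p : Polynomial 𝕜) :
    IsNaturalOperator (fun X => Polynomial.aeval (C X) p) := by
  induction p using Polynomial.induction_on' with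
  | add p q hp hq =>
    simp only [map_add]
    exact hp.add hq
  | monomial n a =>
    have hpow : IsNaturalOperator (fun X => C X ^ n) := by
      induction n with
      | zero =>
        simp only [pow_zero]
        exact id
      | succ n ih =>
        simp only [pow_succ']
        exact hC.comp ih
    simp only [Polynomial.aeval_monomial, ← Algebra.smul_def]
    exact hpow.smul a

end IsNaturalOperator

end DiffOps

/-! ### The curved Casimir operator is a natural operator of order two. -/

section CasimirOrder

universe u

variable {𝕜 : Type*} [RCLike 𝕜]
  {EG : Type*} [NormedAddCommGroup EG] [NormedSpace ℝ EG] [FiniteDimensional ℝ EG]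
  {G : Type u} [TopologicalSpace G] [ChartedSpace EG G] [Group G] [LieGroup 𝓘(ℝ, EG) ∞ G]
  {EP : Type*} [NormedAddCommGroup EP] [NormedSpace ℝ EP] [FiniteDimensional ℝ EP]
  {P : Subgroup G} [ChartedSpace EP P] [LieGroup 𝓘(ℝ, EP) ∞ P]
  {W : Type*} [AddCommGroup W] [Module 𝕜 W] [FiniteDimensional 𝕜 W]

/-- The derivative of a scalar function along the vector field `ω⁻¹(A)`. -/
def scalarDeriv (X : ParabolicGeometry EG EP P) (c : X.𝒢 → 𝕜) (A : GroupLieAlgebra 𝓘(ℝ, EG) G)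
    (u : X.𝒢) : 𝕜 :=
  vecDeriv c u ((X.conn u).symm A)

variable (X : ParabolicGeometry EG EP P)

theorem contMDiff_scalarDeriv {c : X.𝒢 → 𝕜} (hc : ContMDiff 𝓘(ℝ, EG) 𝓘(ℝ, 𝕜) ∞ c)
    (A : GroupLieAlgebra 𝓘(ℝ, EG) G) : ContMDiff 𝓘(ℝ, EG) 𝓘(ℝ, 𝕜) ∞ (scalarDeriv X c A) :=
  contMDiff_vecDeriv hc (X.contMDiff_conn_symm A)

theorem fundDeriv_smul {c : X.𝒢 → 𝕜} (hc : ContMDiff 𝓘(ℝ, EG) 𝓘(ℝ, 𝕜) ∞ c) {f : X.𝒢 → W}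
    (hf : SmoothVec 𝕜 EG f) (u : X.𝒢) (A : GroupLieAlgebra 𝓘(ℝ, EG) G) :
    fundDeriv 𝕜 X (fun u => c u • f u) u A =
      c u • fundDeriv 𝕜 X f u A + scalarDeriv X c A u • f u :=
  dirDeriv_smul hc hf u _

theorem fundDeriv₂_smul {c : X.𝒢 → 𝕜} (hc : ContMDiff 𝓘(ℝ, EG) 𝓘(ℝ, 𝕜) ∞ c) {f : X.𝒢 → W}
    (hf : SmoothVec 𝕜 EG f) (u : X.𝒢) (A B : GroupLieAlgebra 𝓘(ℝ, EG) G) :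
    fundDeriv₂ 𝕜 X (fun u => c u • f u) u A B =
      c u • fundDeriv₂ 𝕜 X f u A B + (scalarDeriv X c A u • fundDeriv 𝕜 X f u B +
        scalarDeriv X c B u • fundDeriv 𝕜 X f u A +
        scalarDeriv X (scalarDeriv X c B) A u • f u) := by
  have h1 : (fun u' => fundDeriv 𝕜 X (fun u => c u • f u) u' B) =
      (fun u' => c u' • fundDeriv 𝕜 X f u' B) + fun u' => scalarDeriv X c B u' • f u' :=
    funext fun u' => fundDeriv_smul X hc hf u' B
  have hB := smooth_fundDeriv X hf B
  have hcB := contMDiff_scalarDeriv X hc B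
  unfold fundDeriv₂
  rw [h1, fundDeriv_add X (SmoothVec.smul hc hB) (SmoothVec.smul hcB hf),
    fundDeriv_smul X hc hB, fundDeriv_smul X hcB hf]
  abel

theorem contMDiff_ofReal_comp_proj
    (φ : ContMDiffMap 𝓘(ℝ, EuclideanSpace ℝ (Fin X.dimM)) 𝓘(ℝ, ℝ) X.M ℝ ∞) :
    ContMDiff 𝓘(ℝ, EG) 𝓘(ℝ, 𝕜) ∞ (fun u => (φ (X.proj u) : 𝕜)) :=
  (RCLike.ofRealCLM (K := 𝕜)).contMDiff.comp (φ.contMDiff.comp X.contMDiff_proj)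

variable [LieAlgebra.IsSemisimple ℝ (GroupLieAlgebra 𝓘(ℝ, EG) G)]

variable (𝕜) in
/-- The commutator of the curved Casimir operator with the multiplication by the function `c`. -/
def casimirCommutator (c : X.𝒢 → 𝕜) (f : X.𝒢 → W) (u : X.𝒢) : W :=
  ∑ l, (scalarDeriv X c (Module.finBasis ℝ (GroupLieAlgebra 𝓘(ℝ, EG) G) l) u •
      fundDeriv 𝕜 X f u (killingDualBasis EG G l) +
    scalarDeriv X c (killingDualBasis EG G l) u •
      fundDeriv 𝕜 X f u (Module.finBasis ℝ (GroupLieAlgebra 𝓘(ℝ, EG) G) l) +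
    scalarDeriv X (scalarDeriv X c (killingDualBasis EG G l))
      (Module.finBasis ℝ (GroupLieAlgebra 𝓘(ℝ, EG) G) l) u • f u)

theorem casimirFun_smul_fun {c : X.𝒢 → 𝕜} (hc : ContMDiff 𝓘(ℝ, EG) 𝓘(ℝ, 𝕜) ∞ c) {f : X.𝒢 → W}
    (hf : SmoothVec 𝕜 EG f) (u : X.𝒢) :
    casimirFun 𝕜 X (fun u => c u • f u) u =
      c u • casimirFun 𝕜 X f u + casimirCommutator 𝕜 X c f u := by
  unfold casimirFun casimirCommutator
  rw [Finset.smul_sum, ← Finset.sum_add_distrib]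
  exact Finset.sum_congr rfl fun l _ => fundDeriv₂_smul X hc hf u _ _

/-- The symbol of the curved Casimir operator. -/
def casimirSymbol (c d : X.𝒢 → 𝕜) (u : X.𝒢) : 𝕜 :=
  ∑ l, (scalarDeriv X c (Module.finBasis ℝ (GroupLieAlgebra 𝓘(ℝ, EG) G) l) u *
      scalarDeriv X d (killingDualBasis EG G l) u +
    scalarDeriv X c (killingDualBasis EG G l) u *
      scalarDeriv X d (Module.finBasis ℝ (GroupLieAlgebra 𝓘(ℝ, EG) G) l) u)

/-- The commutator is of first order in `f`; commuting it with a second function leaves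
multiplication by a scalar function. -/
theorem casimirCommutator_smul_fun {c d : X.𝒢 → 𝕜} (hd : ContMDiff 𝓘(ℝ, EG) 𝓘(ℝ, 𝕜) ∞ d)
    {f : X.𝒢 → W} (hf : SmoothVec 𝕜 EG f) (u : X.𝒢) :
    casimirCommutator 𝕜 X c (fun u => d u • f u) u =
      d u • casimirCommutator 𝕜 X c f u + casimirSymbol X c d u • f u := by
  unfold casimirCommutator casimirSymbol
  rw [Finset.smul_sum, Finset.sum_smul, ← Finset.sum_add_distrib]
  refine Finset.sum_congr rfl fun l _ => ?_
  rw [fundDeriv_smul X hd hf, fundDeriv_smul X hd hf]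
  module

/-- Two commutators with functions reduce `𝒞` to multiplication by its symbol, which commutes with
multiplication by a third function. -/
theorem isDiffOp_curvedCasimir (ρ : Representation 𝕜 P W) :
    IsDiffOp X ρ ρ 2 (curvedCasimir X ρ) := by
  have h1 : ∀ φ σ u, ((curvedCasimir X ρ ∘ₗ mulFun X ρ φ - mulFun X ρ φ ∘ₗ curvedCasimir X ρ :
      Module.End 𝕜 (Sections X ρ)) σ).1 u =
      casimirCommutator 𝕜 X (fun u => (φ (X.proj u) : 𝕜)) σ.1 u := by
    intro φ σ u
    have h := casimirFun_smul_fun X (contMDiff_ofReal_comp_proj (𝕜 := 𝕜) X φ) σ.2.1 u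
    exact sub_eq_of_eq_add' h
  intro φ ψ
  set T := curvedCasimir X ρ ∘ₗ mulFun X ρ φ - mulFun X ρ φ ∘ₗ curvedCasimir X ρ
  have h2 : ∀ σ u, ((T ∘ₗ mulFun X ρ ψ - mulFun X ρ ψ ∘ₗ T :
      Module.End 𝕜 (Sections X ρ)) σ).1 u =
      casimirSymbol X (fun u => (φ (X.proj u) : 𝕜)) (fun u => (ψ (X.proj u) : 𝕜)) u • σ.1 u := by
    intro σ u
    have h := casimirCommutator_smul_fun X (c := fun u => (φ (X.proj u) : 𝕜))
      (contMDiff_ofReal_comp_proj (𝕜 := 𝕜) X ψ) σ.2.1 u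
    refine sub_eq_of_eq_add' ?_
    refine (h1 φ (mulFun X ρ ψ σ) u).trans (h.trans ?_)
    rw [← h1 φ σ u]
    rfl
  intro χ
  ext σ u
  refine (h2 (mulFun X ρ χ σ) u).trans ?_
  refine Eq.trans ?_ (congrArg ((χ (X.proj u) : 𝕜) • ·) (h2 σ u)).symm
  exact smul_comm _ _ _

variable {X}

/-- Compatibility with the Cartan connections means that `Φ` carries the field `ω⁻¹(A)` on `X` to
the one on `Y`. -/
theorem IsMorphism.fundDeriv_comp {Y : ParabolicGeometry EG EP P} {Φ : X.𝒢 → Y.𝒢}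
    (hΦ : IsMorphism X Y Φ) {f : Y.𝒢 → W} (hf : SmoothVec 𝕜 EG f) (u : X.𝒢)
    (A : GroupLieAlgebra 𝓘(ℝ, EG) G) :
    fundDeriv 𝕜 X (fun u => f (Φ u)) u A = fundDeriv 𝕜 Y f (Φ u) A := by
  unfold fundDeriv
  rw [dirDeriv_comp hf hΦ.contMDiff]
  congr 1
  rw [LinearEquiv.eq_symm_apply, hΦ.pullback_conn, LinearEquiv.apply_symm_apply]

theorem IsMorphism.casimirFun_comp {Y : ParabolicGeometry EG EP P} {Φ : X.𝒢 → Y.𝒢}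
    (hΦ : IsMorphism X Y Φ) {f : Y.𝒢 → W} (hf : SmoothVec 𝕜 EG f) (u : X.𝒢) :
    casimirFun 𝕜 X (fun u => f (Φ u)) u = casimirFun 𝕜 Y f (Φ u) := by
  unfold casimirFun
  refine Finset.sum_congr rfl fun l _ => ?_
  unfold fundDeriv₂
  rw [← hΦ.fundDeriv_comp (smooth_fundDeriv Y hf _)]
  congr 1
  funext v
  exact hΦ.fundDeriv_comp hf v _

theorem isNaturalOperator_curvedCasimir (ρ : Representation 𝕜 P W) :
    IsNaturalOperator (fun X : ParabolicGeometry EG EP P => curvedCasimir X ρ) where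
  isDiffOp := ⟨2, fun X => isDiffOp_curvedCasimir X ρ⟩
  pullback X Y Φ hΦ σ τ h u := by
    have h1 : σ.1 = fun u => τ.1 (Φ u) := funext h
    rw [curvedCasimir_apply, h1]
    exact hΦ.casimirFun_comp τ.2.1 u

theorem isNaturalOperator_casimirProduct (ρ : Representation 𝕜 P W) (i N : ℕ) (S : ℕ → Finset 𝕜) :
    IsNaturalOperator (fun X : ParabolicGeometry EG EP P => casimirProduct X ρ i N S) :=
  (isNaturalOperator_curvedCasimir ρ).aeval _

theorem aeval_C_mul_X_pow_succ {V : Type*} [AddCommGroup V] [Module 𝕜 V] (C : Module.End 𝕜 V)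
    (a : 𝕜) (n : ℕ) (v : V) :
    Polynomial.aeval C (Polynomial.C a * Polynomial.X ^ (n + 1)) v =
      Polynomial.aeval C (Polynomial.C a * Polynomial.X ^ n) (C v) := by
  rw [pow_succ, ← mul_assoc, map_mul, Polynomial.aeval_X, Module.End.mul_apply]

theorem aeval_curvedCasimir_sectionsMap {W' : Type*} [AddCommGroup W'] [Module 𝕜 W']
    [FiniteDimensional 𝕜 W'] {ρ : Representation 𝕜 P W} {ρ' : Representation 𝕜 P W'}
    (Φ : ρ.IntertwiningMap ρ') (p : Polynomial 𝕜) (σ : Sections X ρ) :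
    Polynomial.aeval (curvedCasimir X ρ') p (sectionsMap X Φ σ) =
      sectionsMap X Φ (Polynomial.aeval (curvedCasimir X ρ) p σ) := by
  induction p using Polynomial.induction_on generalizing σ with
  | C a => simp
  | add p q hp hq => simp [hp, hq]
  | monomial n a ih =>
    rw [aeval_C_mul_X_pow_succ, curvedCasimir_sectionsMap, ih, aeval_C_mul_X_pow_succ]

end CasimirOrder

/-! ### Cutting off locally defined smooth functions. -/

section LocalToGlobal

variable {𝕜 : Type*} [RCLike 𝕜]
  {E : Type*} [NormedAddCommGroup E] [NormedSpace ℝ E]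
  {N : Type*} [TopologicalSpace N] [ChartedSpace E N]
  {W : Type*} [AddCommGroup W] [Module 𝕜 W] [FiniteDimensional 𝕜 W]

theorem SmoothVec.restrict {f : N → W} (hf : SmoothVec 𝕜 E f) (U : TopologicalSpace.Opens N) :
    SmoothVec 𝕜 E (fun x : U => f x) :=
  fun x => contMDiffAt_subtype_iff.2 (hf x)

/-- The extension by zero of the product of a locally defined smooth function with a cut-off
function. -/
theorem SmoothVec.smul_of_tsupport {χ : N → 𝕜} (hχ : ContMDiff 𝓘(ℝ, E) 𝓘(ℝ, 𝕜) ∞ χ) {f : N → W}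
    {U : TopologicalSpace.Opens N} (hf : SmoothVec 𝕜 E (fun x : U => f x)) {K : Set N}
    (hK : IsClosed K) (hKU : K ⊆ U) (hχK : ∀ x ∉ K, χ x = 0) :
    SmoothVec 𝕜 E (fun x => χ x • f x) := by
  intro x
  -- Points of `K` lie in `U`, where both factors are smooth; off the closed set `K` the product
  -- vanishes in a neighbourhood.
  by_cases hx : x ∈ K
  · have h := SmoothVec.smul (hχ.comp (contMDiff_subtype_val (U := U))) hf ⟨x, hKU hx⟩
    exact contMDiffAt_subtype_iff (U := U) (x := ⟨x, hKU hx⟩)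
      (f := fun y => coords 𝕜 W (χ y • f y)) |>.1 h
  · refine (contMDiffAt_const (c := (0 : Fin (Module.finrank 𝕜 W) → 𝕜))).congr_of_eventuallyEq ?_
    filter_upwards [hK.isOpen_compl.mem_nhds hx] with y hy
    rw [hχK y hy, zero_smul, map_zero]

end LocalToGlobal

/-! ### Lifting sections along surjective bundle maps. -/

section Lift

universe u

variable {𝕜 : Type*} [RCLike 𝕜]
  {EG : Type*} [NormedAddCommGroup EG] [NormedSpace ℝ EG] [FiniteDimensional ℝ EG]
  {G : Type u} [TopologicalSpace G] [ChartedSpace EG G] [Group G] [LieGroup 𝓘(ℝ, EG) ∞ G]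
  {EP : Type*} [NormedAddCommGroup EP] [NormedSpace ℝ EP] [FiniteDimensional ℝ EP]
  {P : Subgroup G} [ChartedSpace EP P] [LieGroup 𝓘(ℝ, EP) ∞ P]
  {W : Type*} [AddCommGroup W] [Module 𝕜 W] [FiniteDimensional 𝕜 W]
  {W' : Type*} [AddCommGroup W'] [Module 𝕜 W'] [FiniteDimensional 𝕜 W']
  {ρ : Representation 𝕜 P W} {ρ' : Representation 𝕜 P W'}

theorem Sections.ext_apply {X : ParabolicGeometry EG EP P} {σ τ : Sections X ρ}
    (h : ∀ u, σ.1 u = τ.1 u) : σ = τ :=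
  Subtype.ext (funext h)

/-- A local trivialization of the principal bundle, as an equivariant map to `P`. -/
theorem exists_equivariant_map (X : ParabolicGeometry EG EP P) (x : X.M) :
    ∃ (U : Set X.M) (τ : X.𝒢 → P), IsOpen U ∧ x ∈ U ∧
      ContMDiffOn 𝓘(ℝ, EG) 𝓘(ℝ, EP) ∞ τ (X.proj ⁻¹' U) ∧
      ∀ u, X.proj u ∈ U → ∀ h, τ (X.act u h) = τ u * h := by
  obtain ⟨U, s, τ, hU, hx, -, hτ, -, h1, h2⟩ := X.locallyTrivial x
  refine ⟨U, τ, hU, hx, hτ, fun u hu h => ?_⟩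
  conv_lhs => rw [← h2 u hu]
  rw [← X.act_mul, h1 _ hu]

/-- The lift of an equivariant function along a linear map, in a local trivialization. -/
def localLift (ρ : Representation 𝕜 P W) (ρ' : Representation 𝕜 P W') (s : W' →ₗ[𝕜] W) (h : P) :
    W' →ₗ[𝕜] W :=
  ρ h⁻¹ ∘ₗ s ∘ₗ ρ' h

/-- With `τ(u · k) = τ(u) k`, this makes `u ↦ localLift ρ ρ' s (τ u) (σ u)` equivariant although `s`
is not. -/
theorem localLift_mul (s : W' →ₗ[𝕜] W) (h k : P) (w : W') :
    localLift ρ ρ' s (h * k) (ρ' k⁻¹ w) = ρ k⁻¹ (localLift ρ ρ' s h w) := by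
  simp only [localLift, LinearMap.comp_apply]
  rw [mul_inv_rev, map_mul, map_mul, Module.End.mul_apply, Module.End.mul_apply,
    ← Module.End.mul_apply (ρ' k), ← map_mul, mul_inv_cancel, map_one, Module.End.one_apply]

theorem apply_localLift (π : ρ.IntertwiningMap ρ') {s : W' →ₗ[𝕜] W} (hs : ∀ w, π (s w) = w) (h : P)
    (w : W') : π (localLift ρ ρ' s h w) = w := by
  simp only [localLift, LinearMap.comp_apply]
  rw [π.isIntertwining, hs, ← Module.End.mul_apply, ← map_mul, inv_mul_cancel, map_one,
    Module.End.one_apply]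

theorem smoothVec_localLift (hρ : IsSmoothRep EP ρ) (hρ' : IsSmoothRep EP ρ') (s : W' →ₗ[𝕜] W)
    {N : Type*} [TopologicalSpace N] [ChartedSpace EG N] {τ : N → P}
    (hτ : ContMDiff 𝓘(ℝ, EG) 𝓘(ℝ, EP) ∞ τ) {f : N → W'} (hf : SmoothVec 𝕜 EG f) :
    SmoothVec 𝕜 EG (fun u => localLift ρ ρ' s (τ u) (f u)) := by
  have h1 : SmoothVec 𝕜 EG (fun u => ρ' (τ u) (f u)) :=
    SmoothVec.family_apply (R := fun u => ρ' (τ u)) (fun w => (hρ' w).comp hτ) hf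
  exact SmoothVec.family_apply (R := fun u => ρ (τ u)⁻¹) (fun w => (hρ.inv w).comp hτ)
    (h1.comp_linear s)

/-- Surjective homomorphisms of natural vector bundles have right inverses. -/
theorem exists_isDiffOp_rightInverse (hρ : IsSmoothRep EP ρ) (hρ' : IsSmoothRep EP ρ')
    (π : ρ.IntertwiningMap ρ') (hπ : Function.Surjective π) (X : ParabolicGeometry EG EP P) :
    ∃ T : Sections X ρ' →ₗ[𝕜] Sections X ρ, IsDiffOp X ρ' ρ 0 T ∧
      ∀ σ, sectionsMap X π (T σ) = σ := by
  choose U τ hU hxU hτ hτact using exists_equivariant_map X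
  obtain ⟨χ, hχ⟩ := SmoothPartitionOfUnity.exists_isSubordinate
    𝓘(ℝ, EuclideanSpace ℝ (Fin X.dimM)) (s := (Set.univ : Set X.M)) isClosed_univ U hU
    (fun x _ => Set.mem_iUnion_of_mem x (hxU x))
  -- A merely linear section of `π` suffices: the trivializations correct its failure to be
  -- equivariant.
  obtain ⟨s, hs⟩ := LinearMap.exists_rightInverse_of_surjective π.toLinearMap
    (LinearMap.range_eq_top.2 hπ)
  have hs' : ∀ w, π (s w) = w := fun w => LinearMap.congr_fun hs w
  have hterm : ∀ (σ : Sections X ρ') x, SmoothVec 𝕜 EG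
      (fun u => (χ x (X.proj u) : 𝕜) • localLift ρ ρ' s (τ x u) (σ.1 u)) := by
    intro σ x
    let O : TopologicalSpace.Opens X.𝒢 :=
      ⟨X.proj ⁻¹' U x, (hU x).preimage X.contMDiff_proj.continuous⟩
    refine SmoothVec.smul_of_tsupport (U := O) (K := X.proj ⁻¹' tsupport (χ x))
      (contMDiff_ofReal_comp_proj X (χ x)) ?_
      ((isClosed_tsupport _).preimage X.contMDiff_proj.continuous)
      (Set.preimage_mono (hχ x)) (fun u hu => ?_)
    · refine smoothVec_localLift hρ hρ' s (fun u => ?_) (σ.2.1.restrict O)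
      exact contMDiffAt_subtype_iff.2 ((hτ x).contMDiffAt (O.isOpen.mem_nhds u.2))
    · rw [image_eq_zero_of_notMem_tsupport hu, RCLike.ofReal_zero]
  have hone : ∀ y, ∑ x ∈ χ.finsupport y, (χ x y : 𝕜) = 1 := by
    intro y
    rw [← RCLike.ofReal_sum, χ.sum_finsupport y (Set.mem_univ y), RCLike.ofReal_one]
  have hsmooth : ∀ σ : Sections X ρ', SmoothVec 𝕜 EG (fun u => ∑ x ∈ χ.finsupport (X.proj u),
      (χ x (X.proj u) : 𝕜) • localLift ρ ρ' s (τ x u) (σ.1 u)) := by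
    intro σ u
    -- The index set varies with the point. Near `u` it is contained in the fixed finite set
    -- `fintsupport`, and the added terms vanish.
    refine ((SmoothVec.sum (χ.fintsupport (X.proj u)) fun x _ => hterm σ x) u).congr_of_eventuallyEq
      ?_
    filter_upwards [X.contMDiff_proj.continuous.continuousAt.eventually
      (χ.eventually_finsupport_subset (X.proj u))] with v hv
    congr 1
    refine Finset.sum_subset hv fun x _ hx => ?_
    rw [χ.mem_finsupport, Function.notMem_support] at hx
    rw [hx, RCLike.ofReal_zero, zero_smul]
  refine ⟨{ toFun := fun σ => ⟨fun u => ∑ x ∈ χ.finsupport (X.proj u),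
              (χ x (X.proj u) : 𝕜) • localLift ρ ρ' s (τ x u) (σ.1 u), hsmooth σ, fun u h => ?_⟩
            map_add' := fun σ σ' => ?_
            map_smul' := fun c σ => ?_ }, fun φ => ?_, fun σ => ?_⟩
  · beta_reduce
    -- Weights and index set depend only on the base point, so equivariance can be checked term by
    -- term.
    rw [X.proj_act, map_sum]
    refine Finset.sum_congr rfl fun x hx => ?_
    have hxu : X.proj u ∈ U x := by
      refine hχ x (subset_tsupport _ ?_)
      rwa [χ.mem_finsupport] at hx
    rw [hτact x u hxu, σ.2.2, localLift_mul, map_smul]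
  · refine Sections.ext_apply fun u => ?_
    simp only [Submodule.coe_add, Pi.add_apply, map_add, smul_add, Finset.sum_add_distrib]
  · refine Sections.ext_apply fun u => ?_
    simp only [Submodule.coe_smul, Pi.smul_apply, map_smul, RingHom.id_apply, Finset.smul_sum]
    exact Finset.sum_congr rfl fun x _ => smul_comm _ _ _
  · refine LinearMap.ext fun σ => Sections.ext_apply fun u => ?_
    change ∑ x ∈ χ.finsupport (X.proj u), (χ x (X.proj u) : 𝕜) •
      localLift ρ ρ' s (τ x u) ((φ (X.proj u) : 𝕜) • σ.1 u) =
        (φ (X.proj u) : 𝕜) • ∑ x ∈ χ.finsupport (X.proj u), (χ x (X.proj u) : 𝕜) •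
          localLift ρ ρ' s (τ x u) (σ.1 u)
    rw [Finset.smul_sum]
    exact Finset.sum_congr rfl fun x _ => by rw [map_smul, smul_comm]
  · refine Sections.ext_apply fun u => ?_
    change π (∑ x ∈ χ.finsupport (X.proj u), (χ x (X.proj u) : 𝕜) •
      localLift ρ ρ' s (τ x u) (σ.1 u)) = σ.1 u
    rw [map_sum]
    simp only [map_smul, apply_localLift π hs']
    rw [← Finset.sum_smul, hone, one_smul]

end Lift

/-! ### The product of Casimir factors descends to the subquotient. -/

section Descent

universe u

variable {𝕜 : Type*} [RCLike 𝕜]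
  {EG : Type*} [NormedAddCommGroup EG] [NormedSpace ℝ EG] [FiniteDimensional ℝ EG]
  {G : Type u} [TopologicalSpace G] [ChartedSpace EG G] [Group G] [LieGroup 𝓘(ℝ, EG) ∞ G]
  [LieAlgebra.IsSemisimple ℝ (GroupLieAlgebra 𝓘(ℝ, EG) G)]
  {EP : Type*} [NormedAddCommGroup EP] [NormedSpace ℝ EP] [FiniteDimensional ℝ EP]
  {P : Subgroup G} [ChartedSpace EP P] [LieGroup 𝓘(ℝ, EP) ∞ P]
  {W : Type*} [AddCommGroup W] [Module 𝕜 W] [FiniteDimensional 𝕜 W]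
  {ρ : Representation 𝕜 P W}

/-- Sections with values in a subrepresentation. -/
theorem exists_sectionsMap_inclusion (X : ParabolicGeometry EG EP P) (V : Subrepresentation ρ)
    (σ : Sections X ρ) (h : ∀ u, σ.1 u ∈ V.toSubmodule) :
    ∃ τ : Sections X V.toRepresentation, sectionsMap X (inclusion V) τ = σ := by
  obtain ⟨p, hp⟩ := LinearMap.exists_leftInverse_of_injective V.toSubmodule.subtype
    (LinearMap.ker_eq_bot.2 V.toSubmodule.injective_subtype)
  have hp' : ∀ (w : W) (hw : w ∈ V.toSubmodule), p w = ⟨w, hw⟩ :=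
    fun w hw => LinearMap.congr_fun hp ⟨w, hw⟩
  refine ⟨⟨fun u => p (σ.1 u), σ.2.1.comp_linear p, fun u k => ?_⟩,
    Sections.ext_apply fun u => ?_⟩
  · beta_reduce
    rw [hp' _ (h u), σ.2.2, hp' _ (V.apply_mem_toSubmodule k⁻¹ (h u))]
    rfl
  · change ((p (σ.1 u) : V.toSubmodule) : W) = σ.1 u
    rw [hp' _ (h u)]

theorem sectionsMap_inclusion_injective (X : ParabolicGeometry EG EP P) (V : Subrepresentation ρ) :
    Function.Injective (sectionsMap X (inclusion V)) := fun _ _ h =>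
  Sections.ext_apply fun u => Subtype.ext (congrFun (congrArg Subtype.val h) u)

theorem aeval_curvedCasimir_of_eigenvalue {c : 𝕜} (hc : HasCasimirEigenvalue EG EP ρ c)
    (X : ParabolicGeometry EG EP P) (p : Polynomial 𝕜) (σ : Sections X ρ) :
    Polynomial.aeval (curvedCasimir X ρ) p σ = p.eval c • σ :=
  Module.End.aeval_apply_of_mem_apply_eq_smul (hc X σ)

/-- On the bundle induced by a completely reducible representation, the curved Casimir operator is
annihilated by the polynomial whose roots are its eigenvalues on the irreducible components. -/
theorem aeval_curvedCasimir_eq_zero (hss : ρ.IsSemisimpleRepresentation) (S : Finset 𝕜)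
    (hS : ∀ V : Subrepresentation ρ, V.toRepresentation.IsIrreducible →
      ∃ c ∈ S, HasCasimirEigenvalue EG EP V.toRepresentation c)
    (X : ParabolicGeometry EG EP P) (σ : Sections X ρ) :
    Polynomial.aeval (curvedCasimir X ρ) (∏ c ∈ S, (Polynomial.X - Polynomial.C c)) σ = 0 := by
  refine Sections.ext_apply fun u => ?_
  by_contra hu
  -- A nonzero value would survive some equivariant projection to an irreducible `V`. The operator
  -- commutes with this projection, and on the bundle of `V` one of its factors is zero.
  obtain ⟨V, Φ, hV, hΦ⟩ := exists_intertwining_irreducible hss hu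
  refine hΦ ?_
  obtain ⟨c, hcS, hc⟩ := hS V hV
  have h := aeval_curvedCasimir_sectionsMap Φ (∏ c ∈ S, (Polynomial.X - Polynomial.C c)) σ
  rw [aeval_curvedCasimir_of_eigenvalue hc, Polynomial.eval_prod,
    Finset.prod_eq_zero hcS (by simp), zero_smul] at h
  exact (congrFun (congrArg Subtype.val h) u).symm

variable {N : ℕ} (F : InvariantFiltration ρ N)

theorem exists_section_next (X : ParabolicGeometry EG EP P) (j : ℕ)
    (σ : Sections X (F.step j).toRepresentation) (h : sectionsMap X (F.proj j) σ = 0) :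
    ∃ τ : Sections X (F.step (j + 1)).toRepresentation,
      sectionsMap X (inclusion (F.step (j + 1))) τ = sectionsMap X (inclusion (F.step j)) σ := by
  refine exists_sectionsMap_inclusion X _ _ fun u => ?_
  have h1 : (F.next j).mkQ (σ.1 u) = 0 := congrFun (congrArg Subtype.val h) u
  rw [Submodule.mkQ_apply, Submodule.Quotient.mk_eq_zero] at h1
  exact h1

theorem casimirProduct_succ (X : ParabolicGeometry EG EP P) {i m : ℕ} (him : i ≤ m)
    (S : ℕ → Finset 𝕜) (σ : Sections X ρ) :
    casimirProduct X ρ i (m + 1) S σ =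
      Polynomial.aeval (curvedCasimir X ρ) (∏ c ∈ S (m + 1), (Polynomial.X - Polynomial.C c))
        (casimirProduct X ρ i m S σ) := by
  unfold casimirProduct
  rw [← Finset.insert_Ioc_right_eq_Ioc_add_one him, Finset.prod_insert (by simp), map_mul]
  rfl

/-- The block for `m + 1` annihilates sections of the subquotient `Wᵐ⁺¹/Wᵐ⁺²` and commutes with the
projection, so it carries sections of `Wᵐ⁺¹` to sections of `Wᵐ⁺²`. For `m = i` the product is
empty. -/
theorem casimirProduct_step (hF : ∀ j ≤ N, (F.gr j).IsSemisimpleRepresentation) {i : ℕ}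
    {S : ℕ → Finset 𝕜} (hS : ∀ j ∈ Finset.Ioc i N, ∀ V : Subrepresentation (F.gr j),
      V.toRepresentation.IsIrreducible → ∃ c ∈ S j, HasCasimirEigenvalue EG EP V.toRepresentation c)
    (X : ParabolicGeometry EG EP P) (σ : Sections X (F.step (i + 1)).toRepresentation) {m : ℕ}
    (him : i ≤ m) (hm : m ≤ N) :
    ∃ τ : Sections X (F.step (m + 1)).toRepresentation,
      sectionsMap X (inclusion (F.step (m + 1))) τ =
        casimirProduct X ρ i m S (sectionsMap X (inclusion (F.step (i + 1))) σ) := by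
  induction m, him using Nat.le_induction with
  | base =>
    refine ⟨σ, ?_⟩
    unfold casimirProduct
    simp
  | succ m him ih =>
    obtain ⟨τ, hτ⟩ := ih (by omega)
    rw [casimirProduct_succ X him, ← hτ, aeval_curvedCasimir_sectionsMap]
    refine exists_section_next F X (m + 1) _ ?_
    rw [← aeval_curvedCasimir_sectionsMap]
    exact aeval_curvedCasimir_eq_zero (hF _ hm) _
      (hS _ (Finset.mem_Ioc.2 ⟨by omega, hm⟩)) X _

variable {i : ℕ} {S : ℕ → Finset 𝕜}

/-- The operator `L` depends only on the projection of a section to `Wⁱ / Wⁱ⁺¹`. -/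
theorem casimirProduct_eq_of_proj_eq (hF : ∀ j ≤ N, (F.gr j).IsSemisimpleRepresentation)
    (hi : i ≤ N) (hS : ∀ j ∈ Finset.Ioc i N, ∀ V : Subrepresentation (F.gr j),
      V.toRepresentation.IsIrreducible → ∃ c ∈ S j, HasCasimirEigenvalue EG EP V.toRepresentation c)
    (X : ParabolicGeometry EG EP P) {τ τ' : Sections X (F.step i).toRepresentation}
    (h : sectionsMap X (F.proj i) τ = sectionsMap X (F.proj i) τ') :
    casimirProduct X (F.step i).toRepresentation i N S τ =
      casimirProduct X (F.step i).toRepresentation i N S τ' := by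
  -- The difference of the sections takes values in `Wⁱ⁺¹`, and the blocks up to `N` push it into
  -- `Wᴺ⁺¹ = 0`.
  obtain ⟨τ₁, h₁⟩ := exists_section_next F X i (τ - τ') (by rw [map_sub, sub_eq_zero]; exact h)
  obtain ⟨τ₂, h₂⟩ := casimirProduct_step F hF hS X τ₁ hi le_rfl
  have h0 : sectionsMap X (inclusion (F.step (N + 1))) τ₂ = 0 := by
    refine Sections.ext_apply fun u => ?_
    have h3 : (F.step (N + 1)).toSubmodule = ⊥ := congrArg Subrepresentation.toSubmodule F.step_last
    exact (Submodule.mem_bot 𝕜).1 (h3.le (τ₂.1 u).2)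
  rw [← sub_eq_zero, ← map_sub]
  apply sectionsMap_inclusion_injective X (F.step i)
  rw [map_zero]
  unfold casimirProduct at h₂ ⊢
  rw [← aeval_curvedCasimir_sectionsMap, ← h₁, ← h₂, h0]

theorem sectionsMap_casimirProduct {W' : Type*} [AddCommGroup W'] [Module 𝕜 W']
    [FiniteDimensional 𝕜 W'] {ρ' : Representation 𝕜 P W'} (X : ParabolicGeometry EG EP P)
    (Φ : ρ.IntertwiningMap ρ') (σ : Sections X ρ) :
    casimirProduct X ρ' i N S (sectionsMap X Φ σ) =
      sectionsMap X Φ (casimirProduct X ρ i N S σ) :=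
  aeval_curvedCasimir_sectionsMap Φ _ σ

theorem casimirProduct_of_eigenvalue {c : 𝕜} (hc : HasCasimirEigenvalue EG EP ρ c)
    (X : ParabolicGeometry EG EP P) (σ : Sections X ρ) :
    casimirProduct X ρ i N S σ = (∏ j ∈ Finset.Ioc i N, ∏ a ∈ S j, (c - a)) • σ := by
  unfold casimirProduct
  rw [aeval_curvedCasimir_of_eigenvalue hc, Polynomial.eval_prod]
  simp only [Polynomial.eval_prod, Polynomial.eval_sub, Polynomial.eval_X, Polynomial.eval_C]

/-- The pullback of a section along a morphism of parabolic geometries. -/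
theorem IsMorphism.exists_pullback {X Y : ParabolicGeometry EG EP P} {Φ : X.𝒢 → Y.𝒢}
    (hΦ : IsMorphism X Y Φ) (τ : Sections Y ρ) : ∃ σ : Sections X ρ, ∀ u, σ.1 u = τ.1 (Φ u) :=
  ⟨⟨fun u => τ.1 (Φ u), τ.2.1.comp hΦ.contMDiff, fun u h => by
    beta_reduce
    rw [hΦ.map_act, τ.2.2]⟩,
    fun _ => rfl⟩

theorem proj_surjective (j : ℕ) : Function.Surjective (F.proj j) :=
  Submodule.mkQ_surjective (F.next j)

end Descent

end CurvedCasimir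

end

/-! ### The splitting operator. -/

theorem theorem3p5
    {𝕜 : Type*} [RCLike 𝕜]
    -- the semisimple Lie group `G`
    {EG : Type*} [NormedAddCommGroup EG] [NormedSpace ℝ EG] [FiniteDimensional ℝ EG]
    {G : Type*} [TopologicalSpace G] [ChartedSpace EG G] [Group G] [LieGroup 𝓘(ℝ, EG) ∞ G]
    [LieAlgebra.IsSemisimple ℝ (GroupLieAlgebra 𝓘(ℝ, EG) G)]
    -- the parabolic subgroup `P`
    {EP : Type*} [NormedAddCommGroup EP] [NormedSpace ℝ EP] [FiniteDimensional ℝ EP]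
    (P : Subgroup G) [ChartedSpace EP P] [LieGroup 𝓘(ℝ, EP) ∞ P]
    (hP : IsParabolicSubgroup EG EP P)
    -- the representation `W` of `P` with its filtration
    {W : Type*} [AddCommGroup W] [Module 𝕜 W] [FiniteDimensional 𝕜 W]
    (ρ : Representation 𝕜 P W) (hρ : IsSmoothRep EP ρ)
    (N : ℕ) (F : InvariantFiltration ρ N)
    (hF : ∀ j ≤ N, (F.gr j).IsSemisimpleRepresentation)
    -- the irreducible component `W'` of the `i`-th subquotient
    (i : ℕ) (hi : i ≤ N) (W' : Subrepresentation (F.gr i))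
    (hW' : W'.toRepresentation.IsIrreducible)
    -- for real scalars only: the eigenvalues are real where this is not automatic
    (hreal' : RealityCondition EG EP W'.toRepresentation)
    (hreal : ∀ j ∈ Finset.Ioc i N, ∀ V : Subrepresentation (F.gr j),
      V.toRepresentation.IsIrreducible → RealityCondition EG EP V.toRepresentation) :
    -- the eigenvalues exist
    (∃ (μ₀ : 𝕜) (S : ℕ → Finset 𝕜), IsEigenvalueSystem EG EP F i W' μ₀ S) ∧
    ∀ (μ₀ : 𝕜) (S : ℕ → Finset 𝕜), IsEigenvalueSystem EG EP F i W' μ₀ S →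
      -- `L` is a natural operator on `Γ(WM)`
      IsNaturalOperator
        (fun X : ParabolicGeometry EG EP P => casimirProduct X ρ i N S) ∧
      -- and it descends to a natural operator `Γ(W'M) → Γ(WⁱM)`
      ∃ Lbar : ∀ X : ParabolicGeometry EG EP P,
          Sections X W'.toRepresentation →ₗ[𝕜] Sections X (F.step i).toRepresentation,
        IsNaturalOperator Lbar ∧
        (∀ X : ParabolicGeometry EG EP P,
          (∀ σ : Sections X W'.toRepresentation, ∃ τ : Sections X (F.step i).toRepresentation,
            sectionsMap X (F.proj i) τ = sectionsMap X (inclusion W') σ) ∧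
          (∀ (σ : Sections X W'.toRepresentation) (τ : Sections X (F.step i).toRepresentation),
            sectionsMap X (F.proj i) τ = sectionsMap X (inclusion W') σ →
            casimirProduct X ρ i N S (sectionsMap X (inclusion (F.step i)) τ) =
              sectionsMap X (inclusion (F.step i)) (Lbar X σ)) ∧
          (∀ σ : Sections X W'.toRepresentation,
            sectionsMap X (F.proj i) (Lbar X σ) =
              (∏ j ∈ Finset.Ioc i N, ∏ c ∈ S j, (μ₀ - c)) •
                sectionsMap X (inclusion W') σ)) ∧
        ((∀ j ∈ Finset.Ioc i N, μ₀ ∉ S j) → IsNaturalSplittingOperator F i W' Lbar) := by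
  refine ⟨exists_isEigenvalueSystem hP hρ F hF i W' hW' hreal' hreal, fun μ₀ S hS =>
    ⟨isNaturalOperator_casimirProduct ρ i N S, ?_⟩⟩
  choose T hT hTproj using exists_isDiffOp_rightInverse (EG := EG)
    (hρ.toRepresentation (F.step i)) (hρ.gr F i) (F.proj i) (proj_surjective F i)
  -- Composition with a chosen lift makes linearity and finite order evident; `hL` then shows that
  -- the choice is irrelevant.
  obtain ⟨Lbar, hLbar⟩ : ∃ Lbar : ∀ X : ParabolicGeometry EG EP P,
      Sections X W'.toRepresentation →ₗ[𝕜] Sections X (F.step i).toRepresentation,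
      Lbar = fun X => casimirProduct X (F.step i).toRepresentation i N S ∘ₗ T X ∘ₗ
        sectionsMap X (inclusion W') := ⟨_, rfl⟩
  have hL : ∀ X σ τ, sectionsMap X (F.proj i) τ = sectionsMap X (inclusion W') σ →
      casimirProduct X (F.step i).toRepresentation i N S τ = Lbar X σ := by
    intro X σ τ h
    rw [hLbar]
    refine casimirProduct_eq_of_proj_eq F hF hi hS.exists_mem X ?_
    rw [h]
    exact (hTproj X _).symm
  have hlift : ∀ X (σ : Sections X W'.toRepresentation),
      ∃ τ : Sections X (F.step i).toRepresentation,
        sectionsMap X (F.proj i) τ = sectionsMap X (inclusion W') σ :=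
    fun X σ => ⟨_, hTproj X _⟩
  have hproj : ∀ X (σ : Sections X W'.toRepresentation), sectionsMap X (F.proj i) (Lbar X σ) =
      (∏ j ∈ Finset.Ioc i N, ∏ c ∈ S j, (μ₀ - c)) • sectionsMap X (inclusion W') σ := by
    intro X σ
    obtain ⟨τ, hτ⟩ := hlift X σ
    -- The projection and the inclusion of `W'` commute with the product, which reduces the claim to
    -- the bundle of `W'`, where `𝒞` is `μ₀`.
    rw [← hL X σ τ hτ, ← sectionsMap_casimirProduct, hτ, sectionsMap_casimirProduct,
      casimirProduct_of_eigenvalue hS.eigenvalue, map_smul]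
  have hnat : IsNaturalOperator Lbar := by
    refine ⟨?_, fun X Y Φ hΦ σ τ h u => ?_⟩
    · obtain ⟨r, hr⟩ := (isNaturalOperator_casimirProduct (EG := EG) (EP := EP)
        (F.step i).toRepresentation i N S).isDiffOp
      rw [hLbar]
      -- Lift and inclusion have order zero, so the bound does not depend on the geometry.
      exact ⟨r + (0 + 0), fun X => (hr X).comp ((hT X).comp (isDiffOp_sectionsMap _))⟩
    -- The lift `T` is not natural. However, the pullback of a lift of `τ` is a lift of `σ`, and any
    -- lift computes `Lbar`.
    · obtain ⟨τ', hτ'⟩ := hlift Y τ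
      obtain ⟨σ', hσ'⟩ := hΦ.exists_pullback τ'
      have h1 : sectionsMap X (F.proj i) σ' = sectionsMap X (inclusion W') σ := by
        refine Sections.ext_apply fun v => ?_
        rw [sectionsMap_apply, sectionsMap_apply, hσ', h]
        exact congrFun (congrArg Subtype.val hτ') (Φ v)
      rw [← hL X σ σ' h1, ← hL Y τ τ' hτ']
      exact (isNaturalOperator_casimirProduct (F.step i).toRepresentation i N S).pullback
        X Y Φ hΦ σ' τ' hσ' u
  refine ⟨Lbar, hnat, fun X => ⟨hlift X, fun σ τ h => ?_, hproj X⟩, fun hne => ?_⟩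
  · rw [sectionsMap_casimirProduct, hL X σ τ h]
  · have hc : (∏ j ∈ Finset.Ioc i N, ∏ c ∈ S j, (μ₀ - c)) ≠ 0 := by
      refine Finset.prod_ne_zero_iff.2 fun j hj => Finset.prod_ne_zero_iff.2 fun c hc => ?_
      rw [sub_ne_zero]
      rintro rfl
      exact hne j hj hc
    refine ⟨hnat, fun X σ τ h => ?_, _, hc, hproj⟩
    -- Applying `π` to `Lbar X σ = Lbar X τ` leaves the same nonzero multiple of `σ` and of `τ`.
    have h1 := congrArg (sectionsMap X (F.proj i)) h
    rw [hproj, hproj] at h1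
    exact sectionsMap_inclusion_injective X W' (smul_right_injective _ hc h1)
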